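/- Let $n \ge 2$, $k \ge 1$, $R > 0$, and let $\mathbb S_R^{n+k} \subset \mathbb R^{n+k+1}$ be the sphere of radius $R$ about the origin, of sectional curvature $K = R^{-2}$. Let $\mathcal M^n$ be a compact connected smooth manifold without boundary, and let $F : \mathcal M^n \times (-\infty, 0) \to \mathbb S_R^{n+k}$ be an ancient solution of the mean curvature flow, that is, a smooth map such that each $F(\cdot, t)$ is an immersion and $\partial_t F = H$, where $h$ and $H$ denote the second fundamental form and the mean curvature vector of $F(\cdot,t)$ as a submanifold of $\mathbb S_R^{n+k}$ ($H$ being the trace of $h$). Assume $|H| > 0$ on $\mathcal M \times (-\infty, 0)$, and write $\mathcal M_t = F(\mathcal M, t)$. 1. Suppose that either $n = 4$ and there is a $\delta > 0$ such that $|h|^2 - \frac13 |H|^2 \le (2 - \delta) K$ for all $t < 0$, or $n \ge 5$ and $|h|^2 - \frac{1}{n-1} |H|^2 \le 2K$ for all $t < 0$. Then $\mathcal M_t$ is either a shrinking spherical cap or a totally geodesic sphere. 2. If $|h|^2 \le \frac{4}{3n} |H|^2$ for all $t < 0$, then $\mathcal M_t$ is a shrinking spherical cap. Here $\mathcal M_t$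 is a *shrinking spherical cap* if there are an $(n+2)$-dimensional linear subspace $V \subset \mathbb R^{n+k+1}$, a unit vector $p \in V$ and a time $T \ge 0$ such that, for all $t < 0$, $$\mathcal M_t = \{\, y \in V : |y| = R,\ \langle y, p\rangle = R\, e^{nK(t - T)} \,\}$$ (a geodesic $n$-sphere about the pole $Rp$ in a totally geodesic $\mathbb S_R^{n+1}$, tending to the equator as $t \to -\infty$ and shrinking towards the pole as time increases, which it would reach at time $T$); and $\mathcal M_t$ is a *totally geodesic sphere* if there is an $(n+1)$-dimensional linear subspace $V$ with $\mathcal M_t = V \cap \mathbb S_R^{n+k}$ for all $t < 0$. -/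

import Mathlib

open scoped Manifold ContDiff

noncomputable section

namespace SphereMCF

/-- The Euclidean space in which the sphere `S_R^{n+k}` of radius `R` about the origin sits. -/
abbrev Ambient (n k : ℕ) : Type := EuclideanSpace ℝ (Fin (n + k + 1))

/-- The map `f` read in the preferred chart of `M` around `x`. -/
def inChart {n k : ℕ} {M : Type*} [TopologicalSpace M] [ChartedSpace (EuclideanSpace ℝ (Fin n)) M]
    (f : M → Ambient n k) (x : M) : EuclideanSpace ℝ (Fin n) → Ambient n k :=
  fun y => f ((extChartAt (𝓡 n) x).symm y)

/-- The coordinate tangent vector `∂ᵢ f` at `x`. -/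
def tangentVec {n k : ℕ} {M : Type*} [TopologicalSpace M]
    [ChartedSpace (EuclideanSpace ℝ (Fin n)) M]
    (f : M → Ambient n k) (x : M) (i : Fin n) : Ambient n k :=
  fderiv ℝ (inChart f x) (extChartAt (𝓡 n) x x) (EuclideanSpace.single i 1)

/-- The second coordinate derivative `∂ᵢ ∂ⱼ f` at `x`, taken in the Euclidean space. -/
def secondDeriv {n k : ℕ} {M : Type*} [TopologicalSpace M]
    [ChartedSpace (EuclideanSpace ℝ (Fin n)) M]
    (f : M → Ambient n k) (x : M) (i j : Fin n) : Ambient n k :=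
  fderiv ℝ (fun y => fderiv ℝ (inChart f x) y (EuclideanSpace.single j 1))
    (extChartAt (𝓡 n) x x) (EuclideanSpace.single i 1)

/-- The induced metric `g_{ij} = ⟨∂ᵢ f, ∂ⱼ f⟩` at `x`. -/
def metric {n k : ℕ} {M : Type*} [TopologicalSpace M]
    [ChartedSpace (EuclideanSpace ℝ (Fin n)) M]
    (f : M → Ambient n k) (x : M) : Matrix (Fin n) (Fin n) ℝ :=
  Matrix.of fun i j => inner ℝ (tangentVec f x i) (tangentVec f x j)

/-- The normal space at `x` of `f`, as a submanifold of the sphere about the origin: the vectors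
orthogonal to the position vector `f x` (hence tangent to the sphere) and to every `∂ᵢ f`. -/
def normalSpace {n k : ℕ} {M : Type*} [TopologicalSpace M]
    [ChartedSpace (EuclideanSpace ℝ (Fin n)) M]
    (f : M → Ambient n k) (x : M) : Submodule ℝ (Ambient n k) :=
  (Submodule.span ℝ (insert (f x) (Set.range (tangentVec f x))))ᗮ

/-- The second fundamental form `h_{ij}` at `x` of `f` as a submanifold of the sphere. The
Levi-Civita connection of the sphere is the tangential part of the Euclidean derivative, so `h_{ij}`
is the component of `∂ᵢ ∂ⱼ f` in the normal space. -/
def secondFundForm {n k : ℕ} {M : Type*} [TopologicalSpace M]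
    [ChartedSpace (EuclideanSpace ℝ (Fin n)) M]
    (f : M → Ambient n k) (x : M) (i j : Fin n) : Ambient n k :=
  (normalSpace f x).starProjection (secondDeriv f x i j)

/-- The mean curvature vector `H = g^{ij} h_{ij}`. -/
def meanCurv {n k : ℕ} {M : Type*} [TopologicalSpace M]
    [ChartedSpace (EuclideanSpace ℝ (Fin n)) M]
    (f : M → Ambient n k) (x : M) : Ambient n k :=
  ∑ i, ∑ j, (metric f x)⁻¹ i j • secondFundForm f x i j

/-- The squared norm `|h|² = g^{ip} g^{jq} ⟨h_{ij}, h_{pq}⟩` of the second fundamental form. -/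
def secondFundFormNormSq {n k : ℕ} {M : Type*} [TopologicalSpace M]
    [ChartedSpace (EuclideanSpace ℝ (Fin n)) M]
    (f : M → Ambient n k) (x : M) : ℝ :=
  ∑ i, ∑ j, ∑ p, ∑ q, (metric f x)⁻¹ i p * (metric f x)⁻¹ j q *
    inner ℝ (secondFundForm f x i j) (secondFundForm f x p q)

/-- `F : M × (-∞, 0) → S_R^{n+k}` is an ancient solution of the mean curvature flow in the sphere
of radius `R`: a smooth family of immersions into the sphere with `∂_t F = H`. The values of `F` at
times `t ≥ 0` play no role. -/
structure IsAncientSolution {n k : ℕ} {M : Type*} [TopologicalSpace M]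
    [ChartedSpace (EuclideanSpace ℝ (Fin n)) M] (R : ℝ) (F : ℝ → M → Ambient n k) : Prop where
  mem_sphere : ∀ t < 0, ∀ x, F t x ∈ Metric.sphere (0 : Ambient n k) R
  smooth : ContMDiffOn (𝓘(ℝ, ℝ).prod (𝓡 n)) 𝓘(ℝ, Ambient n k) ∞
    (fun z : ℝ × M => F z.1 z.2) (Set.Iio 0 ×ˢ Set.univ)
  immersion : ∀ t < 0, ∀ x, Function.Injective (mfderiv (𝓡 n) 𝓘(ℝ, Ambient n k) (F t) x)
  flow : ∀ t < 0, ∀ x, HasDerivAt (fun s => F s x) (meanCurv (F t) x) t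

/-- The family `Γ t`, `t < 0`, of subsets of the sphere of radius `R` is a shrinking spherical cap:
inside a fixed totally geodesic `(n+1)`-sphere, with unit pole `p`, each `Γ t` is the geodesic
`n`-sphere about `R p` of polar angle `θ(t)`, where `cos θ(t) = exp (n (t - T) / R²)`. The family
leaves the equator at `t = -∞` and would shrink to the pole at the time `T ≥ 0`. -/
def IsShrinkingSphericalCap {n k : ℕ} (R : ℝ) (Γ : ℝ → Set (Ambient n k)) : Prop :=
  ∃ (V : Submodule ℝ (Ambient n k)) (p : Ambient n k) (T : ℝ),
    Module.finrank ℝ V = n + 2 ∧ p ∈ V ∧ ‖p‖ = 1 ∧ 0 ≤ T ∧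
    ∀ t < 0, Γ t = {y | y ∈ V ∧ y ∈ Metric.sphere (0 : Ambient n k) R ∧
      inner ℝ y p = R * Real.exp (n * (t - T) / R ^ 2)}

/-- The family `Γ t`, `t < 0`, is a (static) totally geodesic `n`-sphere in the sphere of
radius `R`. -/
def IsTotallyGeodesicSphere {n k : ℕ} (R : ℝ) (Γ : ℝ → Set (Ambient n k)) : Prop :=
  ∃ V : Submodule ℝ (Ambient n k), Module.finrank ℝ V = n + 1 ∧
    ∀ t < 0, Γ t = {y | y ∈ V ∧ y ∈ Metric.sphere (0 : Ambient n k) R}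

end SphereMCF

end

/-! A maximum principle started at ever earlier times forces the trace-free second fundamental form
to vanish, and a totally umbilic flow with H ≠ 0 can be integrated explicitly.

Put φ = |h|² - |H|²/n and W = |H|²/(3n) + bK. As 1/n + 1/(3n) = 4/(3n), each pinching hypothesis
gives φ ≤ W for some b ≥ 0 with 2b < n. Let ε = (n - 2b)K. At a point where φ = λW with 0 < λ ≤ 1,
the gradient terms in (∂_t - Δ)(φ - λW) have a good sign because |∇h|² ≥ 3/(n+2) |∇H|²
(`three_mul_sum_trace_sq_le`), and the reaction terms are at most -2εφ (`quarticReaction_le`,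
`reaction_le`). So e^{εt} φ/W has no new positive maximum (`not_pinching_max`), whence φ(t₂) ≤
e^{-ε(t₂ - t₁)} W(t₂) for all t₁ < t₂ < 0 (`pinching_decay`). Letting t₁ → -∞ gives φ = 0.

For an umbilic slice, the Codazzi equation and n ≥ 2 make H parallel. Thus |H|² = s is constant on
the slice, and so is H + (s/n)F, which yields a centre q. The linear space U spanned by F - q and
the tangent space is the same at all points, and the slice is the whole round sphere of q + U
(`exists_slice`). In time, differences F(x) - F(x') are only rescaled, so U is fixed, and the centre
obeys q' = nKq. Hence q = e^{nKt} p₀, which is the law of a shrinking cap. The totally geodesic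
alternative never arises, since |H| > 0.

The evolution equations are computed in an `ImmersionJet`: a ring of germs with commuting
derivations, at the origin of coordinates in which the slice is a graph over its tangent plane.
There the Christoffel symbols vanish, and the commutation of fourth partial derivatives (`q_symm`)
replaces Simons' identity. The immersion is viewed in Euclidean space, where |h|² grows by nK and
|H|² by n²K, so that φ is unchanged. -/

open scoped Manifold ContDiff

noncomputable section

namespace SphereMCF

/-! ### Algebraic inequalities for the reaction and gradient terms. -/

section TensorAlgebra

open Matrix Finset

/-- The diagonal case of `trace_mul_sq_add_commutator_le`. -/
theorem diagonal_trace_mul_sq_add_commutator_le {n : ℕ} (d : Fin n → ℝ)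
    (B : Matrix (Fin n) (Fin n) ℝ) (hB : Bᵀ = B) :
    (diagonal d * B).trace ^ 2
        + 2 * (diagonal d * diagonal d * B * B).trace
        - 2 * (diagonal d * B * diagonal d * B).trace
      ≤ 2 * (diagonal d * diagonal d).trace * (B * B).trace := by
  have hs : ∀ i j, B i j = B j i := fun i j => congrFun (congrFun hB j) i
  have e1 : (diagonal d * B).trace = ∑ i, d i * B i i := by
    simp [Matrix.trace, Matrix.diagonal_mul]
  have e2 : (diagonal d * diagonal d * B * B).trace = ∑ i, ∑ j, d i ^ 2 * B i j ^ 2 := by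
    rw [Matrix.diagonal_mul_diagonal]
    rw [Matrix.mul_assoc]
    refine sum_congr rfl fun i _ => ?_
    rw [Matrix.diag_apply, Matrix.diagonal_mul, Matrix.mul_apply, mul_sum]
    refine sum_congr rfl fun j _ => ?_
    rw [hs j i]; ring
  have e3 : (diagonal d * B * diagonal d * B).trace = ∑ i, ∑ j, d i * d j * B i j ^ 2 := by
    simp only [Matrix.trace, Matrix.diag, Matrix.mul_apply (M := diagonal d * B * diagonal d),
      Matrix.diagonal_mul, Matrix.mul_diagonal]
    refine sum_congr rfl fun i _ => sum_congr rfl fun j _ => ?_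
    rw [hs j i]; ring
  have e4 : (diagonal d * diagonal d).trace = ∑ i, d i ^ 2 := by
    simp [Matrix.trace, Matrix.diagonal_mul_diagonal, sq]
  have e5 : (B * B).trace = ∑ i, ∑ j, B i j ^ 2 := by
    simp only [Matrix.trace, Matrix.diag, Matrix.mul_apply]
    refine sum_congr rfl fun i _ => sum_congr rfl fun j _ => ?_
    rw [hs j i]; ring
  have e2' : ∑ i, ∑ j, d i ^ 2 * B i j ^ 2 = ∑ i, ∑ j, d j ^ 2 * B i j ^ 2 := by
    rw [sum_comm]
    exact sum_congr rfl fun i _ => sum_congr rfl fun j _ => by rw [hs j i]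
  set D := ∑ i, d i ^ 2 with hD
  have hdle : ∀ i, d i ^ 2 ≤ D := fun i =>
    single_le_sum (f := fun i => d i ^ 2) (fun _ _ => sq_nonneg _) (mem_univ i)
  have cs : (∑ i, d i * B i i) ^ 2 ≤ D * ∑ i, B i i ^ 2 := sum_mul_sq_le_sq_mul_sq _ _ _
  -- The squared norm of the commutator is Σ (d i - d j)² (B i j)². Off the diagonal (d i - d j)² ≤
  -- 2(d i² + d j²) ≤ 2D. On the diagonal this factor is zero, which leaves room for the term D (B i
  -- i)² that `cs` needs to bound the squared trace.
  have key : ∀ i j, (d i - d j) ^ 2 * B i j ^ 2 + (if i = j then D * B i i ^ 2 else 0)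
      ≤ 2 * D * B i j ^ 2 := by
    intro i j
    by_cases h : i = j
    · subst h
      simp only [if_true, sub_self]
      nlinarith [sq_nonneg (B i i), hdle i, mul_nonneg ((sq_nonneg (d i)).trans (hdle i))
        (sq_nonneg (B i i))]
    · simp only [h, if_false, add_zero]
      have hij : d i ^ 2 + d j ^ 2 ≤ D := by
        rw [hD, ← sum_pair h (f := fun i => d i ^ 2)]
        exact sum_le_sum_of_subset_of_nonneg (subset_univ _) fun _ _ _ => sq_nonneg _
      refine mul_le_mul_of_nonneg_right ?_ (sq_nonneg _)
      nlinarith [sq_nonneg (d i + d j)]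
  have hsum := sum_le_sum fun i (_ : i ∈ univ) => sum_le_sum fun j (_ : j ∈ univ) => key i j
  simp only [sum_add_distrib, sum_ite_eq, mem_univ, if_true] at hsum
  simp only [← mul_sum] at hsum
  have e6 : ∑ i, ∑ j, (d i - d j) ^ 2 * B i j ^ 2
      = 2 * ∑ i, ∑ j, d i ^ 2 * B i j ^ 2 - 2 * ∑ i, ∑ j, d i * d j * B i j ^ 2 := by
    rw [two_mul]
    nth_rewrite 2 [e2']
    simp only [mul_sum, ← sum_add_distrib, ← sum_sub_distrib]
    exact sum_congr rfl fun i _ => sum_congr rfl fun j _ => by ring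
  rw [e1, e2, e3, e4, e5]
  linarith

/-- For symmetric matrices |[A,B]|² = 2 tr(A²B²) - 2 tr(ABAB), so this is ⟨A,B⟩² + |[A,B]|² ≤
2|A|²|B|². Both sides are invariant under simultaneous orthogonal conjugation, which reduces it to
diagonal A. -/
theorem trace_mul_sq_add_commutator_le {n : ℕ} (A B : Matrix (Fin n) (Fin n) ℝ)
    (hA : Aᵀ = A) (hB : Bᵀ = B) :
    (A * B).trace ^ 2 + 2 * (A * A * B * B).trace - 2 * (A * B * A * B).trace
      ≤ 2 * (A * A).trace * (B * B).trace := by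
  have hA' : A.IsHermitian := by
    rw [Matrix.IsHermitian, Matrix.conjTranspose_eq_transpose_of_trivial, hA]
  obtain ⟨U, V, d, hUV, hVU, hAd, hVt⟩ : ∃ (U V : Matrix (Fin n) (Fin n) ℝ) (d : Fin n → ℝ),
      U * V = 1 ∧ V * U = 1 ∧ A = U * diagonal d * V ∧ V = Uᵀ := by
    refine ⟨(hA'.eigenvectorUnitary : Matrix (Fin n) (Fin n) ℝ),
      star (hA'.eigenvectorUnitary : Matrix (Fin n) (Fin n) ℝ), hA'.eigenvalues, ?_, ?_, ?_, ?_⟩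
    · exact Unitary.coe_mul_star_self _
    · exact Unitary.coe_star_mul_self _
    · have := hA'.spectral_theorem
      simpa [Unitary.conjStarAlgAut_apply, Function.comp_def] using this
    · rw [Matrix.star_eq_conjTranspose, Matrix.conjTranspose_eq_transpose_of_trivial]
  set D := diagonal d
  set C := V * B * U with hC
  have hCt : Cᵀ = C := by
    rw [hC, Matrix.transpose_mul, Matrix.transpose_mul, hB, hVt, Matrix.transpose_transpose,
      Matrix.mul_assoc]
  have hBC : B = U * C * V := by
    simp only [hC, Matrix.mul_assoc]
    rw [hUV, ← Matrix.mul_assoc U V, hUV]; simp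
  have cyc : ∀ X : Matrix (Fin n) (Fin n) ℝ, (U * X * V).trace = X.trace := fun X => by
    rw [Matrix.trace_mul_comm, ← Matrix.mul_assoc, hVU, Matrix.one_mul]
  have mm : ∀ X Y : Matrix (Fin n) (Fin n) ℝ, (U * X * V) * (U * Y * V) = U * (X * Y) * V := by
    intro X Y
    simp only [Matrix.mul_assoc]
    rw [← Matrix.mul_assoc V U, hVU, Matrix.one_mul]
  rw [hAd, hBC]
  simp only [mm, cyc]
  exact diagonal_trace_mul_sq_add_commutator_le d C hCt

theorem sum_mul_sum_comm₄ {n : ℕ} {κ : Type*} [Fintype κ]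
    (P Q : Fin n → Fin n → Fin n → Fin n → κ → ℝ) :
    ∑ i, ∑ j, ∑ k, ∑ l, (∑ a, P i j k l a) * (∑ b, Q i j k l b)
      = ∑ a, ∑ b, ∑ i, ∑ j, ∑ k, ∑ l, P i j k l a * Q i j k l b := by
  simp_rw [sum_mul_sum]
  have : ∀ f : Fin n → Fin n → Fin n → Fin n → ℝ, ∑ i, ∑ j, ∑ k, ∑ l, f i j k l
      = ∑ p : Fin n × Fin n × Fin n × Fin n, f p.1 p.2.1 p.2.2.1 p.2.2.2 := fun f => by
    simp only [Fintype.sum_prod_type]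
  simp_rw [this]
  rw [sum_comm]
  exact sum_congr rfl fun a _ => sum_comm

/-- The quartic curvature term of a family of symmetric matrices. -/
def quarticTerm {n : ℕ} (A B : Fin n → Fin n → ℝ) : ℝ :=
  ∑ i, ∑ j, ∑ k, ∑ l, (A i j * A k l * (B i j * B k l)
    + 2 * (A i k * A j k * (B i l * B j l)) - 2 * (A k i * A l j * (B k l * B i j)))

theorem quarticTerm_eq {n : ℕ} (A B : Matrix (Fin n) (Fin n) ℝ) (hA : Aᵀ = A) (hB : Bᵀ = B) :
    quarticTerm (fun i j => A i j) (fun i j => B i j) = (A * B).trace ^ 2 + 2 * (A * A * B * B).trace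
      - 2 * (A * B * A * B).trace := by
  have hs : ∀ i j, A i j = A j i := fun i j => congrFun (congrFun hA j) i
  have hs' : ∀ i j, B i j = B j i := fun i j => congrFun (congrFun hB j) i
  have e1 : (A * B).trace ^ 2 = ∑ i, ∑ j, ∑ k, ∑ l, A i j * A k l * (B i j * B k l) := by
    simp only [Matrix.trace, Matrix.diag, Matrix.mul_apply, sq, sum_mul_sum]
    refine sum_congr rfl fun i _ => ?_
    rw [sum_comm]
    refine sum_congr rfl fun j _ => sum_congr rfl fun k _ => sum_congr rfl fun l _ => ?_
    rw [hs' j i, hs' l k]; ring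
  have e2 : (A * A * B * B).trace = ∑ i, ∑ j, ∑ k, ∑ l, A i k * A j k * (B i l * B j l) := by
    have : ∀ i, ((A * A) * (B * B)) i i = ∑ j, ∑ k, ∑ l, A i k * A j k * (B i l * B j l) := by
      intro i
      rw [Matrix.mul_apply]
      refine sum_congr rfl fun j _ => ?_
      rw [Matrix.mul_apply, Matrix.mul_apply, sum_mul_sum]
      refine sum_congr rfl fun k _ => sum_congr rfl fun l _ => ?_
      rw [hs k j, hs' j l, hs' i l, hs' l j, hs' l i]; ring
    rw [Matrix.mul_assoc]
    exact sum_congr rfl fun i _ => this i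
  have e3 : (A * B * A * B).trace = ∑ i, ∑ j, ∑ k, ∑ l, A k i * A l j * (B k l * B i j) := by
    have : ∀ i, ((A * B) * (A * B)) i i = ∑ j, ∑ k, ∑ l, A k i * A l j * (B k l * B i j) := by
      intro i
      rw [Matrix.mul_apply]
      have : ∀ l, (A * B) i l * (A * B) l i = ∑ j, ∑ k, A k i * A l j * (B k l * B i j) := by
        intro l
        rw [Matrix.mul_apply, Matrix.mul_apply, sum_mul_sum, sum_comm]
        refine sum_congr rfl fun j _ => sum_congr rfl fun k _ => ?_
        rw [hs i k, hs' j i]; ring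
      simp_rw [this]
      rw [sum_comm]
      exact sum_congr rfl fun j _ => sum_comm
    rw [Matrix.mul_assoc (A * B)]
    exact sum_congr rfl fun i _ => this i
  rw [e1, e2, e3, quarticTerm]
  simp only [sum_add_distrib, sum_sub_distrib, mul_sum]

theorem sum_sq_eq_trace {n : ℕ} (A : Matrix (Fin n) (Fin n) ℝ) (hA : Aᵀ = A) :
    ∑ i, ∑ j, A i j ^ 2 = (A * A).trace := by
  have hs : ∀ i j, A i j = A j i := fun i j => congrFun (congrFun hA j) i
  simp only [Matrix.trace, Matrix.diag, Matrix.mul_apply]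
  exact sum_congr rfl fun i _ => sum_congr rfl fun j _ => by rw [hs j i]; ring

theorem quarticTerm_le {n : ℕ} (A B : Fin n → Fin n → ℝ) (hA : ∀ i j, A i j = A j i)
    (hB : ∀ i j, B i j = B j i) :
    quarticTerm A B ≤ 2 * (∑ i, ∑ j, A i j ^ 2) * ∑ i, ∑ j, B i j ^ 2 := by
  have hA' : (Matrix.of A)ᵀ = Matrix.of A := by ext i j; exact hA j i
  have hB' : (Matrix.of B)ᵀ = Matrix.of B := by ext i j; exact hB j i
  have h := trace_mul_sq_add_commutator_le (Matrix.of A) (Matrix.of B) hA' hB'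
  rw [← quarticTerm_eq (Matrix.of A) (Matrix.of B) hA' hB', ← sum_sq_eq_trace _ hA', ← sum_sq_eq_trace _ hB'] at h
  exact h

theorem quarticTerm_self {n : ℕ} (A : Fin n → Fin n → ℝ) (hA : ∀ i j, A i j = A j i) :
    quarticTerm A A = (∑ i, ∑ j, A i j ^ 2) ^ 2 := by
  have hA' : (Matrix.of A)ᵀ = Matrix.of A := by ext i j; exact hA j i
  have h := quarticTerm_eq (Matrix.of A) (Matrix.of A) hA' hA'
  have h2 := sum_sq_eq_trace _ hA'
  simp only [Matrix.of_apply] at h2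
  rw [h2]
  simp only [Matrix.of_apply] at h
  rw [h]; ring

/-- The quartic reaction term of a vector valued symmetric tensor. -/
def quarticReaction {n : ℕ} {ι : Type*} [Fintype ι] (h : Fin n → Fin n → ι → ℝ) : ℝ :=
  ∑ i, ∑ j, ∑ k, ∑ l, ((h i j ⬝ᵥ h k l) ^ 2 + 2 * ((h i k ⬝ᵥ h j k) * (h i l ⬝ᵥ h j l))
    - 2 * ((h k i ⬝ᵥ h l j) * (h k l ⬝ᵥ h i j)))

/-- The components C only have to reproduce the inner products; they need not belong to an
orthonormal basis. `quarticReaction_le` uses a redundant family. -/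
theorem quarticReaction_eq_sum {n : ℕ} {ι κ : Type*} [Fintype ι] [Fintype κ]
    (h : Fin n → Fin n → ι → ℝ) (C : κ → Fin n → Fin n → ℝ)
    (hC : ∀ i j k l, h i j ⬝ᵥ h k l = ∑ a, C a i j * C a k l) :
    quarticReaction h = ∑ a, ∑ b, quarticTerm (C a) (C b) := by
  have h1 := sum_mul_sum_comm₄ (fun i j k l a => C a i j * C a k l)
    (fun i j k l b => C b i j * C b k l)
  have h2 := sum_mul_sum_comm₄ (fun i j k l a => C a i k * C a j k)
    (fun i j k l b => C b i l * C b j l)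
  have h3 := sum_mul_sum_comm₄ (fun i j k l a => C a k i * C a l j)
    (fun i j k l b => C b k l * C b i j)
  have h2' := congrArg (2 * ·) h2
  have h3' := congrArg (2 * ·) h3
  simp only [mul_sum (a := (2 : ℝ))] at h2' h3'
  simp only [quarticReaction, quarticTerm, sum_add_distrib, sum_sub_distrib, hC, sq]
  rw [h1, h2', h3']

theorem dotProduct_sub_smul_sub_smul {ι : Type*} [Fintype ι] (u v ν : ι → ℝ) (p q : ℝ) :
    ∑ a, (u a - p * ν a) * (v a - q * ν a)
      = u ⬝ᵥ v - q * (u ⬝ᵥ ν) - p * (v ⬝ᵥ ν) + p * q * (ν ⬝ᵥ ν) := by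
  simp only [dotProduct, mul_sum, ← sum_sub_distrib, ← sum_add_distrib]
  exact sum_congr rfl fun a _ => by ring

/-- The bound on the quartic reaction term, split along a unit vector `ν`. -/
theorem quarticReaction_le {n : ℕ} {ι : Type*} [Fintype ι] (h : Fin n → Fin n → ι → ℝ)
    (hs : ∀ i j, h i j = h j i) (ν : ι → ℝ) (hν : ν ⬝ᵥ ν = 1) (x y : ℝ)
    (hx : x = ∑ i, ∑ j, (h i j ⬝ᵥ ν) ^ 2) (hxy : x + y = ∑ i, ∑ j, h i j ⬝ᵥ h i j) :
    quarticReaction h ≤ x ^ 2 + 4 * x * y + 2 * y ^ 2 := by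
  -- The component `none` is the one along ν, the others are the coordinates of the projection to
  -- ν^⊥. Together they reproduce inner products because ν is a unit vector, so no orthonormal basis
  -- of ν^⊥ has to be chosen.
  let C : Option ι → Fin n → Fin n → ℝ := fun o i j =>
    o.elim (h i j ⬝ᵥ ν) fun a => h i j a - (h i j ⬝ᵥ ν) * ν a
  have hCs : ∀ a i j, C a i j = C a j i := fun a i j => by cases a <;> simp [C, hs i j]
  have hC : ∀ i j k l, h i j ⬝ᵥ h k l = ∑ a, C a i j * C a k l := by
    intro i j k l
    rw [Fintype.sum_option]
    simp only [C, Option.elim]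
    rw [dotProduct_sub_smul_sub_smul, hν]; ring
  set N : Option ι → ℝ := fun a => ∑ i, ∑ j, C a i j ^ 2 with hN
  have hN0 : N none = x := by rw [hx]; rfl
  have hNy : ∑ a, N (some a) = y := by
    have : ∑ a, N a = x + y := by
      rw [hxy, hN]
      simp only
      rw [sum_comm]
      refine sum_congr rfl fun i _ => ?_
      rw [sum_comm]
      refine sum_congr rfl fun j _ => ?_
      rw [hC]; simp [sq]
    rw [Fintype.sum_option, hN0] at this
    linarith
  rw [quarticReaction_eq_sum h C hC]
  simp only [Fintype.sum_option, sum_add_distrib]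
  -- A matrix commutes with itself, so the ν-ν entry is exactly x². All other pairs are estimated
  -- with the factor 2: twice 2xy for the mixed ones and 2y² for the rest.
  have h0 : quarticTerm (C none) (C none) = x ^ 2 := by
    rw [quarticTerm_self _ (hCs none), ← hN0]
  have h1 : ∑ b, quarticTerm (C none) (C (some b)) ≤ 2 * x * y := by
    rw [← hNy, mul_sum, ← hN0]
    exact sum_le_sum fun b _ => quarticTerm_le _ _ (hCs _) (hCs _)
  have h2 : ∑ b, quarticTerm (C (some b)) (C none) ≤ 2 * x * y := by
    rw [← hNy, mul_sum, ← hN0]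
    refine sum_le_sum fun b _ => (quarticTerm_le _ _ (hCs _) (hCs _)).trans (le_of_eq ?_)
    simp only [hN]; ring
  have h3 : ∑ a, ∑ b, quarticTerm (C (some a)) (C (some b)) ≤ 2 * y ^ 2 := by
    rw [sq, ← hNy, sum_mul_sum, mul_sum]
    refine sum_le_sum fun a _ => ?_
    rw [mul_sum]
    refine sum_le_sum fun b _ => (quarticTerm_le _ _ (hCs _) (hCs _)).trans (le_of_eq ?_)
    simp only [hN]; ring
  linarith

/-- The trace inequality for a symmetric 3-tensor. -/
theorem three_mul_sum_trace_sq_le {n : ℕ} (t : Fin n → Fin n → Fin n → ℝ)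
    (h12 : ∀ i j k, t i j k = t j i k) (h23 : ∀ i j k, t i j k = t i k j) :
    3 * ∑ k, (∑ i, t i i k) ^ 2 ≤ (n + 2) * ∑ i, ∑ j, ∑ k, t i j k ^ 2 := by
  set T : Fin n → ℝ := fun k => ∑ i, t i i k with hT
  -- With this normalisation v_i δ_jk + v_j δ_ik + v_k δ_ij has the same trace as t, so it is the
  -- orthogonal projection of t to the pure trace tensors; the inequality is that the remainder has
  -- nonnegative norm.
  set v : Fin n → ℝ := fun k => T k / (n + 2) with hv
  have hn : (0 : ℝ) < n + 2 := by positivity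
  have hTv : ∀ k, T k = (n + 2) * v k := fun k => by simp only [hv]; field_simp
  have h0 : 0 ≤ ∑ i, ∑ j, ∑ k, (t i j k - ((if j = k then v i else 0) + (if i = k then v j else 0)
      + (if i = j then v k else 0))) ^ 2 := by positivity
  have e : ∀ i j k, (t i j k - ((if j = k then v i else 0) + (if i = k then v j else 0)
      + (if i = j then v k else 0))) ^ 2 = t i j k ^ 2
      - 2 * (if j = k then v i * t i j k else 0) - 2 * (if i = k then v j * t i j k else 0)
      - 2 * (if i = j then v k * t i j k else 0)
      + ((if j = k then v i ^ 2 else 0) + (if i = k then v j ^ 2 else 0)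
      + (if i = j then v k ^ 2 else 0))
      + 2 * (if j = k then (if i = k then v i * v j else 0) else 0)
      + 2 * (if j = k then (if i = j then v i * v k else 0) else 0)
      + 2 * (if i = k then (if i = j then v j * v k else 0) else 0) := by
    intro i j k
    split_ifs <;> ring
  have a1 : ∑ i, ∑ j, v i * t i j j = (n + 2) * ∑ i, v i ^ 2 := by
    rw [mul_sum]
    refine sum_congr rfl fun i _ => ?_
    rw [← mul_sum]
    have : ∑ j, t i j j = T i := sum_congr rfl fun j _ => by rw [h12, h23]
    rw [this, hTv]; ring
  have a2 : ∑ i, ∑ j, v j * t i j i = (n + 2) * ∑ i, v i ^ 2 := by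
    rw [← a1, sum_comm]
    exact sum_congr rfl fun i _ => sum_congr rfl fun j _ => by rw [h12 j i j]
  have a3 : ∑ i, ∑ k, v k * t i i k = (n + 2) * ∑ i, v i ^ 2 := by
    rw [← a1, sum_comm]
    exact sum_congr rfl fun i _ => sum_congr rfl fun j _ => by rw [h23 j j i, h12 j i j]
  simp only [e, sum_add_distrib, sum_sub_distrib, ← mul_sum] at h0
  have s1 : ∀ f : Fin n → Fin n → ℝ, ∑ i, ∑ j, ∑ k, (if j = k then f i j else 0)
      = ∑ i, ∑ j, f i j := fun f => by simp
  have s2 : ∑ i, ∑ j, ∑ k, (if i = k then v j * t i j k else 0) = ∑ i, ∑ j, v j * t i j i := by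
    simp
  have s3 : ∑ i, ∑ j, ∑ k, (if i = j then v k * t i j k else 0) = ∑ i, ∑ k, v k * t i i k := by
    refine sum_congr rfl fun i _ => ?_
    rw [sum_comm]; simp
  have s1' : ∑ i, ∑ j, ∑ k, (if j = k then v i * t i j k else 0) = ∑ i, ∑ j, v i * t i j j := by
    simp
  have q1 : ∑ i : Fin n, ∑ j : Fin n, ∑ k : Fin n, (if j = k then v i ^ 2 else 0)
      = n * ∑ i, v i ^ 2 := by simp [mul_sum]
  have q2 : ∑ i : Fin n, ∑ j : Fin n, ∑ k : Fin n, (if i = k then v j ^ 2 else 0)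
      = n * ∑ i, v i ^ 2 := by simp
  have q3 : ∑ i : Fin n, ∑ j : Fin n, ∑ k : Fin n, (if i = j then v k ^ 2 else 0)
      = n * ∑ i, v i ^ 2 := by
    have : ∀ i : Fin n, ∑ j : Fin n, ∑ k : Fin n, (if i = j then v k ^ 2 else 0)
      = ∑ k, v k ^ 2 := fun i => by rw [sum_comm]; simp
    simp
  have r1 : ∑ i : Fin n, ∑ j : Fin n, ∑ k : Fin n,
      (if j = k then (if i = k then v i * v j else 0) else 0) = ∑ i, v i ^ 2 := by simp [sq]
  have r2 : ∑ i : Fin n, ∑ j : Fin n, ∑ k : Fin n,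
      (if j = k then (if i = j then v i * v k else 0) else 0) = ∑ i, v i ^ 2 := by simp [sq]
  have r3 : ∑ i : Fin n, ∑ j : Fin n, ∑ k : Fin n,
      (if i = k then (if i = j then v j * v k else 0) else 0) = ∑ i, v i ^ 2 := by simp [sq]
  rw [s1', s2, s3, q1, q2, q3, r1, r2, r3, a1, a2, a3] at h0
  have hTT : ∑ k, T k ^ 2 = (n + 2) ^ 2 * ∑ i, v i ^ 2 := by
    rw [mul_sum]
    exact sum_congr rfl fun k _ => by rw [hTv]; ring
  rw [hTT]
  nlinarith

/-- The reaction inequality: `φ` is the traceless part, split as `x + y`, and `s = |H|²`. -/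
theorem reaction_le {n K s x y f b : ℝ} (hn : 0 < n) (hK : 0 < K) (hb : 0 ≤ b) (hbn : 2 * b ≤ n)
    (hs : 0 ≤ s) (hf0 : 0 ≤ f) (hf1 : f ≤ 1) (hy : 0 ≤ y)
    (hφ : x + y = f * (s / (3 * n) + b * K)) :
    x ^ 2 + 4 * x * y + 2 * y ^ 2 + s * x / n - n * K * (x + y)
        - f * (1 / (3 * n)) * (s * x + s ^ 2 / n + n * K * s)
      ≤ -((n - 2 * b) * K * (x + y)) := by
  have hx : x = f * (s / (3 * n) + b * K) - y := by linarith
  have key : x ^ 2 + 4 * x * y + 2 * y ^ 2 + s * x / n - n * K * (x + y)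
        - f * (1 / (3 * n)) * (s * x + s ^ 2 / n + n * K * s) =
      f * K * (s * (f * b / (3 * n) - 2 / 3 + b / n) + b * K * (f * b - n))
        + (y * (2 * f * b * K - y) - y * ((1 - f) * (s / n))) := by
    rw [hx]; field_simp; ring
  -- Completing the square in y, followed by f² ≤ f.
  have h1 : y * (2 * f * b * K - y) ≤ f * b ^ 2 * K ^ 2 := by
    have : y * (2 * f * b * K - y) ≤ (f * b * K) ^ 2 := by nlinarith [sq_nonneg (f * b * K - y)]
    have h2 : (f * b * K) ^ 2 ≤ f * b ^ 2 * K ^ 2 := by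
      have : f * (f * (b * K) ^ 2) ≤ 1 * (f * (b * K) ^ 2) :=
        mul_le_mul_of_nonneg_right hf1 (by positivity)
      nlinarith
    linarith
  have h2 : 0 ≤ y * ((1 - f) * (s / n)) := by
    have : 0 ≤ 1 - f := by linarith
    positivity
  have h3 : f * K * (s * (f * b / (3 * n) - 2 / 3 + b / n) + b * K * (f * b - n))
      ≤ f * K * (s * (b / (3 * n) - 2 / 3 + b / n) + b * K * (b - n)) := by
    have hfb : f * b ≤ b := by nlinarith
    gcongr
  -- The term in s comes out twice as large as the claim requires; the surplus is nonnegative by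
  -- `h5`.
  have h4 : f * K * (s * (b / (3 * n) - 2 / 3 + b / n) + b * K * (b - n)) + f * b ^ 2 * K ^ 2
      = -(n - 2 * b) * K * (f * (2 * (s / (3 * n)) + b * K)) := by
    field_simp; ring
  have h5 : 0 ≤ (n - 2 * b) * K * (f * (s / (3 * n))) := by
    have : 0 ≤ n - 2 * b := by linarith
    positivity
  rw [key, hφ]
  nlinarith

end TensorAlgebra

end SphereMCF

end

/-! ### Differential calculus of an immersion at a point, in graph coordinates. -/

noncomputable section

namespace SphereMCF

set_option linter.unusedSimpArgs false

open Matrix Finset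

/-- The ring of smooth functions near a point, with its coordinate derivations `D`, a further time
derivation `D0`, the evaluation `ev` at the point, an immersion `f` and the inverse `G` of its
metric. -/
structure ImmersionJet (n N : ℕ) (A : Type*) [CommRing A] where
  ev : A →+* ℝ
  D : Fin n → Derivation ℤ A A
  D0 : Derivation ℤ A A
  D_comm : ∀ i j a, D i (D j a) = D j (D i a)
  D0_comm : ∀ i a, D0 (D i a) = D i (D0 a)
  f : Fin N → A
  G : Fin n → Fin n → A
  G_mul : ∀ i k, ∑ j, (∑ α, D i (f α) * D j (f α)) * G j k = if i = k then 1 else 0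

namespace ImmersionJet

variable {n N : ℕ} {A : Type*} [CommRing A] (L : ImmersionJet n N A)

/-- A derivation applied to each component of a vector. -/
def dv (d : Derivation ℤ A A) (u : Fin N → A) : Fin N → A := fun α => d (u α)

/-- The evaluation applied to each component of a vector. -/
def evv (u : Fin N → A) : Fin N → ℝ := fun α => L.ev (u α)

theorem derivation_dotProduct (d : Derivation ℤ A A) (u v : Fin N → A) :
    d (u ⬝ᵥ v) = dv d u ⬝ᵥ v + u ⬝ᵥ dv d v := by
  simp only [dotProduct, map_sum, Derivation.leibniz, smul_eq_mul, dv, ← sum_add_distrib]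
  exact sum_congr rfl fun α _ => by ring

theorem ev_dotProduct (u v : Fin N → A) : L.ev (u ⬝ᵥ v) = L.evv u ⬝ᵥ L.evv v := by
  simp [dotProduct, map_sum, evv]

def f1 (i : Fin n) : Fin N → A := dv (L.D i) L.f
def f2 (i j : Fin n) : Fin N → A := dv (L.D i) (L.f1 j)
def g (i j : Fin n) : A := L.f1 i ⬝ᵥ L.f1 j
def c (i j k : Fin n) : A := ∑ l, L.G k l * (L.f2 i j ⬝ᵥ L.f1 l)
/-- The normal part of the second derivative. -/
def nn (i j : Fin n) : Fin N → A := L.f2 i j - ∑ k, L.c i j k • L.f1 k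
/-- The mean curvature vector in the ambient Euclidean space. -/
def Hv : Fin N → A := ∑ i, ∑ j, L.G i j • L.nn i j
/-- The squared norm of the second fundamental form in the ambient Euclidean space. -/
def S : A := ∑ i, ∑ j, ∑ p, ∑ q, L.G i p * L.G j q * (L.nn i j ⬝ᵥ L.nn p q)
def B : A := L.Hv ⬝ᵥ L.Hv

def r (i : Fin n) : Fin N → ℝ := L.evv (L.f1 i)
def a (i j : Fin n) : Fin N → ℝ := L.evv (L.f2 i j)
def t (i j k : Fin n) : Fin N → ℝ := L.evv (dv (L.D i) (L.f2 j k))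
def q (i j k l : Fin n) : Fin N → ℝ := L.evv (dv (L.D i) (dv (L.D j) (L.f2 k l)))
def h : Fin N → ℝ := ∑ i, L.a i i

theorem f2_symm (i j : Fin n) : L.f2 i j = L.f2 j i := funext fun _ => L.D_comm _ _ _

theorem a_symm (i j : Fin n) : L.a i j = L.a j i := by rw [a, f2_symm, a]

theorem t_symm (i j k : Fin n) : L.t i j k = L.t i k j := by rw [t, f2_symm, t]

theorem t_symm' (i j k : Fin n) : L.t i j k = L.t j i k :=
  funext fun _ => congrArg L.ev (L.D_comm _ _ _)

/-- This replaces the commutation of covariant derivatives in Simons' identity: the curvature terms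
come from the lower order corrections in the second derivatives of `nn` and `G`. -/
theorem q_symm (i j k l : Fin n) : L.q i j k l = L.q k l i j := by
  funext α
  refine congrArg L.ev ?_
  change L.D i (L.D j (L.D k (L.D l (L.f α)))) = L.D k (L.D l (L.D i (L.D j (L.f α))))
  rw [L.D_comm j k, L.D_comm i k, L.D_comm j l, L.D_comm i l]

/-- The coordinates are those of the graph over the tangent plane at the point. -/
structure IsGraph : Prop where
  r_dot : ∀ i j, L.r i ⬝ᵥ L.r j = if i = j then 1 else 0
  a_dot : ∀ i j k, L.a i j ⬝ᵥ L.r k = 0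
  t_dot : ∀ i j k l, L.t i j k ⬝ᵥ L.r l = 0

variable {L} (hL : L.IsGraph)
include hL

theorem IsGraph.ev_g (i j : Fin n) : L.ev (L.g i j) = if i = j then 1 else 0 := by
  rw [g, ev_dotProduct]; exact hL.r_dot i j

omit hL in
theorem g_mul_G (i k : Fin n) : ∑ j, L.g i j * L.G j k = if i = k then 1 else 0 := L.G_mul i k

theorem IsGraph.ev_G (i j : Fin n) : L.ev (L.G i j) = if i = j then 1 else 0 := by
  have := congrArg L.ev (L.g_mul_G i j)
  simpa [map_sum, hL.ev_g, apply_ite L.ev] using this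

/-- g and its inverse G are both the identity at the point, so differentiating gG = 1 leaves dG + dg
= 0. It holds for the time derivation as well. -/
theorem IsGraph.ev_d_G (d : Derivation ℤ A A) (i j : Fin n) :
    L.ev (d (L.G i j)) = -L.ev (d (L.g i j)) := by
  have h0 : d (if i = j then 1 else 0) = 0 := by split_ifs <;> simp
  have := congrArg (fun x => L.ev (d x)) (L.g_mul_G i j)
  simp only [h0, map_sum, Derivation.leibniz, smul_eq_mul, map_add, map_mul, hL.ev_g, hL.ev_G,
    map_zero, sum_add_distrib, ite_mul, one_mul, zero_mul, sum_ite_eq, sum_ite_eq', mem_univ,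
    if_true] at this
  linarith

theorem IsGraph.ev_D_g (m i j : Fin n) : L.ev (L.D m (L.g i j)) = 0 := by
  rw [g, derivation_dotProduct, map_add, ev_dotProduct, ev_dotProduct, dotProduct_comm (L.evv (L.f1 i))]
  change L.a m i ⬝ᵥ L.r j + L.a m j ⬝ᵥ L.r i = 0
  rw [hL.a_dot, hL.a_dot, add_zero]

theorem IsGraph.ev_D_G (m i j : Fin n) : L.ev (L.D m (L.G i j)) = 0 := by
  rw [hL.ev_d_G, hL.ev_D_g, neg_zero]

/-- Third derivatives of a graph are normal to the tangent plane, so only products of second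
derivatives remain. This is where the intrinsic curvature enters. -/
theorem IsGraph.ev_D_D_g (k l i j : Fin n) :
    L.ev (L.D k (L.D l (L.g i j))) = L.a k i ⬝ᵥ L.a l j + L.a l i ⬝ᵥ L.a k j := by
  simp only [g, derivation_dotProduct, map_add, ev_dotProduct]
  change L.t k l i ⬝ᵥ L.r j + L.a l i ⬝ᵥ L.a k j + (L.a k i ⬝ᵥ L.a l j + L.r i ⬝ᵥ L.t k l j) = _
  rw [dotProduct_comm (L.r i), hL.t_dot, hL.t_dot]; ring

/-- The mixed terms in the second derivative of gG = 1 vanish with the first derivatives of g and G.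
-/
theorem IsGraph.ev_D_D_G (k l i j : Fin n) :
    L.ev (L.D k (L.D l (L.G i j))) = -(L.a k i ⬝ᵥ L.a l j + L.a l i ⬝ᵥ L.a k j) := by
  rw [← hL.ev_D_D_g]
  have h0 : L.D k (L.D l (if i = j then 1 else 0)) = 0 := by split_ifs <;> simp
  have := congrArg (fun x => L.ev (L.D k (L.D l x))) (L.g_mul_G i j)
  simp only [h0, map_sum, Derivation.leibniz, smul_eq_mul, map_add, map_mul, hL.ev_g, hL.ev_G,
    hL.ev_D_g, hL.ev_D_G, mul_zero, sum_const_zero, add_zero, zero_add,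
    map_zero, sum_add_distrib, ite_mul, one_mul, zero_mul, sum_ite_eq, sum_ite_eq', mem_univ,
    if_true] at this
  linarith

theorem IsGraph.ev_c (i j k : Fin n) : L.ev (L.c i j k) = 0 := by
  have h0 : ∀ l, L.ev (L.f2 i j ⬝ᵥ L.f1 l) = 0 := fun l => by
    rw [ev_dotProduct]; exact hL.a_dot i j l
  simp [c, map_sum, h0]

theorem IsGraph.ev_D_c (m i j k : Fin n) : L.ev (L.D m (L.c i j k)) = L.a i j ⬝ᵥ L.a m k := by
  have h0 : ∀ l, L.ev (L.f2 i j ⬝ᵥ L.f1 l) = 0 := fun l => by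
    rw [ev_dotProduct]; exact hL.a_dot i j l
  have h1 : ∀ l, L.ev (L.D m (L.f2 i j ⬝ᵥ L.f1 l)) = L.a i j ⬝ᵥ L.a m l := fun l => by
    rw [derivation_dotProduct, map_add, ev_dotProduct, ev_dotProduct]
    change L.t m i j ⬝ᵥ L.r l + L.a i j ⬝ᵥ L.a m l = _
    rw [hL.t_dot, zero_add]
  simp [c, map_sum, h0, h1, hL.ev_G]

theorem IsGraph.evv_nn (i j : Fin n) : L.evv (L.nn i j) = L.a i j := by
  funext α
  simp [evv, nn, hL.ev_c, a, map_sum]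

theorem IsGraph.evv_d_nn (d : Derivation ℤ A A) (i j : Fin n) :
    L.evv (dv d (L.nn i j)) = L.evv (dv d (L.f2 i j)) - ∑ k, L.ev (d (L.c i j k)) • L.r k := by
  funext α
  simp [evv, nn, hL.ev_c, dv, map_sum, r, mul_comm]

/-- The subtracted sum is the Weingarten term, which keeps the differentiated vector field normal.
-/
theorem IsGraph.evv_D_nn (m i j : Fin n) :
    L.evv (dv (L.D m) (L.nn i j)) = L.t m i j - ∑ k, (L.a i j ⬝ᵥ L.a m k) • L.r k := by
  rw [hL.evv_d_nn]
  simp only [hL.ev_D_c]; rfl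

omit hL in
theorem dot_sum_smul_eq_zero (w : Fin n → ℝ) (v : Fin N → ℝ) (hv : ∀ k, v ⬝ᵥ L.r k = 0) :
    (∑ k, w k • L.r k) ⬝ᵥ v = 0 := by
  simp [dotProduct_comm _ v, dotProduct_sum, hv]

theorem IsGraph.evv_d_nn_dot (d : Derivation ℤ A A) (i j : Fin n) (v : Fin N → ℝ)
    (hv : ∀ k, v ⬝ᵥ L.r k = 0) :
    L.evv (dv d (L.nn i j)) ⬝ᵥ v = L.evv (dv d (L.f2 i j)) ⬝ᵥ v := by
  rw [hL.evv_d_nn, sub_dotProduct, dot_sum_smul_eq_zero _ v hv, sub_zero]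

theorem IsGraph.evv_D_nn_dot (m i j p q : Fin n) :
    L.evv (dv (L.D m) (L.nn i j)) ⬝ᵥ L.evv (dv (L.D m) (L.nn p q))
      = L.t m i j ⬝ᵥ L.t m p q + ∑ k, (L.a i j ⬝ᵥ L.a m k) * (L.a p q ⬝ᵥ L.a m k) := by
  rw [hL.evv_D_nn, hL.evv_D_nn, sub_dotProduct, dotProduct_sub, dotProduct_sub,
    dot_sum_smul_eq_zero _ _ (hL.t_dot m p q), dotProduct_comm (L.t m i j) (∑ k, _),
    dot_sum_smul_eq_zero _ _ (hL.t_dot m i j)]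
  simp [sum_dotProduct, dotProduct_sum, hL.r_dot, smul_dotProduct, dotProduct_smul, mul_comm]

/-- Second derivatives of the Christoffel symbols multiply tangent vectors only. Pairing with a
normal vector v removes them, so they are never computed. -/
theorem IsGraph.evv_D_D_nn_dot (k l i j : Fin n) (v : Fin N → ℝ) (hv : ∀ k, v ⬝ᵥ L.r k = 0) :
    L.evv (dv (L.D k) (dv (L.D l) (L.nn i j))) ⬝ᵥ v = L.q k l i j ⬝ᵥ v
      - ∑ m, ((L.a i j ⬝ᵥ L.a k m) * (L.a l m ⬝ᵥ v) + (L.a i j ⬝ᵥ L.a l m) * (L.a k m ⬝ᵥ v)) := by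
  have e : L.evv (dv (L.D k) (dv (L.D l) (L.nn i j))) = L.q k l i j
      - ∑ m, ((L.a i j ⬝ᵥ L.a k m) • L.a l m + (L.a i j ⬝ᵥ L.a l m) • L.a k m)
      - ∑ m, L.ev (L.D k (L.D l (L.c i j m))) • L.r m := by
    funext α
    simp only [evv, nn, dv, map_sum, Pi.sub_apply, Finset.sum_apply, Pi.smul_apply, map_sub,
      Derivation.leibniz, smul_eq_mul, map_add, map_mul, hL.ev_c, hL.ev_D_c, zero_mul,
      Pi.add_apply, q, a, r, sub_sub, ← sum_add_distrib]
    congr 1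
    exact sum_congr rfl fun m _ => by simp only [f2, f1, dv]; ring
  rw [e, sub_dotProduct, sub_dotProduct, dot_sum_smul_eq_zero _ v hv, sub_zero]
  simp [sum_dotProduct, add_dotProduct, smul_dotProduct]

theorem IsGraph.evv_Hv : L.evv L.Hv = L.h := by
  funext α
  have := fun i j => congrFun (hL.evv_nn i j) α
  simp only [evv] at this
  simp [evv, Hv, map_sum, hL.ev_G, h, this]

theorem IsGraph.h_dot (k : Fin n) : L.h ⬝ᵥ L.r k = 0 := by
  simp [h, sum_dotProduct, hL.a_dot]

theorem IsGraph.evv_d_Hv (d : Derivation ℤ A A) :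
    L.evv (dv d L.Hv) = ∑ i, L.evv (dv d (L.nn i i)) + ∑ i, ∑ j, L.ev (d (L.G i j)) • L.a i j := by
  funext α
  have := fun i j => congrFun (hL.evv_nn i j) α
  simp only [evv] at this
  simp [evv, Hv, map_sum, hL.ev_G, dv, this, sum_add_distrib, mul_comm, add_comm]

theorem IsGraph.evv_D_Hv (k : Fin n) :
    L.evv (dv (L.D k) L.Hv) = ∑ i, L.t k i i - ∑ l, (L.h ⬝ᵥ L.a k l) • L.r l := by
  rw [hL.evv_d_Hv]
  simp only [hL.ev_D_G, zero_smul, sum_const_zero, add_zero, hL.evv_D_nn, sum_sub_distrib]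
  congr 1
  rw [sum_comm]
  refine sum_congr rfl fun l _ => ?_
  rw [← sum_smul, h, sum_dotProduct]

theorem IsGraph.evv_D_D_Hv_dot (k l : Fin n) (v : Fin N → ℝ) (hv : ∀ k, v ⬝ᵥ L.r k = 0) :
    L.evv (dv (L.D k) (dv (L.D l) L.Hv)) ⬝ᵥ v = (∑ i, L.q k l i i) ⬝ᵥ v
      - ∑ m, ((L.h ⬝ᵥ L.a k m) * (L.a l m ⬝ᵥ v) + (L.h ⬝ᵥ L.a l m) * (L.a k m ⬝ᵥ v))
      - ∑ i, ∑ j, (L.a k i ⬝ᵥ L.a l j + L.a l i ⬝ᵥ L.a k j) * (L.a i j ⬝ᵥ v) := by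
  have e : L.evv (dv (L.D k) (dv (L.D l) L.Hv)) = ∑ i, L.evv (dv (L.D k) (dv (L.D l) (L.nn i i)))
      - ∑ i, ∑ j, (L.a k i ⬝ᵥ L.a l j + L.a l i ⬝ᵥ L.a k j) • L.a i j := by
    funext α
    have := fun i j => congrFun (hL.evv_nn i j) α
    simp only [evv] at this
    simp only [evv, Hv, map_sum, hL.ev_G, hL.ev_D_G, hL.ev_D_D_G, dv, this, Finset.sum_apply,
      Pi.sub_apply, Pi.smul_apply, map_sub,
      Derivation.leibniz, smul_eq_mul, map_add, map_mul, ite_mul, one_mul, zero_mul, mul_zero,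
      sum_add_distrib, sum_ite_eq, mem_univ, if_true, sum_const_zero, add_zero]
    rw [sub_eq_add_neg, ← sum_neg_distrib]
    congr 1
    refine sum_congr rfl fun i _ => ?_
    rw [← sum_neg_distrib]
    exact sum_congr rfl fun j _ => by ring
  rw [e, sub_dotProduct, sum_dotProduct]
  simp only [hL.evv_D_D_nn_dot k l _ _ v hv, sum_sub_distrib]
  rw [sum_dotProduct, sum_comm (s := univ) (t := univ)]
  simp only [h, sum_dotProduct, sum_add_distrib, smul_dotProduct, smul_eq_mul, ← sum_mul]

end ImmersionJet

end SphereMCF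

end

/-! ### Evolution equations for |H|² and |h|². -/

noncomputable section

namespace SphereMCF

set_option linter.unusedSimpArgs false

open Matrix Finset

theorem quarticReaction_expand {n : ℕ} {ι : Type*} [Fintype ι] (h : Fin n → Fin n → ι → ℝ) :
    quarticReaction h = ∑ i, ∑ j, ∑ k, ∑ l, (h i j ⬝ᵥ h k l) ^ 2
      + 2 * ∑ i, ∑ j, ∑ k, ∑ l, (h i k ⬝ᵥ h j k) * (h i l ⬝ᵥ h j l)
      - 2 * ∑ i, ∑ j, ∑ k, ∑ l, (h k i ⬝ᵥ h l j) * (h k l ⬝ᵥ h i j) := by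
  simp only [quarticReaction, sum_add_distrib, sum_sub_distrib, mul_sum]

namespace ImmersionJet

variable {n N : ℕ} {A : Type*} [CommRing A] {L : ImmersionJet n N A}

/-- The mean curvature flow equation in a sphere, with `κ` the constant `n K`. -/
structure IsFlow (L : ImmersionJet n N A) (κ : A) : Prop where
  D_const : ∀ i, L.D i κ = 0
  eq : ∀ α, L.D0 (L.f α) = L.Hv α + κ * L.f α

/-- The value at the point of the heat operator, in coordinates with vanishing Christoffel symbols
and with orthonormal coordinate vectors. -/
def heat (L : ImmersionJet n N A) (u : A) : ℝ := L.ev (L.D0 u) - ∑ k, L.ev (L.D k (L.D k u))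

variable {κ : A} (hF : L.IsFlow κ) (hL : L.IsGraph)
include hF

theorem IsFlow.dv_D0_f2 (i j : Fin n) :
    dv L.D0 (L.f2 i j) = dv (L.D i) (dv (L.D j) L.Hv) + κ • L.f2 i j := by
  funext α
  change L.D0 (L.D i (L.D j (L.f α))) = L.D i (L.D j (L.Hv α)) + κ * L.D i (L.D j (L.f α))
  rw [L.D0_comm, L.D0_comm, hF.eq]
  simp only [map_add, Derivation.leibniz, hF.D_const, smul_zero, mul_zero, zero_mul, map_zero,
    add_zero, smul_eq_mul]

theorem IsFlow.dv_D0_f1 (i : Fin n) : dv L.D0 (L.f1 i) = dv (L.D i) L.Hv + κ • L.f1 i := by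
  funext α
  change L.D0 (L.D i (L.f α)) = L.D i (L.Hv α) + κ * L.D i (L.f α)
  rw [L.D0_comm, hF.eq]
  simp only [map_add, Derivation.leibniz, hF.D_const, smul_zero, mul_zero, zero_mul, map_zero,
    add_zero, smul_eq_mul]

omit hF in
theorem evv_add (u v : Fin N → A) : L.evv (u + v) = L.evv u + L.evv v := by
  funext α; simp [evv]

omit hF in
theorem evv_smul (x : A) (v : Fin N → A) : L.evv (x • v) = L.ev x • L.evv v := by
  funext α; simp [evv]

include hL

omit hF in
theorem IsGraph.evv_D_Hv_dot_r (k j : Fin n) :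
    L.evv (dv (L.D k) L.Hv) ⬝ᵥ L.r j = -(L.h ⬝ᵥ L.a k j) := by
  rw [hL.evv_D_Hv, sub_dotProduct]
  simp [sum_dotProduct, hL.t_dot, smul_dotProduct, hL.r_dot]

/-- The usual equation ∂_t g = -2⟨H, h⟩, written with the Euclidean mean curvature; the velocity is
`Hv + κ f`, and its radial part contributes 2κ g. -/
theorem IsFlow.ev_D0_g (i j : Fin n) :
    L.ev (L.D0 (L.g i j)) = -2 * (L.h ⬝ᵥ L.a i j) + if i = j then 2 * L.ev κ else 0 := by
  rw [g, derivation_dotProduct, map_add, ev_dotProduct, ev_dotProduct, hF.dv_D0_f1, hF.dv_D0_f1,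
    evv_add, evv_add, evv_smul, evv_smul, add_dotProduct, dotProduct_add,
    dotProduct_comm (L.evv (L.f1 i))]
  change L.evv (dv (L.D i) L.Hv) ⬝ᵥ L.r j + (L.ev κ • L.r i) ⬝ᵥ L.r j
    + (L.evv (dv (L.D j) L.Hv) ⬝ᵥ L.r i + L.r i ⬝ᵥ (L.ev κ • L.r j)) = _
  rw [hL.evv_D_Hv_dot_r, hL.evv_D_Hv_dot_r, smul_dotProduct, dotProduct_smul, hL.r_dot,
    L.a_symm j i]
  split_ifs <;> simp <;> ring

theorem IsFlow.ev_D0_G (i j : Fin n) :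
    L.ev (L.D0 (L.G i j)) = 2 * (L.h ⬝ᵥ L.a i j) - if i = j then 2 * L.ev κ else 0 := by
  rw [hL.ev_d_G, hF.ev_D0_g hL]; ring

theorem IsFlow.evv_D0_f2_dot (i j : Fin n) (v : Fin N → ℝ) (hv : ∀ k, v ⬝ᵥ L.r k = 0) :
    L.evv (dv L.D0 (L.f2 i j)) ⬝ᵥ v = (∑ k, L.q i j k k) ⬝ᵥ v
      - ∑ m, ((L.h ⬝ᵥ L.a i m) * (L.a j m ⬝ᵥ v) + (L.h ⬝ᵥ L.a j m) * (L.a i m ⬝ᵥ v))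
      - ∑ k, ∑ l, (L.a i k ⬝ᵥ L.a j l + L.a j k ⬝ᵥ L.a i l) * (L.a k l ⬝ᵥ v)
      + L.ev κ * (L.a i j ⬝ᵥ v) := by
  rw [hF.dv_D0_f2, evv_add, evv_smul, add_dotProduct, hL.evv_D_D_Hv_dot i j v hv, smul_dotProduct]
  rfl

/-- The evolution of the squared norm of the mean curvature vector. -/
theorem IsFlow.heat_B : L.heat L.B = -2 * ∑ k, (∑ i, L.t k i i) ⬝ᵥ (∑ i, L.t k i i)
    + 2 * ∑ i, ∑ j, (L.h ⬝ᵥ L.a i j) ^ 2 - 2 * L.ev κ * (L.h ⬝ᵥ L.h) := by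
  have hh := hL.h_dot
  have e0 : L.ev (L.D0 L.B) = 2 * ((∑ i, ∑ k, L.q i i k k) ⬝ᵥ L.h)
      - 4 * ∑ i, ∑ j, ∑ k, (L.a i k ⬝ᵥ L.a i j) * (L.h ⬝ᵥ L.a k j)
      - 2 * L.ev κ * (L.h ⬝ᵥ L.h) := by
    rw [B, derivation_dotProduct, map_add, ev_dotProduct, ev_dotProduct, hL.evv_Hv,
      dotProduct_comm L.h, ← two_mul, hL.evv_d_Hv, add_dotProduct, sum_dotProduct]
    simp only [hL.evv_d_nn_dot _ _ _ _ hh, hF.evv_D0_f2_dot hL _ _ _ hh, hF.ev_D0_G hL]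
    have s1 : (∑ i, ∑ j, (2 * (L.h ⬝ᵥ L.a i j) - if i = j then 2 * L.ev κ else 0) • L.a i j) ⬝ᵥ L.h
        = 2 * ∑ i, ∑ j, (L.h ⬝ᵥ L.a i j) ^ 2 - 2 * L.ev κ * (L.h ⬝ᵥ L.h) := by
      have : ∀ i, ∑ j, (2 * (L.h ⬝ᵥ L.a i j) - if i = j then 2 * L.ev κ else 0) • L.a i j
          = (∑ j, (2 * (L.h ⬝ᵥ L.a i j)) • L.a i j) - (2 * L.ev κ) • L.a i i := fun i => by
        simp [sub_smul, sum_sub_distrib, ite_smul]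
      simp only [this, sum_sub_distrib, ← smul_sum]
      rw [sub_dotProduct, smul_dotProduct]
      simp only [sum_dotProduct, smul_dotProduct, smul_eq_mul]
      congr 1
      swap
      · rw [← sum_dotProduct]; rfl
      simp only [mul_sum]
      exact sum_congr rfl fun i _ => sum_congr rfl fun j _ => by
        rw [dotProduct_comm (L.a i j)]; ring
    have s2 : ∑ i, ∑ m, ((L.h ⬝ᵥ L.a i m) * (L.a i m ⬝ᵥ L.h) + (L.h ⬝ᵥ L.a i m) * (L.a i m ⬝ᵥ L.h))
        = 2 * ∑ i, ∑ j, (L.h ⬝ᵥ L.a i j) ^ 2 := by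
      simp only [mul_sum]
      exact sum_congr rfl fun i _ => sum_congr rfl fun j _ => by rw [dotProduct_comm (L.a i j)]; ring
    have s3 : ∑ i, ∑ k, ∑ l, (L.a i k ⬝ᵥ L.a i l + L.a i k ⬝ᵥ L.a i l) * (L.a k l ⬝ᵥ L.h)
        = 2 * ∑ i, ∑ j, ∑ k, (L.a i k ⬝ᵥ L.a i j) * (L.h ⬝ᵥ L.a k j) := by
      simp only [mul_sum]
      refine sum_congr rfl fun i _ => ?_
      rw [sum_comm]
      exact sum_congr rfl fun j _ => sum_congr rfl fun k _ => by
        rw [dotProduct_comm (L.a k j)]; ring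
    simp only [sum_add_distrib, sum_sub_distrib] at s2 s3 ⊢
    rw [s1, s2, s3]
    simp only [← mul_sum, ← sum_dotProduct]
    simp only [h, sum_dotProduct]
    ring
  have e1 : ∀ k, L.ev (L.D k (L.D k L.B)) = 2 * ((∑ i, L.q k k i i) ⬝ᵥ L.h)
      - 4 * ∑ m, (L.h ⬝ᵥ L.a k m) ^ 2 - 4 * ∑ i, ∑ j, (L.a k i ⬝ᵥ L.a k j) * (L.h ⬝ᵥ L.a i j)
      + 2 * ((∑ i, L.t k i i) ⬝ᵥ (∑ i, L.t k i i)) + 2 * ∑ l, (L.h ⬝ᵥ L.a k l) ^ 2 := by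
    intro k
    have d2 : L.D k (L.D k L.B) = dv (L.D k) (dv (L.D k) L.Hv) ⬝ᵥ L.Hv
        + dv (L.D k) L.Hv ⬝ᵥ dv (L.D k) L.Hv + (dv (L.D k) L.Hv ⬝ᵥ dv (L.D k) L.Hv
        + L.Hv ⬝ᵥ dv (L.D k) (dv (L.D k) L.Hv)) := by
      rw [B, derivation_dotProduct, map_add, derivation_dotProduct, derivation_dotProduct]
    rw [d2]
    simp only [map_add, ev_dotProduct, hL.evv_Hv]
    rw [dotProduct_comm L.h, hL.evv_D_D_Hv_dot _ _ _ hh, hL.evv_D_Hv, sub_dotProduct,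
      dotProduct_sub, dotProduct_sub]
    have z : (∑ i, L.t k i i) ⬝ᵥ (∑ l, (L.h ⬝ᵥ L.a k l) • L.r l) = 0 := by
      simp [sum_dotProduct, dotProduct_sum, hL.t_dot]
    have z' : (∑ l, (L.h ⬝ᵥ L.a k l) • L.r l) ⬝ᵥ (∑ l, (L.h ⬝ᵥ L.a k l) • L.r l)
        = ∑ l, (L.h ⬝ᵥ L.a k l) ^ 2 := by
      simp [sum_dotProduct, dotProduct_sum, hL.r_dot, smul_dotProduct, sq]
    have s2 : ∑ m, ((L.h ⬝ᵥ L.a k m) * (L.a k m ⬝ᵥ L.h) + (L.h ⬝ᵥ L.a k m) * (L.a k m ⬝ᵥ L.h))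
        = 2 * ∑ j, (L.h ⬝ᵥ L.a k j) ^ 2 := by
      simp only [mul_sum]
      exact sum_congr rfl fun j _ => by rw [dotProduct_comm (L.a k j)]; ring
    have s3 : ∑ i, ∑ j, (L.a k i ⬝ᵥ L.a k j + L.a k i ⬝ᵥ L.a k j) * (L.a i j ⬝ᵥ L.h)
        = 2 * ∑ i, ∑ j, (L.a k i ⬝ᵥ L.a k j) * (L.h ⬝ᵥ L.a i j) := by
      simp only [mul_sum]
      exact sum_congr rfl fun j _ => sum_congr rfl fun k _ => by
        rw [dotProduct_comm _ L.h]; ring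
    rw [dotProduct_comm (∑ l, (L.h ⬝ᵥ L.a k l) • L.r l) (∑ i, L.t k i i), z, z', s2, s3]
    ring
  rw [heat, e0]
  -- Summed over k, the fourth derivatives from the time and space parts are the same double sum,
  -- and they cancel.
  simp only [e1, sum_add_distrib, sum_sub_distrib, ← mul_sum, ← sum_dotProduct]
  have s4 : ∑ k, ∑ i, ∑ j, (L.a k i ⬝ᵥ L.a k j) * (L.h ⬝ᵥ L.a i j)
      = ∑ i, ∑ j, ∑ k, (L.a i k ⬝ᵥ L.a i j) * (L.h ⬝ᵥ L.a k j) :=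
    sum_congr rfl fun k _ => sum_comm
  rw [s4]
  ring

/-- The evolution of the squared norm of the second fundamental form. -/
theorem IsFlow.heat_S : L.heat L.S = -2 * ∑ i, ∑ j, ∑ k, L.t i j k ⬝ᵥ L.t i j k
    + 2 * quarticReaction L.a - 2 * L.ev κ * ∑ i, ∑ j, L.a i j ⬝ᵥ L.a i j := by
  -- By the symmetry of the second fundamental form, the two inverse metrics in |h|² contribute
  -- equally when differentiated.
  have symS : ∀ w : Fin n → Fin n → ℝ, ∑ i, ∑ j, ∑ q, w j q * (L.a i j ⬝ᵥ L.a i q)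
      = ∑ i, ∑ j, ∑ p, w i p * (L.a i j ⬝ᵥ L.a p j) := fun w => by
    rw [sum_comm]
    exact sum_congr rfl fun i _ => sum_congr rfl fun j _ => sum_congr rfl fun k _ => by
      rw [L.a_symm j i, L.a_symm j k]
  have e0 : L.ev (L.D0 L.S) = 2 * ∑ i, ∑ j, ∑ p, L.ev (L.D0 (L.G i p)) * (L.a i j ⬝ᵥ L.a p j)
      + 2 * ∑ i, ∑ j, L.evv (dv L.D0 (L.f2 i j)) ⬝ᵥ L.a i j := by
    have : L.ev (L.D0 L.S) = ∑ i, ∑ j, ∑ p, L.ev (L.D0 (L.G i p)) * (L.a i j ⬝ᵥ L.a p j)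
        + ∑ i, ∑ j, ∑ q, L.ev (L.D0 (L.G j q)) * (L.a i j ⬝ᵥ L.a i q)
        + ∑ i, ∑ j, L.ev (L.D0 (L.nn i j ⬝ᵥ L.nn i j)) := by
      simp only [S, map_sum, Derivation.leibniz, smul_eq_mul, map_add, map_mul, hL.ev_G,
        ev_dotProduct, hL.evv_nn, ite_mul, one_mul, zero_mul, mul_ite, mul_one, mul_zero,
        sum_add_distrib, sum_ite_eq, mem_univ, if_true, mul_add, sum_const_zero, sum_ite_irrel]
      have : ∀ i j, ∑ x, L.a i j ⬝ᵥ L.a x j * L.ev (L.D0 (L.G i x))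
          = ∑ p, L.ev (L.D0 (L.G i p)) * (L.a i j ⬝ᵥ L.a p j) := fun i j =>
        sum_congr rfl fun p _ => mul_comm _ _
      have h2 : ∀ i j, ∑ x, L.a i j ⬝ᵥ L.a i x * L.ev (L.D0 (L.G j x))
          = ∑ p, L.ev (L.D0 (L.G j p)) * (L.a i j ⬝ᵥ L.a i p) := fun i j =>
        sum_congr rfl fun p _ => mul_comm _ _
      simp only [this, h2]
      ring
    rw [this, symS]
    have : ∀ i j, L.ev (L.D0 (L.nn i j ⬝ᵥ L.nn i j))
        = 2 * (L.evv (dv L.D0 (L.f2 i j)) ⬝ᵥ L.a i j) := fun i j => by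
      rw [derivation_dotProduct, map_add, ev_dotProduct, ev_dotProduct, hL.evv_nn,
        dotProduct_comm (L.a i j), hL.evv_d_nn_dot _ _ _ _ (hL.a_dot i j)]
      ring
    simp only [this, ← mul_sum]
    ring
  have e1 : ∀ k, L.ev (L.D k (L.D k L.S))
      = -4 * ∑ i, ∑ j, ∑ p, (L.a k i ⬝ᵥ L.a k p) * (L.a i j ⬝ᵥ L.a p j)
      + 2 * ∑ i, ∑ j, L.q k k i j ⬝ᵥ L.a i j + 2 * ∑ i, ∑ j, L.t k i j ⬝ᵥ L.t k i j
      - 2 * ∑ i, ∑ j, ∑ m, (L.a i j ⬝ᵥ L.a k m) ^ 2 := by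
    intro k
    have : L.ev (L.D k (L.D k L.S))
        = ∑ i, ∑ j, ∑ p, L.ev (L.D k (L.D k (L.G i p))) * (L.a i j ⬝ᵥ L.a p j)
        + ∑ i, ∑ j, ∑ q, L.ev (L.D k (L.D k (L.G j q))) * (L.a i j ⬝ᵥ L.a i q)
        + ∑ i, ∑ j, L.ev (L.D k (L.D k (L.nn i j ⬝ᵥ L.nn i j))) := by
      simp only [S, map_sum, Derivation.leibniz, smul_eq_mul, map_add, map_mul, hL.ev_G, hL.ev_D_G,
        ev_dotProduct, hL.evv_nn, ite_mul, one_mul, zero_mul, mul_ite, mul_one, mul_zero, add_zero,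
        zero_add, ite_self,
        sum_add_distrib, sum_ite_eq, mem_univ, if_true, mul_add, sum_const_zero, sum_ite_irrel]
      have : ∀ i j, ∑ x, L.a i j ⬝ᵥ L.a x j * L.ev (L.D k (L.D k (L.G i x)))
          = ∑ p, L.ev (L.D k (L.D k (L.G i p))) * (L.a i j ⬝ᵥ L.a p j) := fun i j =>
        sum_congr rfl fun p _ => mul_comm _ _
      have h2 : ∀ i j, ∑ x, L.a i j ⬝ᵥ L.a i x * L.ev (L.D k (L.D k (L.G j x)))
          = ∑ p, L.ev (L.D k (L.D k (L.G j p))) * (L.a i j ⬝ᵥ L.a i p) := fun i j =>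
        sum_congr rfl fun p _ => mul_comm _ _
      simp only [this, h2]
      ring
    rw [this, symS]
    have : ∀ i j, L.ev (L.D k (L.D k (L.nn i j ⬝ᵥ L.nn i j)))
        = 2 * (L.q k k i j ⬝ᵥ L.a i j) + 2 * (L.t k i j ⬝ᵥ L.t k i j)
          - 2 * ∑ m, (L.a i j ⬝ᵥ L.a k m) ^ 2 := fun i j => by
      rw [derivation_dotProduct, map_add, derivation_dotProduct, derivation_dotProduct]
      simp only [map_add, ev_dotProduct, hL.evv_nn, hL.evv_D_nn_dot]
      rw [dotProduct_comm (L.a i j), hL.evv_D_D_nn_dot _ _ _ _ _ (hL.a_dot i j)]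
      have : ∑ m, ((L.a i j ⬝ᵥ L.a k m) * (L.a k m ⬝ᵥ L.a i j)
          + (L.a i j ⬝ᵥ L.a k m) * (L.a k m ⬝ᵥ L.a i j)) = 2 * ∑ m, (L.a i j ⬝ᵥ L.a k m) ^ 2 := by
        rw [mul_sum]
        exact sum_congr rfl fun m _ => by rw [dotProduct_comm (L.a k m)]; ring
      rw [this]
      have : ∑ m, (L.a i j ⬝ᵥ L.a k m) * (L.a i j ⬝ᵥ L.a k m) = ∑ m, (L.a i j ⬝ᵥ L.a k m) ^ 2 :=
        sum_congr rfl fun m _ => by ring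
      rw [this]; ring
    simp only [this, hL.ev_D_D_G, sum_add_distrib, sum_sub_distrib, ← mul_sum]
    have : ∑ i, ∑ j, ∑ p, -(L.a k i ⬝ᵥ L.a k p + L.a k i ⬝ᵥ L.a k p) * (L.a i j ⬝ᵥ L.a p j)
        = -2 * ∑ i, ∑ j, ∑ p, (L.a k i ⬝ᵥ L.a k p) * (L.a i j ⬝ᵥ L.a p j) := by
      simp only [mul_sum]
      exact sum_congr rfl fun i _ => sum_congr rfl fun j _ => sum_congr rfl fun p _ => by ring
    rw [this]; ring
  have e2 : ∑ i, ∑ j, L.evv (dv L.D0 (L.f2 i j)) ⬝ᵥ L.a i j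
      = ∑ i, ∑ j, ∑ k, L.q i j k k ⬝ᵥ L.a i j
        - 2 * ∑ i, ∑ j, ∑ m, (L.h ⬝ᵥ L.a i m) * (L.a i j ⬝ᵥ L.a m j)
        - 2 * ∑ i, ∑ j, ∑ k, ∑ l, (L.a i k ⬝ᵥ L.a j l) * (L.a k l ⬝ᵥ L.a i j)
        + L.ev κ * ∑ i, ∑ j, L.a i j ⬝ᵥ L.a i j := by
    simp only [fun i j => hF.evv_D0_f2_dot hL i j _ (hL.a_dot i j), sum_add_distrib,
      sum_sub_distrib, ← mul_sum, add_mul, sum_dotProduct]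
    have h1 : ∑ i, ∑ j, ∑ m, (L.h ⬝ᵥ L.a i m) * (L.a j m ⬝ᵥ L.a i j)
        = ∑ i, ∑ j, ∑ m, (L.h ⬝ᵥ L.a i m) * (L.a i j ⬝ᵥ L.a m j) :=
      sum_congr rfl fun i _ => sum_congr rfl fun j _ => sum_congr rfl fun m _ => by
        rw [L.a_symm j m, dotProduct_comm (L.a m j)]
    have h2 : ∑ i, ∑ j, ∑ m, (L.h ⬝ᵥ L.a j m) * (L.a i m ⬝ᵥ L.a i j)
        = ∑ i, ∑ j, ∑ m, (L.h ⬝ᵥ L.a i m) * (L.a i j ⬝ᵥ L.a m j) := by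
      rw [← h1, sum_comm]
      exact sum_congr rfl fun i _ => sum_congr rfl fun j _ => sum_congr rfl fun m _ => by
        rw [L.a_symm j i]
    have h3 : ∑ i, ∑ j, ∑ k, ∑ l, (L.a j k ⬝ᵥ L.a i l) * (L.a k l ⬝ᵥ L.a i j)
        = ∑ i, ∑ j, ∑ k, ∑ l, (L.a i k ⬝ᵥ L.a j l) * (L.a k l ⬝ᵥ L.a i j) := by
      rw [sum_comm]
      exact sum_congr rfl fun i _ => sum_congr rfl fun j _ => sum_congr rfl fun k _ =>
        sum_congr rfl fun l _ => by rw [L.a_symm j i]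
    rw [h1, h2, h3]; ring
  have e3 : ∑ i, ∑ j, ∑ p, L.ev (L.D0 (L.G i p)) * (L.a i j ⬝ᵥ L.a p j)
      = 2 * ∑ i, ∑ j, ∑ p, (L.h ⬝ᵥ L.a i p) * (L.a i j ⬝ᵥ L.a p j)
        - 2 * L.ev κ * ∑ i, ∑ j, L.a i j ⬝ᵥ L.a i j := by
    simp only [hF.ev_D0_G hL, sub_mul, sum_sub_distrib, ite_mul, zero_mul, sum_ite_eq, mem_univ,
      if_true, mul_sum, mul_assoc]
  -- The core of Simons' identity: the Laplacian of h and the Hessian of H have the same fourth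
  -- order part, so it cancels in the heat operator.
  have q1 : ∑ k, ∑ i, ∑ j, L.q k k i j ⬝ᵥ L.a i j = ∑ i, ∑ j, ∑ k, L.q i j k k ⬝ᵥ L.a i j := by
    rw [sum_comm]
    refine sum_congr rfl fun i _ => ?_
    rw [sum_comm]
    exact sum_congr rfl fun j _ => sum_congr rfl fun k _ => by rw [L.q_symm]
  have q2 : ∑ k, ∑ i, ∑ j, ∑ m, (L.a i j ⬝ᵥ L.a k m) ^ 2
      = ∑ i, ∑ j, ∑ k, ∑ l, (L.a i j ⬝ᵥ L.a k l) ^ 2 := by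
    rw [sum_comm]
    exact sum_congr rfl fun i _ => sum_comm
  have q3 : ∑ k, ∑ i, ∑ j, ∑ p, (L.a k i ⬝ᵥ L.a k p) * (L.a i j ⬝ᵥ L.a p j)
      = ∑ i, ∑ j, ∑ k, ∑ l, (L.a i k ⬝ᵥ L.a j k) * (L.a i l ⬝ᵥ L.a j l) := by
    have : ∀ k i, ∑ j, ∑ p, (L.a k i ⬝ᵥ L.a k p) * (L.a i j ⬝ᵥ L.a p j)
        = ∑ p, ∑ j, (L.a i k ⬝ᵥ L.a p k) * (L.a i j ⬝ᵥ L.a p j) := fun k i => by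
      rw [sum_comm, L.a_symm k i]
      exact sum_congr rfl fun p _ => sum_congr rfl fun j _ => by rw [L.a_symm k p]
    simp only [this]
    rw [sum_comm]
    exact sum_congr rfl fun i _ => sum_comm
  have q4 : ∑ i, ∑ j, ∑ k, ∑ l, (L.a i k ⬝ᵥ L.a j l) * (L.a k l ⬝ᵥ L.a i j)
      = ∑ i, ∑ j, ∑ k, ∑ l, (L.a k i ⬝ᵥ L.a l j) * (L.a k l ⬝ᵥ L.a i j) :=
    sum_congr rfl fun i _ => sum_congr rfl fun j _ => sum_congr rfl fun k _ =>
      sum_congr rfl fun l _ => by rw [L.a_symm i k, L.a_symm j l]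
  rw [heat, e0, e2, e3]
  simp only [e1, sum_add_distrib, sum_sub_distrib, ← mul_sum]
  rw [q1, q2, q3, q4, quarticReaction_expand]
  ring

end ImmersionJet

end SphereMCF

end

/-! ### The trace-free part and the pinching inequality for the heat operator. -/

noncomputable section

namespace SphereMCF

set_option linter.unusedSimpArgs false

open Matrix Finset

/-- In this form multiples of the identity added to A or B affect the first sum only. -/
theorem quarticTerm_eq_commutator {n : ℕ} (A B : Matrix (Fin n) (Fin n) ℝ) (hA : Aᵀ = A)
    (hB : Bᵀ = B) : quarticTerm (fun i j => A i j) (fun i j => B i j)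
      = (∑ i, ∑ j, ∑ k, ∑ l, A i j * A k l * (B i j * B k l))
        - ((A * B - B * A) * (A * B - B * A)).trace := by
  have e1 : (A * B).trace ^ 2 = ∑ i, ∑ j, ∑ k, ∑ l, A i j * A k l * (B i j * B k l) := by
    have hs' : ∀ i j, B i j = B j i := fun i j => congrFun (congrFun hB j) i
    simp only [Matrix.trace, Matrix.diag, Matrix.mul_apply, sq, sum_mul_sum]
    refine sum_congr rfl fun i _ => ?_
    rw [sum_comm]
    refine sum_congr rfl fun j _ => sum_congr rfl fun k _ => sum_congr rfl fun l _ => ?_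
    rw [hs' j i, hs' l k]; ring
  have e2 : (A * B * B * A).trace = (A * A * B * B).trace := by
    rw [Matrix.trace_mul_comm, ← Matrix.mul_assoc, ← Matrix.mul_assoc]
  have e3 : (B * A * A * B).trace = (A * A * B * B).trace := by
    rw [Matrix.mul_assoc, Matrix.mul_assoc, Matrix.trace_mul_comm, ← Matrix.mul_assoc]
  have e4 : (B * A * B * A).trace = (A * B * A * B).trace := by
    rw [Matrix.mul_assoc, Matrix.mul_assoc, Matrix.trace_mul_comm, ← Matrix.mul_assoc]
  rw [quarticTerm_eq A B hA hB, e1, sub_mul, mul_sub, mul_sub]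
  simp only [← Matrix.mul_assoc, Matrix.trace_sub, e2, e3, e4]
  ring

/-- The quartic reaction term of a vector valued tensor as commutators of its components. -/
theorem quarticReaction_eq_commutator {n : ℕ} {ι : Type*} [Fintype ι] (h : Fin n → Fin n → ι → ℝ)
    (hs : ∀ i j, h i j = h j i) (C : ι → Matrix (Fin n) (Fin n) ℝ)
    (hC : ∀ a i j, C a i j = h i j a) :
    quarticReaction h = ∑ i, ∑ j, ∑ k, ∑ l, (h i j ⬝ᵥ h k l) ^ 2
      - ∑ a, ∑ b, ((C a * C b - C b * C a) * (C a * C b - C b * C a)).trace := by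
  have hCs : ∀ a, (C a)ᵀ = C a := fun a => by
    ext i j; rw [Matrix.transpose_apply, hC, hC, hs]
  have hdot : ∀ i j k l, h i j ⬝ᵥ h k l = ∑ a, C a i j * C a k l := fun i j k l => by
    simp [dotProduct, hC]
  rw [quarticReaction_eq_sum h (fun a i j => C a i j) hdot]
  simp only [fun a b => quarticTerm_eq_commutator (C a) (C b) (hCs a) (hCs b), sum_sub_distrib]
  rw [← sum_mul_sum_comm₄ (fun i j k l a => C a i j * C a k l)
    (fun i j k l a => C a i j * C a k l)]
  simp only [hdot, sq]

/-- Commutators ignore multiples of the identity, so only the sum of the ⟨h,h⟩² changes. Since h is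
trace-free, the only mixed terms that survive are the ⟨h i j, e⟩², each with weight n and arising
twice. -/
theorem quarticReaction_add_trace {n : ℕ} {ι : Type*} [Fintype ι] (h : Fin n → Fin n → ι → ℝ)
    (hs : ∀ i j, h i j = h j i) (h0 : ∑ i, h i i = 0) (e : ι → ℝ) :
    quarticReaction (fun i j => h i j + if i = j then e else 0)
      = quarticReaction h + 2 * n * ∑ i, ∑ j, (h i j ⬝ᵥ e) ^ 2 + n ^ 2 * (e ⬝ᵥ e) ^ 2 := by
  classical
  have hs' : ∀ i j, (h i j + if i = j then e else 0) = h j i + if j = i then e else 0 :=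
    fun i j => by simp [hs i j, eq_comm]
  rw [quarticReaction_eq_commutator _ hs' (fun a => Matrix.of (fun i j => h i j a) + e a • 1),
    quarticReaction_eq_commutator h hs (fun a => Matrix.of (fun i j => h i j a)) fun _ _ _ => rfl]
  rotate_left
  · intro a i j
    simp [Matrix.one_apply]
    split_ifs <;> simp
  have comm : ∀ (A B : Matrix (Fin n) (Fin n) ℝ) (p q : ℝ),
      (A + p • (1 : Matrix (Fin n) (Fin n) ℝ)) * (B + q • (1 : Matrix (Fin n) (Fin n) ℝ))
        - (B + q • (1 : Matrix (Fin n) (Fin n) ℝ)) * (A + p • (1 : Matrix (Fin n) (Fin n) ℝ))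
        = A * B - B * A := by
    intro A B p q
    simp only [add_mul, mul_add, Matrix.smul_mul, Matrix.mul_smul, Matrix.one_mul, Matrix.mul_one]
    rw [smul_comm p q]
    abel
  simp only [comm]
  have sq_exp : ∀ i j k l, ((h i j + if i = j then e else 0) ⬝ᵥ (h k l + if k = l then e else 0)) ^ 2
      = (h i j ⬝ᵥ h k l) ^ 2 + (if k = l then (h i j ⬝ᵥ e) ^ 2 else 0)
        + (if i = j then (h k l ⬝ᵥ e) ^ 2 else 0)
        + (if i = j then if k = l then (e ⬝ᵥ e) ^ 2 else 0 else 0)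
        + 2 * (if k = l then (h i j ⬝ᵥ h k k) * (h i j ⬝ᵥ e) else 0)
        + 2 * (if i = j then (h i i ⬝ᵥ h k l) * (h k l ⬝ᵥ e) else 0)
        + 2 * (if i = j then if k = l then (h i i ⬝ᵥ h k k) * (e ⬝ᵥ e) else 0 else 0)
        + 2 * (if i = j then if k = l then (h i i ⬝ᵥ e) * (h k k ⬝ᵥ e) else 0 else 0)
        + 2 * (if i = j then if k = l then (h i i ⬝ᵥ e) * (e ⬝ᵥ e) else 0 else 0)
        + 2 * (if i = j then if k = l then (h k k ⬝ᵥ e) * (e ⬝ᵥ e) else 0 else 0) := by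
    intro i j k l
    by_cases h1 : i = j <;> by_cases h2 : k = l <;>
      simp only [h1, h2, if_true, if_false, add_zero, add_dotProduct, dotProduct_add, mul_zero,
        zero_dotProduct, dotProduct_zero, dotProduct_comm e] <;> ring
  have t1 : ∀ v : ι → ℝ, ∑ k, v ⬝ᵥ h k k = 0 := fun v => by
    rw [← dotProduct_sum, h0, dotProduct_zero]
  have t2 : ∀ v : ι → ℝ, ∑ k, h k k ⬝ᵥ v = 0 := fun v => by
    rw [← sum_dotProduct, h0, zero_dotProduct]
  simp only [sq_exp, sum_add_distrib, ← mul_sum, sum_ite_eq, mem_univ, if_true, ← sum_mul, t1, t2,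
    zero_mul, mul_zero, add_zero, sum_const_zero, sum_ite_irrel, ite_self]
  have t3 : ∑ i, ∑ k, ∑ l, (h i i ⬝ᵥ h k l) * (h k l ⬝ᵥ e) = 0 := by
    rw [sum_comm]
    refine sum_eq_zero fun k _ => ?_
    rw [sum_comm]
    exact sum_eq_zero fun l _ => by rw [← sum_mul, t2, zero_mul]
  rw [t3]
  simp only [sum_const, card_univ, Fintype.card_fin, nsmul_eq_mul, ← mul_sum]
  ring

namespace ImmersionJet

variable {n N : ℕ} {A : Type*} [CommRing A] {L : ImmersionJet n N A} {κ : A}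

theorem heat_sub (L : ImmersionJet n N A) (u v : A) : L.heat (u - v) = L.heat u - L.heat v := by
  simp only [heat, map_sub, sum_sub_distrib]; ring

theorem heat_add (L : ImmersionJet n N A) (u v : A) : L.heat (u + v) = L.heat u + L.heat v := by
  simp only [heat, map_add, sum_add_distrib]; ring

theorem heat_mul (L : ImmersionJet n N A) {u v : A} (hu : ∀ i, L.D i u = 0) :
    L.heat (u * v) = L.ev u * L.heat v + L.ev v * L.ev (L.D0 u) := by
  simp only [heat, map_mul, map_add, Derivation.leibniz, smul_eq_mul, hu, mul_zero, add_zero,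
    mul_sub, mul_sum, map_zero]
  ring

/-- The trace free part of the second fundamental form. -/
def tf (L : ImmersionJet n N A) (i j : Fin n) : Fin N → ℝ :=
  L.a i j - if i = j then (n : ℝ)⁻¹ • L.h else 0

theorem IsGraph.ev_S (hL : L.IsGraph) : L.ev L.S = ∑ i, ∑ j, L.a i j ⬝ᵥ L.a i j := by
  simp [S, map_sum, hL.ev_G, ev_dotProduct, hL.evv_nn]

theorem IsGraph.ev_B (hL : L.IsGraph) : L.ev L.B = L.h ⬝ᵥ L.h := by
  rw [B, ev_dotProduct, hL.evv_Hv]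

/-- The image lies in a sphere. -/
structure IsSpherical (L : ImmersionJet n N A) (ρ : A) : Prop where
  D_const : ∀ i, L.D i ρ = 0
  eq : L.f ⬝ᵥ L.f = ρ

section Spherical

variable {ρ : A} (hS : L.IsSpherical ρ)
include hS

/-- The factor 2 stays because 2 need not be invertible in A; it is removed after evaluation in ℝ.
-/
theorem IsSpherical.f_dot_f1 (i : Fin n) : 2 * (L.f ⬝ᵥ L.f1 i) = 0 := by
  have := congrArg (L.D i) hS.eq
  rw [derivation_dotProduct, hS.D_const, dotProduct_comm] at this
  rw [two_mul]; exact this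

theorem IsSpherical.evv_f_dot_a (hL : L.IsGraph) (i j : Fin n) :
    L.evv L.f ⬝ᵥ L.a i j = -if i = j then 1 else 0 := by
  have := congrArg (fun x => L.ev (L.D i x)) (hS.f_dot_f1 j)
  simp only [Derivation.leibniz, derivation_dotProduct, map_add, map_mul, smul_eq_mul, map_zero,
    map_ofNat, ev_dotProduct] at this
  change 2 * (L.r i ⬝ᵥ L.r j + L.evv L.f ⬝ᵥ L.a i j) + _ * L.ev (L.D i 2) = 0 at this
  have h2 : L.D i (2 : A) = 0 := by
    have := (L.D i).map_natCast 2
    simpa using this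
  rw [h2, map_zero, mul_zero, hL.r_dot] at this
  linarith

theorem IsSpherical.evv_f_dot_h (hL : L.IsGraph) : L.evv L.f ⬝ᵥ L.h = -n := by
  rw [h, dotProduct_sum]
  simp [hS.evv_f_dot_a hL]

theorem IsSpherical.evv_f_sq : L.evv L.f ⬝ᵥ L.evv L.f = L.ev ρ := by
  rw [← ev_dotProduct, hS.eq]

/-- The trace-free part is tangent to the sphere, so it pairs equally with the spherical and the
Euclidean mean curvature vectors, which differ by a multiple of the position. -/
theorem IsSpherical.evv_f_dot_tf (hL : L.IsGraph) (hn : n ≠ 0) (i j : Fin n) :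
    L.evv L.f ⬝ᵥ L.tf i j = 0 := by
  rw [tf, dotProduct_sub, hS.evv_f_dot_a hL]
  split_ifs
  · rw [dotProduct_smul, hS.evv_f_dot_h hL]; simp [hn]
  · simp

end Spherical

theorem tf_symm (L : ImmersionJet n N A) (i j : Fin n) : L.tf i j = L.tf j i := by
  rw [tf, tf, a_symm]; simp [eq_comm]

theorem tf_trace (L : ImmersionJet n N A) (hn : n ≠ 0) : ∑ i, L.tf i i = 0 := by
  simp only [tf, if_true, sum_sub_distrib, sum_const, card_univ, Fintype.card_fin]
  rw [← Nat.cast_smul_eq_nsmul ℝ, smul_smul, mul_inv_cancel₀ (by exact_mod_cast hn), one_smul, h,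
    sub_self]

theorem a_eq_tf (L : ImmersionJet n N A) :
    L.a = fun i j => L.tf i j + if i = j then (n : ℝ)⁻¹ • L.h else 0 := by
  funext i j; simp [tf]

theorem sum_dotProduct_tf_sq (L : ImmersionJet n N A) (hn : n ≠ 0) :
    ∑ i, ∑ j, L.tf i j ⬝ᵥ L.tf i j
      = ∑ i, ∑ j, L.a i j ⬝ᵥ L.a i j - (L.h ⬝ᵥ L.h) / n := by
  have hn' : (n : ℝ) ≠ 0 := by exact_mod_cast hn
  have e : ∀ i j, L.tf i j ⬝ᵥ L.tf i j = L.a i j ⬝ᵥ L.a i j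
      - 2 * (n : ℝ)⁻¹ * (if i = j then L.a i i ⬝ᵥ L.h else 0)
      + (n : ℝ)⁻¹ ^ 2 * (if i = j then L.h ⬝ᵥ L.h else 0) := by
    intro i j
    rw [tf]
    split_ifs with hij
    · subst hij
      rw [sub_dotProduct, dotProduct_sub, dotProduct_sub, smul_dotProduct, dotProduct_smul,
        smul_dotProduct, dotProduct_smul, dotProduct_comm L.h (L.a i i)]
      simp only [smul_eq_mul]; ring
    · simp
  simp only [e, sum_add_distrib, sum_sub_distrib, ← mul_sum, sum_ite_eq, mem_univ, if_true,
    sum_const, card_univ, Fintype.card_fin, nsmul_eq_mul]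
  rw [← sum_dotProduct, ← h]
  generalize L.h ⬝ᵥ L.h = p
  field_simp
  ring

theorem sum_h_dot_a_sq (L : ImmersionJet n N A) (hn : n ≠ 0) :
    ∑ i, ∑ j, (L.h ⬝ᵥ L.a i j) ^ 2
      = ∑ i, ∑ j, (L.tf i j ⬝ᵥ L.h) ^ 2 + (L.h ⬝ᵥ L.h) ^ 2 / n := by
  have hn' : (n : ℝ) ≠ 0 := by exact_mod_cast hn
  have e : ∀ i j, (L.h ⬝ᵥ L.a i j) ^ 2 = (L.tf i j ⬝ᵥ L.h) ^ 2
      + 2 * (n : ℝ)⁻¹ * (L.h ⬝ᵥ L.h) * (if i = j then L.tf i i ⬝ᵥ L.h else 0)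
      + (n : ℝ)⁻¹ ^ 2 * (if i = j then (L.h ⬝ᵥ L.h) ^ 2 else 0) := by
    intro i j
    rw [L.a_eq_tf]
    simp only [dotProduct_add, dotProduct_comm L.h (L.tf i j)]
    split_ifs with hij
    · subst hij
      rw [dotProduct_smul, smul_eq_mul]; ring
    · simp
  simp only [e, sum_add_distrib, ← mul_sum, sum_ite_eq, mem_univ, if_true,
    ← sum_dotProduct, sum_const, card_univ, Fintype.card_fin, nsmul_eq_mul, L.tf_trace hn,
    zero_dotProduct, mul_zero, add_zero]
  field_simp

/-- The gradient of the second fundamental form bounds the gradient of the mean curvature. -/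
theorem three_mul_sum_trace_t_sq_le (L : ImmersionJet n N A) :
    3 * ∑ k, (∑ i, L.t k i i) ⬝ᵥ (∑ i, L.t k i i)
      ≤ (n + 2) * ∑ i, ∑ j, ∑ k, L.t i j k ⬝ᵥ L.t i j k := by
  have h1 : ∑ k, (∑ i, L.t k i i) ⬝ᵥ (∑ i, L.t k i i)
      = ∑ α, ∑ k, (∑ i, L.t i i k α) ^ 2 := by
    rw [sum_comm]
    refine sum_congr rfl fun k _ => ?_
    rw [dotProduct]
    refine sum_congr rfl fun α _ => ?_
    rw [Finset.sum_apply, ← sq]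
    exact congrArg (· ^ 2) (sum_congr rfl fun i _ => by rw [L.t_symm', L.t_symm])
  have h2 : ∑ i, ∑ j, ∑ k, L.t i j k ⬝ᵥ L.t i j k = ∑ α, ∑ i, ∑ j, ∑ k, L.t i j k α ^ 2 := by
    symm
    rw [sum_comm]
    refine sum_congr rfl fun i _ => ?_
    rw [sum_comm]
    refine sum_congr rfl fun j _ => ?_
    rw [sum_comm]
    exact sum_congr rfl fun k _ => by simp [dotProduct, sq]
  rw [h1, h2, mul_sum, mul_sum]
  exact sum_le_sum fun α _ => three_mul_sum_trace_sq_le (fun i j k => L.t i j k α)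
    (fun i j k => by rw [L.t_symm']) (fun i j k => by rw [L.t_symm])

/-- The final balance after all evolution equations are inserted. The gradient terms are absorbed if
4(n + 2) ≤ 9n, which n ≥ 2 ensures. The reaction terms give at most -2(n - 2b)Kφ, while the decay of
λ costs only (n - 2b)Kφ; the difference makes the inequality strict without a perturbation argument.
-/
theorem pinching_arith {n K b s x φ P t2 T2 lam Q : ℝ} (hn : 2 ≤ n) (hK : 0 < K)
    (hbn : 2 * b < n) (hT2 : 0 ≤ T2) (hgrad : 3 * T2 ≤ (n + 2) * t2) (hlam : lam ≤ 1) (hφ : 0 < φ)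
    (heq : φ = lam * (s / (3 * n) + b * K)) (hP : P = s + n ^ 2 * K)
    (hreact : Q + s * x / n - n * K * φ - lam * (1 / (3 * n)) * (s * x + s ^ 2 / n + n * K * s)
      ≤ -((n - 2 * b) * K * φ)) :
    -2 * t2 + 2 * (Q + 2 * (s * x) / n + P ^ 2 / n ^ 2)
      - 2 * (n * K) * (φ + P / n) - n⁻¹ * (-2 * T2 + 2 * (s * x + P ^ 2 / n) - 2 * (n * K) * P)
      - (lam * ((3 * n)⁻¹ * (-2 * T2 + 2 * (s * x + P ^ 2 / n) - 2 * (n * K) * P))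
        + (s / (3 * n) + b * K) * (-((n - 2 * b) * K) * lam)) < 0 := by
  have hnpos : 0 < n := by linarith
  have hgr : -2 * t2 + (2 / n + 2 * lam / (3 * n)) * T2 ≤ 0 := by
    have h1 : (2 / n + 2 * lam / (3 * n)) * T2 ≤ (2 / n + 2 * 1 / (3 * n)) * T2 := by gcongr
    have h2 : (2 / n + 2 * 1 / (3 * n)) * T2 = 8 * T2 / (3 * n) := by field_simp; ring
    have h3 : 8 * T2 / (3 * n) ≤ 2 * t2 := by
      rw [div_le_iff₀ (by positivity)]
      nlinarith
    linarith
  have hpos : 0 < (n - 2 * b) * K * φ := by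
    have : 0 < n - 2 * b := by linarith
    positivity
  have hfin : -2 * t2 + 2 * (Q + 2 * (s * x) / n + P ^ 2 / n ^ 2)
      - 2 * (n * K) * (φ + P / n) - n⁻¹ * (-2 * T2 + 2 * (s * x + P ^ 2 / n) - 2 * (n * K) * P)
      - (lam * ((3 * n)⁻¹ * (-2 * T2 + 2 * (s * x + P ^ 2 / n) - 2 * (n * K) * P))
        + (s / (3 * n) + b * K) * (-((n - 2 * b) * K) * lam))
      = (-2 * t2 + (2 / n + 2 * lam / (3 * n)) * T2)
        + 2 * (Q + s * x / n - n * K * φ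
          - lam * (1 / (3 * n)) * (s * x + s ^ 2 / n + n * K * s))
        + (n - 2 * b) * K * (lam * (s / (3 * n) + b * K)) := by
    rw [hP]; field_simp; ring
  rw [hfin, ← heq]
  linarith

/-- The heat operator applied to the difference of the trace free part and a decreasing multiple of
the pinching quantity is negative where the two are equal. -/
theorem heat_pinching_neg (hF : L.IsFlow κ) (hL : L.IsGraph) {ρ : A} (hS : L.IsSpherical ρ)
    (hn : 2 ≤ n) {K b : ℝ} (hK : 0 < K) (hκ : L.ev κ = n * K) (hρ : L.ev ρ = K⁻¹)
    (hb : 0 ≤ b) (hbn : 2 * b < n)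
    {ν α β Λ : A} (hν : L.ev ν = (n : ℝ)⁻¹) (hα : L.ev α = (3 * n : ℝ)⁻¹)
    (hβ : L.ev β = b * K - n * K / 3)
    (hDν : ∀ i, L.D i ν = 0) (hDα : ∀ i, L.D i α = 0) (hDβ : ∀ i, L.D i β = 0)
    (hDΛ : ∀ i, L.D i Λ = 0) (hD0ν : L.D0 ν = 0) (hD0α : L.D0 α = 0) (hD0β : L.D0 β = 0)
    (hD0Λ : L.ev (L.D0 Λ) = -((n - 2 * b) * K) * L.ev Λ)
    (hΛ0 : 0 ≤ L.ev Λ) (hΛ1 : L.ev Λ ≤ 1)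
    (hs : n ^ 2 * K < L.ev L.B)
    (hφ : 0 < L.ev (L.S - ν * L.B)) (heq : L.ev (L.S - ν * L.B) = L.ev (Λ * (α * L.B + β))) :
    L.heat (L.S - ν * L.B - Λ * (α * L.B + β)) < 0 := by
  have hn0 : n ≠ 0 := by omega
  have hnr : (2 : ℝ) ≤ n := by exact_mod_cast hn
  have hnpos : (0 : ℝ) < n := by linarith
  set P := L.ev L.B with hP
  have hPh : L.h ⬝ᵥ L.h = P := hL.ev_B.symm
  set s : ℝ := P - n ^ 2 * K with hs_def
  have hspos : 0 < s := by rw [hs_def]; linarith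
  -- This is the mean curvature vector inside the sphere, of squared length s. The hypothesis `hs`
  -- says that it does not vanish, so its direction `u` can serve as the unit vector of
  -- `quarticReaction_le`.
  set Hs : Fin N → ℝ := L.h + (n * K) • L.evv L.f with hHs
  have hHss : Hs ⬝ᵥ Hs = s := by
    rw [hHs, add_dotProduct, dotProduct_add, dotProduct_add, smul_dotProduct, dotProduct_smul,
      smul_dotProduct, dotProduct_smul, dotProduct_comm L.h (L.evv L.f), hS.evv_f_dot_h hL,
      hS.evv_f_sq, hρ, hPh, hs_def]
    simp only [smul_eq_mul]
    field_simp
    ring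
  have htfH : ∀ i j, L.tf i j ⬝ᵥ Hs = L.tf i j ⬝ᵥ L.h := fun i j => by
    rw [hHs, dotProduct_add, dotProduct_smul, dotProduct_comm _ (L.evv L.f),
      hS.evv_f_dot_tf hL hn0, smul_zero, add_zero]
  set u : Fin N → ℝ := (Real.sqrt s)⁻¹ • Hs with hu
  have hsq : Real.sqrt s * Real.sqrt s = s := Real.mul_self_sqrt hspos.le
  have hsq0 : Real.sqrt s ≠ 0 := (Real.sqrt_pos.2 hspos).ne'
  have hu1 : u ⬝ᵥ u = 1 := by
    rw [hu, smul_dotProduct, dotProduct_smul, hHss, smul_eq_mul, smul_eq_mul]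
    nth_rewrite 3 [← hsq]
    field_simp
  set x : ℝ := ∑ i, ∑ j, (L.tf i j ⬝ᵥ u) ^ 2 with hx
  have hsx : ∑ i, ∑ j, (L.tf i j ⬝ᵥ L.h) ^ 2 = s * x := by
    rw [hx]
    simp only [mul_sum]
    refine sum_congr rfl fun i _ => sum_congr rfl fun j _ => ?_
    rw [hu, dotProduct_smul, htfH, smul_eq_mul, mul_pow, inv_pow, Real.sq_sqrt hspos.le]
    field_simp
  set φ : ℝ := ∑ i, ∑ j, L.tf i j ⬝ᵥ L.tf i j with hφdef
  have hφS : L.ev L.S = φ + P / n := by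
    rw [hφdef, L.sum_dotProduct_tf_sq hn0, hL.ev_S, hPh]; ring
  have hxφ : 0 ≤ φ - x := by
    rw [hφdef, hx, ← sum_sub_distrib]
    refine sum_nonneg fun i _ => ?_
    rw [← sum_sub_distrib]
    refine sum_nonneg fun j _ => ?_
    have h1 := dotProduct_sub_smul_sub_smul (L.tf i j) (L.tf i j) u (L.tf i j ⬝ᵥ u) (L.tf i j ⬝ᵥ u)
    have h2 : 0 ≤ ∑ a, (L.tf i j a - (L.tf i j ⬝ᵥ u) * u a)
      * (L.tf i j a - (L.tf i j ⬝ᵥ u) * u a) := sum_nonneg fun a _ => mul_self_nonneg _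
    rw [hu1] at h1
    nlinarith
  have hQ := quarticReaction_le L.tf L.tf_symm u hu1 x (φ - x) hx (by rw [add_sub_cancel, hφdef])
  have hQa : quarticReaction L.a = quarticReaction L.tf + 2 * (s * x) / n + P ^ 2 / n ^ 2 := by
    rw [L.a_eq_tf, quarticReaction_add_trace _ L.tf_symm (L.tf_trace hn0)]
    simp only [dotProduct_smul, smul_dotProduct, smul_eq_mul, hPh, mul_pow, ← mul_sum, hsx]
    field_simp
  have hgrad := L.three_mul_sum_trace_t_sq_le
  set T2 := ∑ k, (∑ i, L.t k i i) ⬝ᵥ (∑ i, L.t k i i) with hT2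
  set t2 := ∑ i, ∑ j, ∑ k, L.t i j k ⬝ᵥ L.t i j k with ht2
  have hT2n : 0 ≤ T2 := sum_nonneg fun k _ => by
    rw [dotProduct]; exact sum_nonneg fun a _ => mul_self_nonneg _
  have hhS := hF.heat_S hL
  have hhB := hF.heat_B hL
  rw [L.sum_h_dot_a_sq hn0, hsx, hPh, hκ, ← hT2] at hhB
  rw [hQa, hκ, ← hL.ev_S, hφS, ← ht2] at hhS
  set lam := L.ev Λ with hlam
  have hφ' : L.ev (L.S - ν * L.B) = φ := by
    rw [map_sub, map_mul, hν, hφS, ← hP]; field_simp; ring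
  -- The shift -nK/3 in β compensates for the extra n²K in the Euclidean |H|².
  have hW : L.ev (α * L.B + β) = s / (3 * n) + b * K := by
    rw [map_add, map_mul, hα, hβ, ← hP, hs_def]; field_simp; ring
  rw [hφ'] at hφ heq
  rw [map_mul, hW] at heq
  have hreact := reaction_le (n := n) (K := K) (s := s) (x := x) (y := φ - x) (f := lam) (b := b)
    hnpos hK hb hbn.le hspos.le hΛ0 hΛ1 hxφ (by rw [add_sub_cancel]; exact heq)
  rw [heat_sub, heat_sub, L.heat_mul hDν, L.heat_mul hDΛ, L.heat_add, L.heat_mul hDα, hD0ν, hD0α,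
    hW, hD0Λ, hν, hα]
  have hβ0 : L.heat β = 0 := by simp [heat, hDβ, hD0β]
  rw [hβ0, hhS, hhB, ← hlam]
  simp only [map_zero, mul_zero, add_zero]
  have hPs : P = s + n ^ 2 * K := by rw [hs_def]; ring
  rw [add_sub_cancel] at hreact
  exact pinching_arith hnr hK hbn hT2n hgrad hΛ1 hφ heq hPs (hreact.trans' (by gcongr))

end ImmersionJet

end SphereMCF

end

/-! ### Umbilic jets, and the ring of germs of smooth functions. -/

noncomputable section

namespace SphereMCF

set_option linter.unusedSimpArgs false

open Matrix Finset Filter Topology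

namespace ImmersionJet

variable {n N : ℕ} {A : Type*} [CommRing A] {L : ImmersionJet n N A} {κ : A}

/-- At a point of an immersion which is umbilic nearby, the second fundamental form is pure trace. -/
theorem IsGraph.a_of_umbilic (hL : L.IsGraph) {ν : A} (hν : L.ev ν = (n : ℝ)⁻¹)
    (hu : ∀ i j α, L.nn i j α = ν * L.g i j * L.Hv α) (i j : Fin n) :
    L.a i j = if i = j then (n : ℝ)⁻¹ • L.h else 0 := by
  funext α
  have := congrArg L.ev (hu i j α)
  rw [map_mul, map_mul, hν, hL.ev_g] at this
  have h1 := congrFun (hL.evv_nn i j) α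
  have h2 := congrFun hL.evv_Hv α
  simp only [evv] at h1 h2
  rw [← h1, this, h2]
  split_ifs <;> simp

/-- The mean curvature vector of an umbilic immersion is parallel in the normal bundle. -/
theorem IsGraph.evv_D_Hv_of_umbilic (hL : L.IsGraph) (hn : 2 ≤ n) {ν : A}
    (hν : L.ev ν = (n : ℝ)⁻¹) (hDν : ∀ i, L.D i ν = 0)
    (hu : ∀ i j α, L.nn i j α = ν * L.g i j * L.Hv α) (k : Fin n) :
    L.evv (dv (L.D k) L.Hv) = -((L.h ⬝ᵥ L.h) / n) • L.r k := by
  have ha := hL.a_of_umbilic hν hu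
  have hn0 : (n : ℝ) ≠ 0 := by positivity
  have hd : ∀ k i j, L.evv (dv (L.D k) (L.nn i j))
      = (if i = j then (n : ℝ)⁻¹ else 0) • L.evv (dv (L.D k) L.Hv) := by
    intro k i j
    funext α
    simp only [evv, dv, hu, Derivation.leibniz, smul_eq_mul, map_add, map_mul, hDν, hν, hL.ev_g,
      hL.ev_D_g, mul_zero, add_zero, Pi.smul_apply, map_zero, zero_add]
    split_ifs <;> simp
  have hT : ∀ k, ∑ i, L.t k i i = 0 := by
    intro k
    -- Codazzi: ∇_k h_ii = ∇_i h_ki. For i ≠ k umbilicity turns the left side into ∇_k H / n and the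
    -- right side into zero. This is where n ≥ 2 is needed.
    obtain ⟨i, hik⟩ : ∃ i : Fin n, i ≠ k := by
      have : Nontrivial (Fin n) := Fin.nontrivial_iff_two_le.2 hn
      exact exists_ne k
    have key : ∀ v : Fin N → ℝ, (∀ l, v ⬝ᵥ L.r l = 0) → (∑ i, L.t k i i) ⬝ᵥ v = 0 := by
      intro v hv
      have e1 := congrArg (· ⬝ᵥ v) (hd k i i)
      have e2 := congrArg (· ⬝ᵥ v) (hd i k i)
      simp only [hL.evv_D_nn, hL.evv_D_Hv, sub_dotProduct, dot_sum_smul_eq_zero _ v hv, sub_zero,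
        if_true, smul_dotProduct, Ne.symm hik, if_false, zero_smul, zero_dotProduct,
        smul_eq_mul, mul_zero, zero_mul] at e1 e2
      rw [L.t_symm', e2] at e1
      have := (mul_eq_zero.1 e1.symm).resolve_left (inv_ne_zero hn0)
      exact this
    have := key (∑ i, L.t k i i) fun l => by simp [sum_dotProduct, hL.t_dot]
    exact dotProduct_self_eq_zero.1 this
  rw [hL.evv_D_Hv, hT]
  have : ∀ l, L.h ⬝ᵥ L.a k l = if k = l then (L.h ⬝ᵥ L.h) / n else 0 := fun l => by
    rw [ha]; split_ifs
    · rw [dotProduct_smul, smul_eq_mul]; field_simp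
    · simp
  simp [this]

end ImmersionJet

section Germs

variable {Z : Type*} [NormedAddCommGroup Z] [NormedSpace ℝ Z]

/-- The germs at `z₀` of smooth functions. -/
def smoothGerm (z₀ : Z) : Subring (Germ (𝓝 z₀) ℝ) where
  carrier := {a | ∃ f : Z → ℝ, ContDiffAt ℝ ∞ f z₀ ∧ a = ↑f}
  mul_mem' := by
    rintro _ _ ⟨f, hf, rfl⟩ ⟨g, hg, rfl⟩
    exact ⟨f * g, hf.mul hg, rfl⟩
  one_mem' := ⟨1, contDiffAt_const, rfl⟩
  add_mem' := by
    rintro _ _ ⟨f, hf, rfl⟩ ⟨g, hg, rfl⟩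
    exact ⟨f + g, hf.add hg, rfl⟩
  zero_mem' := ⟨0, contDiffAt_const, rfl⟩
  neg_mem' := by
    rintro _ ⟨f, hf, rfl⟩
    exact ⟨-f, hf.neg, rfl⟩

namespace smoothGerm

variable {z₀ : Z}

/-- The germ of a smooth function. -/
def mk (f : Z → ℝ) (hf : ContDiffAt ℝ ∞ f z₀) : smoothGerm z₀ := ⟨↑f, f, hf, rfl⟩

/-- The function `f` represents the germ `a`. -/
def Rep (a : smoothGerm z₀) (f : Z → ℝ) : Prop := (a : Germ (𝓝 z₀) ℝ) = ↑f

theorem rep_mk (f : Z → ℝ) (hf : ContDiffAt ℝ ∞ f z₀) : Rep (mk f hf) f := rfl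

theorem exists_rep (a : smoothGerm z₀) : ∃ f, ContDiffAt ℝ ∞ f z₀ ∧ Rep a f := a.2

theorem Rep.congr {a : smoothGerm z₀} {f g : Z → ℝ} (h : Rep a f) (hfg : f =ᶠ[𝓝 z₀] g) :
    Rep a g := h.trans (Germ.coe_eq.2 hfg)

theorem Rep.eventuallyEq {a : smoothGerm z₀} {f g : Z → ℝ} (h : Rep a f) (h' : Rep a g) :
    f =ᶠ[𝓝 z₀] g := Germ.coe_eq.1 (h.symm.trans h')

theorem Rep.eq {a b : smoothGerm z₀} {f g : Z → ℝ} (h : Rep a f) (h' : Rep b g)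
    (hfg : f =ᶠ[𝓝 z₀] g) : a = b := Subtype.ext ((h.congr hfg).trans h'.symm)

/-- Any function representing an element of the ring is smooth at the point; the regularity of φ, W
and H in a chart is obtained from this. -/
theorem Rep.contDiffAt {a : smoothGerm z₀} {f : Z → ℝ} (h : Rep a f) : ContDiffAt ℝ ∞ f z₀ := by
  obtain ⟨g, hg, hag⟩ := exists_rep a
  exact hg.congr_of_eventuallyEq (h.eventuallyEq hag)

theorem Rep.add {a b : smoothGerm z₀} {f g : Z → ℝ} (h : Rep a f) (h' : Rep b g) :
    Rep (a + b) (fun z => f z + g z) := by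
  rw [Rep, Subring.coe_add, h, h']; rfl

theorem Rep.sub {a b : smoothGerm z₀} {f g : Z → ℝ} (h : Rep a f) (h' : Rep b g) :
    Rep (a - b) (fun z => f z - g z) := by
  change (a : Germ (𝓝 z₀) ℝ) - b = _
  rw [h, h']; rfl

theorem Rep.mul {a b : smoothGerm z₀} {f g : Z → ℝ} (h : Rep a f) (h' : Rep b g) :
    Rep (a * b) (fun z => f z * g z) := by
  rw [Rep, Subring.coe_mul, h, h']; rfl

theorem Rep.sum {ι : Type*} {s : Finset ι} {a : ι → smoothGerm z₀} {f : ι → Z → ℝ}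
    (h : ∀ i, Rep (a i) (f i)) : Rep (∑ i ∈ s, a i) (fun z => ∑ i ∈ s, f i z) := by
  classical
  induction s using Finset.induction_on with
  | empty => simp only [sum_empty]; rfl
  | insert i s hi ih => simp only [sum_insert hi]; exact (h i).add ih

/-- The evaluation of a germ at its point. -/
def ev (z₀ : Z) : smoothGerm z₀ →+* ℝ := (Germ.valueRingHom).comp (smoothGerm z₀).subtype

theorem Rep.ev {a : smoothGerm z₀} {f : Z → ℝ} (h : Rep a f) : ev z₀ a = f z₀ := by
  change Germ.value (a : Germ (𝓝 z₀) ℝ) = f z₀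
  rw [h]; rfl

/-- A directional derivative on germs of functions. -/
def dGerm (v : Z) : Germ (𝓝 z₀) ℝ → Germ (𝓝 z₀) ℝ :=
  Germ.map' (fun f z => fderiv ℝ f z v) fun f g h => by
    filter_upwards [h.fderiv (𝕜 := ℝ)] with z hz
    rw [hz]

theorem dGerm_coe (v : Z) (f : Z → ℝ) :
    dGerm (z₀ := z₀) v ↑f = ↑(fun z => fderiv ℝ f z v) := Germ.map'_coe _ _ _

theorem contDiffAt_fderiv_apply {f : Z → ℝ} (hf : ContDiffAt ℝ ∞ f z₀) (v : Z) :
    ContDiffAt ℝ ∞ (fun z => fderiv ℝ f z v) z₀ :=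
  (hf.fderiv_right (m := ∞) (by simp)).clm_apply contDiffAt_const

theorem eventually_differentiableAt {f : Z → ℝ} (hf : ContDiffAt ℝ ∞ f z₀) :
    ∀ᶠ z in 𝓝 z₀, DifferentiableAt ℝ f z := by
  have h1 : ContDiffAt ℝ 1 f z₀ := hf.of_le (mod_cast le_top)
  filter_upwards [h1.eventually (by simp)] with z hz
  exact hz.differentiableAt (by simp)

/-- The directional derivative as a derivation of the ring of smooth germs. -/
def d (v : Z) : Derivation ℤ (smoothGerm z₀) (smoothGerm z₀) :=
  Derivation.mk' (AddMonoidHom.toIntLinearMap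
    { toFun := fun a => ⟨dGerm v a, by
        obtain ⟨f, hf, ha⟩ := exists_rep a
        exact ⟨_, contDiffAt_fderiv_apply hf v, by rw [ha, dGerm_coe]⟩⟩
      map_zero' := by
        refine Subtype.ext ?_
        change dGerm v (((fun _ => 0 : Z → ℝ) : Germ (𝓝 z₀) ℝ)) = ((fun _ => 0 : Z → ℝ) : Germ (𝓝 z₀) ℝ)
        rw [dGerm_coe]
        exact Germ.coe_eq.2 (Eventually.of_forall fun z => by simp)
      map_add' := fun a b => by
        obtain ⟨f, hf, ha⟩ := exists_rep a
        obtain ⟨g, hg, hb⟩ := exists_rep b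
        refine Subtype.ext ?_
        change dGerm v (a + b : Germ (𝓝 z₀) ℝ) = dGerm v a + dGerm v b
        rw [ha, hb, ← Germ.coe_add, dGerm_coe, dGerm_coe, dGerm_coe]
        refine Germ.coe_eq.2 ?_
        filter_upwards [eventually_differentiableAt hf, eventually_differentiableAt hg] with z h h'
        rw [fderiv_add h h']; rfl })
    fun a b => by
      obtain ⟨f, hf, ha⟩ := exists_rep a
      obtain ⟨g, hg, hb⟩ := exists_rep b
      refine Subtype.ext ?_
      change dGerm v ((a : Germ (𝓝 z₀) ℝ) * (b : Germ (𝓝 z₀) ℝ))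
        = (a : Germ (𝓝 z₀) ℝ) * dGerm v (b : Germ (𝓝 z₀) ℝ)
          + (b : Germ (𝓝 z₀) ℝ) * dGerm v (a : Germ (𝓝 z₀) ℝ)
      rw [ha, hb, ← Germ.coe_mul, dGerm_coe, dGerm_coe, dGerm_coe]
      refine Germ.coe_eq.2 ?_
      filter_upwards [eventually_differentiableAt hf, eventually_differentiableAt hg] with z h h'
      rw [fderiv_mul h h']; rfl

theorem Rep.d {a : smoothGerm z₀} {f : Z → ℝ} (h : Rep a f) (v : Z) :
    Rep (d v a) (fun z => fderiv ℝ f z v) := by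
  change dGerm v (a : Germ (𝓝 z₀) ℝ) = _
  rw [h, dGerm_coe]

theorem d_comm (v w : Z) (a : smoothGerm z₀) : d v (d w a) = d w (d v a) := by
  obtain ⟨f, hf, ha⟩ := exists_rep a
  refine ((ha.d w).d v).eq ((ha.d v).d w) ?_
  have h2 : ContDiffAt ℝ 2 f z₀ := hf.of_le ENat.LEInfty.out
  filter_upwards [h2.eventually (by simp)] with z hz
  have hd : DifferentiableAt ℝ (fderiv ℝ f) z :=
    (hz.fderiv_right (m := 1) (by norm_num)).differentiableAt (by simp)
  have := hz.isSymmSndFDerivAt (by simp) v w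
  rw [fderiv_clm_apply hd (by fun_prop), fderiv_clm_apply hd (by fun_prop)]
  simpa using this

theorem rep_const (c : ℝ) : Rep (mk (z₀ := z₀) (fun _ => c) contDiffAt_const) fun _ => c := rfl

theorem d_const (v : Z) (c : ℝ) : d v (mk (z₀ := z₀) (fun _ => c) contDiffAt_const) = 0 :=
  ((rep_const c).d v).eq (g := fun _ => 0) rfl (Eventually.of_forall fun z => by simp)

end smoothGerm

end Germs

end SphereMCF

end

/-! ### Change of frame, and the spherical versus the Euclidean second fundamental form. -/

noncomputable section

namespace SphereMCF

set_option linter.unusedSimpArgs false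

open Matrix Finset

section PointData

variable {n : ℕ} {V : Type*} [NormedAddCommGroup V] [InnerProductSpace ℝ V]

/-- The Gram matrix of a family of vectors. -/
def gramM (v : Fin n → V) : Matrix (Fin n) (Fin n) ℝ := Matrix.of fun i j => inner ℝ (v i) (v j)

/-- The second fundamental form of a submanifold of a sphere at `p` with coordinate vectors `v` and
second derivatives `s`. -/
def sff [FiniteDimensional ℝ V] (p : V) (v : Fin n → V) (s : Fin n → Fin n → V) (i j : Fin n) : V :=
  (Submodule.span ℝ (insert p (Set.range v)))ᗮ.starProjection (s i j)

def traceG {W : Type*} [AddCommGroup W] [Module ℝ W] (v : Fin n → V) (h : Fin n → Fin n → W) : W :=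
  ∑ i, ∑ j, (gramM v)⁻¹ i j • h i j

def normSqG (v : Fin n → V) (h : Fin n → Fin n → V) : ℝ :=
  ∑ i, ∑ j, ∑ p, ∑ q, (gramM v)⁻¹ i p * (gramM v)⁻¹ j q * inner ℝ (h i j) (h p q)

theorem sum_comm₂₂ {W : Type*} [AddCommMonoid W] (f : Fin n → Fin n → Fin n → Fin n → W) :
    ∑ i, ∑ j, ∑ k, ∑ l, f i j k l = ∑ k, ∑ l, ∑ i, ∑ j, f i j k l := by
  have h1 : ∑ i, ∑ j, ∑ k, ∑ l, f i j k l
      = ∑ x : Fin n × Fin n, ∑ y : Fin n × Fin n, f x.1 x.2 y.1 y.2 := by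
    simp only [Fintype.sum_prod_type]
  have h2 : ∑ k, ∑ l, ∑ i, ∑ j, f i j k l
      = ∑ y : Fin n × Fin n, ∑ x : Fin n × Fin n, f x.1 x.2 y.1 y.2 := by
    simp only [Fintype.sum_prod_type]
  rw [h1, h2, sum_comm]

theorem sum_smul_congruence {W : Type*} [AddCommGroup W] [Module ℝ W]
    (P J : Matrix (Fin n) (Fin n) ℝ) (T : Fin n → Fin n → W) :
    ∑ i, ∑ p, P i p • ∑ a, ∑ c, (J a i * J c p) • T a c
      = ∑ a, ∑ c, (J * P * Jᵀ) a c • T a c := by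
  have e : ∀ a c, (J * P * Jᵀ) a c = ∑ i, ∑ p, J a i * P i p * J c p := fun a c => by
    simp only [Matrix.mul_apply, Matrix.transpose_apply, sum_mul]
    exact sum_comm
  simp only [e, sum_smul, smul_sum, smul_smul]
  rw [sum_comm₂₂]
  exact sum_congr rfl fun a _ => sum_congr rfl fun c _ => sum_congr rfl fun i _ =>
    sum_congr rfl fun p _ => by congr 1; ring

variable {v v' : Fin n → V} {J : Matrix (Fin n) (Fin n) ℝ}

theorem gramM_congruence (hv : ∀ i, v' i = ∑ a, J a i • v a) : gramM v' = Jᵀ * gramM v * J := by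
  ext i j
  simp only [gramM, Matrix.of_apply, hv, Matrix.mul_apply, Matrix.transpose_apply, sum_inner,
    inner_sum, inner_smul_left, inner_smul_right, sum_mul, mul_sum, RCLike.conj_to_real]
  exact sum_congr rfl fun a _ => sum_congr rfl fun c _ => by ring

theorem gramM_inv_congruence (hv : ∀ i, v' i = ∑ a, J a i • v a) (hd : IsUnit (gramM v').det) :
    IsUnit J.det ∧ J * (gramM v')⁻¹ * Jᵀ = (gramM v)⁻¹ := by
  have hg := gramM_congruence hv
  have hd' := hd
  rw [hg, Matrix.det_mul, Matrix.det_mul, Matrix.det_transpose] at hd'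
  have hJ : IsUnit J.det := isUnit_of_mul_isUnit_right hd'
  refine ⟨hJ, ?_⟩
  rw [hg, Matrix.mul_inv_rev, Matrix.mul_inv_rev, ← Matrix.mul_assoc, Matrix.mul_nonsing_inv _ hJ,
    Matrix.one_mul, Matrix.mul_assoc, ← Matrix.transpose_nonsing_inv, ← Matrix.transpose_mul,
    Matrix.mul_nonsing_inv _ hJ, Matrix.transpose_one, Matrix.mul_one]

theorem traceG_congruence {W : Type*} [AddCommGroup W] [Module ℝ W] {h h' : Fin n → Fin n → W}
    (hv : ∀ i, v' i = ∑ a, J a i • v a) (hd : IsUnit (gramM v').det)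
    (hh : ∀ i j, h' i j = ∑ a, ∑ b, (J a i * J b j) • h a b) : traceG v' h' = traceG v h := by
  simp only [traceG, hh]
  rw [sum_smul_congruence, (gramM_inv_congruence hv hd).2]

theorem normSqG_eq (h : Fin n → Fin n → V) : normSqG v h
    = ∑ i, ∑ p, (gramM v)⁻¹ i p • ∑ j, ∑ q, (gramM v)⁻¹ j q • (inner ℝ (h i j) (h p q) : ℝ) := by
  simp only [normSqG, smul_eq_mul, mul_sum]
  refine sum_congr rfl fun i _ => ?_
  rw [sum_comm]
  exact sum_congr rfl fun p _ => sum_congr rfl fun j _ => sum_congr rfl fun q _ => by ring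

theorem normSqG_congruence {h h' : Fin n → Fin n → V}
    (hv : ∀ i, v' i = ∑ a, J a i • v a) (hd : IsUnit (gramM v').det)
    (hh : ∀ i j, h' i j = ∑ a, ∑ b, (J a i * J b j) • h a b) : normSqG v' h' = normSqG v h := by
  obtain ⟨_, hi⟩ := gramM_inv_congruence hv hd
  have hh1 : ∀ i j p q, (inner ℝ (h' i j) (h' p q) : ℝ) = ∑ b, ∑ d, (J b j * J d q) •
      ∑ a, ∑ c, (J a i * J c p) • (inner ℝ (h a b) (h c d) : ℝ) := by
    intro i j p q
    simp only [hh, sum_inner, inner_sum, inner_smul_left, inner_smul_right, RCLike.conj_to_real,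
      smul_eq_mul, mul_sum]
    rw [sum_comm₂₂ (fun b d a c => J b j * J d q * (J a i * J c p * inner ℝ (h a b) (h c d)))]
    rw [sum_comm₂₂]
    refine sum_congr rfl fun a _ => ?_
    rw [sum_comm]
    exact sum_congr rfl fun c _ => sum_congr rfl fun b _ => sum_congr rfl fun d _ => by ring
  rw [normSqG_eq, normSqG_eq]
  -- One pair of indices is contracted at a time, the identity J g'⁻¹ Jᵀ = g⁻¹ being used once for
  -- each pair.
  have h2 : ∀ i p, ∑ j, ∑ q, (gramM v')⁻¹ j q • (inner ℝ (h' i j) (h' p q) : ℝ)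
      = ∑ a, ∑ c, (J a i * J c p) • ∑ b, ∑ d, (gramM v)⁻¹ b d • (inner ℝ (h a b) (h c d) : ℝ) := by
    intro i p
    simp only [hh1]
    rw [sum_smul_congruence, hi]
    simp only [smul_sum]
    rw [sum_comm₂₂]
    exact sum_congr rfl fun a _ => sum_congr rfl fun c _ => sum_congr rfl fun b _ =>
      sum_congr rfl fun d _ => smul_comm _ _ _
  simp only [h2]
  rw [sum_smul_congruence, hi]

variable [FiniteDimensional ℝ V]

/-- J is invertible, so both frames have the same span. The inhomogeneous term Q of the second order
chain rule is tangential and is killed by the projection. -/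
theorem sff_congruence {p : V} {s s' : Fin n → Fin n → V} {Q : Fin n → Fin n → Fin n → ℝ}
    (hv : ∀ i, v' i = ∑ a, J a i • v a) (hd : IsUnit (gramM v').det)
    (hs : ∀ i j, s' i j = ∑ a, ∑ b, (J a i * J b j) • s a b + ∑ a, Q i j a • v a) (i j : Fin n) :
    sff p v' s' i j = ∑ a, ∑ b, (J a i * J b j) • sff p v s a b := by
  have hJ := (gramM_inv_congruence hv hd).1
  have hv2 : ∀ a, v a = ∑ i, J⁻¹ i a • v' i := by
    intro a
    simp only [hv, smul_sum, smul_smul]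
    rw [sum_comm]
    have : ∀ b, ∑ i, (J⁻¹ i a * J b i) • v b = (if b = a then (1 : ℝ) else 0) • v b := fun b => by
      rw [← sum_smul]
      congr 1
      have := congrFun (congrFun (Matrix.mul_nonsing_inv _ hJ) b) a
      rw [Matrix.mul_apply, Matrix.one_apply] at this
      rw [← this]
      exact sum_congr rfl fun i _ => mul_comm _ _
    simp [this]
  have hspan : Submodule.span ℝ (insert p (Set.range v')) = Submodule.span ℝ (insert p (Set.range v)) := by
    rw [Submodule.span_insert, Submodule.span_insert]
    congr 1
    apply le_antisymm
    · rw [Submodule.span_le]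
      rintro _ ⟨i, rfl⟩
      rw [hv]
      exact Submodule.sum_mem _ fun a _ => Submodule.smul_mem _ _ (Submodule.subset_span ⟨a, rfl⟩)
    · rw [Submodule.span_le]
      rintro _ ⟨i, rfl⟩
      rw [hv2]
      exact Submodule.sum_mem _ fun a _ => Submodule.smul_mem _ _ (Submodule.subset_span ⟨a, rfl⟩)
  have hv0 : ∀ a, (Submodule.span ℝ (insert p (Set.range v)))ᗮ.starProjection (v a) = 0 := fun a => by
    rw [Submodule.starProjection_apply_eq_zero_iff]
    exact Submodule.le_orthogonal_orthogonal _ (Submodule.subset_span (Or.inr ⟨a, rfl⟩))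
  simp only [sff, hspan, hs, map_add, map_sum, map_smul, hv0, smul_zero, sum_const_zero, add_zero]

/-- The normal part of `s i j`, with respect to the span of the coordinate vectors only. -/
def normalPart (v : Fin n → V) (s : Fin n → Fin n → V) (i j : Fin n) : V :=
  s i j - ∑ k, (∑ l, (gramM v)⁻¹ k l * inner ℝ (s i j) (v l)) • v k

omit [FiniteDimensional ℝ V] in
theorem inner_normalPart (hd : IsUnit (gramM v).det) (s : Fin n → Fin n → V) (i j m : Fin n) :
    inner ℝ (v m) (normalPart v s i j) = 0 := by
  have h1 : ∀ l, ∑ k, gramM v m k * (gramM v)⁻¹ k l = if m = l then 1 else 0 := fun l => by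
    have := congrFun (congrFun (Matrix.mul_nonsing_inv _ hd) m) l
    rwa [Matrix.mul_apply, Matrix.one_apply] at this
  rw [normalPart, inner_sub_right, inner_sum]
  have : ∑ k, inner ℝ (v m) ((∑ l, (gramM v)⁻¹ k l * inner ℝ (s i j) (v l)) • v k)
      = ∑ l, (∑ k, gramM v m k * (gramM v)⁻¹ k l) * inner ℝ (s i j) (v l) := by
    simp only [inner_smul_right, sum_mul]
    rw [sum_comm]
    exact sum_congr rfl fun l _ => sum_congr rfl fun k _ => by simp [gramM]; ring
  rw [this]
  simp [h1, real_inner_comm]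

variable {p : V} {s : Fin n → Fin n → V} {K : ℝ}

/-- The Euclidean normal part still has a component along the position p. As ⟨p, s i j⟩ = -g i j and
|p|² = 1/K, removing it means adding K g i j p. -/
theorem sff_eq_normalPart (hd : IsUnit (gramM v).det) (hpv : ∀ i, inner ℝ p (v i) = 0)
    (hps : ∀ i j, inner ℝ p (s i j) = -gramM v i j) (hK : inner ℝ p p = K⁻¹) (hK0 : K ≠ 0)
    (i j : Fin n) : sff p v s i j = normalPart v s i j + (K * gramM v i j) • p := by
  have hpn : inner ℝ p (normalPart v s i j) = -gramM v i j := by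
    rw [normalPart, inner_sub_right, inner_sum, hps]
    simp [inner_smul_right, hpv]
  rw [sff]
  refine Submodule.eq_starProjection_of_mem_orthogonal ?_ ?_
  · rw [Submodule.mem_orthogonal]
    intro u hu
    induction hu using Submodule.span_induction with
    | mem x hx =>
      rcases hx with rfl | ⟨m, rfl⟩
      · rw [inner_add_right, inner_smul_right, hpn, hK]; field_simp; ring
      · rw [inner_add_right, inner_smul_right, inner_normalPart hd, real_inner_comm, hpv]; simp
    | zero => simp
    | add x y _ _ hx hy => rw [inner_add_left, hx, hy, add_zero]
    | smul a x _ hx => rw [inner_smul_left, hx, mul_zero]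
  · refine Submodule.le_orthogonal_orthogonal _ ?_
    have : s i j - (normalPart v s i j + (K * gramM v i j) • p)
        = (∑ k, (∑ l, (gramM v)⁻¹ k l * inner ℝ (s i j) (v l)) • v k) - (K * gramM v i j) • p := by
      rw [normalPart]; abel
    rw [this]
    refine Submodule.sub_mem _ (Submodule.sum_mem _ fun k _ => Submodule.smul_mem _ _
      (Submodule.subset_span (Or.inr ⟨k, rfl⟩))) (Submodule.smul_mem _ _
      (Submodule.subset_span (Or.inl rfl)))

omit [FiniteDimensional ℝ V] in
theorem traceG_gramM (hd : IsUnit (gramM v).det) : traceG v (gramM v) = n := by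
  have h1 : ∀ i, ∑ j, (gramM v)⁻¹ i j * gramM v i j = 1 := fun i => by
    have := congrFun (congrFun (Matrix.nonsing_inv_mul _ hd) i) i
    rw [Matrix.mul_apply, Matrix.one_apply_eq] at this
    rw [← this]
    exact sum_congr rfl fun j _ => by simp [gramM, real_inner_comm]
  change ∑ i, ∑ j, (gramM v)⁻¹ i j • gramM v i j = n
  simp [h1]

omit [FiniteDimensional ℝ V] in
theorem sum_gramM_inv_mul (hd : IsUnit (gramM v).det) (i j : Fin n) :
    ∑ p, (gramM v)⁻¹ i p * gramM v p j = if i = j then 1 else 0 := by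
  have := congrFun (congrFun (Matrix.nonsing_inv_mul _ hd) i) j
  rwa [Matrix.mul_apply, Matrix.one_apply] at this

theorem traceG_sff (hd : IsUnit (gramM v).det) (hpv : ∀ i, inner ℝ p (v i) = 0)
    (hps : ∀ i j, inner ℝ p (s i j) = -gramM v i j) (hK : inner ℝ p p = K⁻¹) (hK0 : K ≠ 0) :
    traceG v (sff p v s) = traceG v (normalPart v s) + (n * K) • p := by
  rw [← traceG_gramM hd]
  simp only [traceG, sff_eq_normalPart hd hpv hps hK hK0, smul_add, sum_add_distrib, sum_mul,
    sum_smul, smul_smul, smul_eq_mul]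
  congr 1
  exact sum_congr rfl fun i _ => sum_congr rfl fun j _ => by congr 1; ring

omit [FiniteDimensional ℝ V] in
theorem inner_normalPart_pos (hpv : ∀ i, inner ℝ p (v i) = 0)
    (hps : ∀ i j, inner ℝ p (s i j) = -gramM v i j) (i j : Fin n) :
    inner ℝ p (normalPart v s i j) = -gramM v i j := by
  rw [normalPart, inner_sub_right, inner_sum, hps]
  simp [inner_smul_right, hpv]

/-- Pythagoras: the radial part of the Euclidean mean curvature vector is -nK p, of squared length
n²K. -/
theorem normSq_traceG_sff (hd : IsUnit (gramM v).det) (hpv : ∀ i, inner ℝ p (v i) = 0)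
    (hps : ∀ i j, inner ℝ p (s i j) = -gramM v i j) (hK : inner ℝ p p = K⁻¹) (hK0 : K ≠ 0) :
    ‖traceG v (sff p v s)‖ ^ 2
      = inner ℝ (traceG v (normalPart v s)) (traceG v (normalPart v s)) - n ^ 2 * K := by
  have h1 : inner ℝ p (traceG v (normalPart v s)) = -n := by
    rw [← traceG_gramM hd]
    simp only [traceG, inner_sum, inner_smul_right, inner_normalPart_pos hpv hps, smul_eq_mul,
      mul_neg, sum_neg_distrib]
  rw [traceG_sff hd hpv hps hK hK0, ← real_inner_self_eq_norm_sq, inner_add_left, inner_add_right,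
    inner_add_right, inner_smul_left, inner_smul_right, inner_smul_left, inner_smul_right,
    real_inner_comm p (traceG v (normalPart v s)), h1, hK]
  simp only [RCLike.conj_to_real]
  field_simp
  ring

theorem normSqG_sff (hd : IsUnit (gramM v).det) (hpv : ∀ i, inner ℝ p (v i) = 0)
    (hps : ∀ i j, inner ℝ p (s i j) = -gramM v i j) (hK : inner ℝ p p = K⁻¹) (hK0 : K ≠ 0) :
    normSqG v (sff p v s) = normSqG v (normalPart v s) - n * K := by
  have e : ∀ i j a b, inner ℝ (sff p v s i j) (sff p v s a b)
      = inner ℝ (normalPart v s i j) (normalPart v s a b) - K * (gramM v i j * gramM v a b) := by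
    intro i j a b
    rw [sff_eq_normalPart hd hpv hps hK hK0, sff_eq_normalPart hd hpv hps hK hK0, inner_add_left,
      inner_add_right, inner_add_right, inner_smul_left, inner_smul_right, inner_smul_left,
      inner_smul_right, real_inner_comm p (normalPart v s i j),
      inner_normalPart_pos hpv hps, inner_normalPart_pos hpv hps, hK]
    simp only [RCLike.conj_to_real]
    field_simp
    ring
  have e2 : ∑ i, ∑ j, ∑ p, ∑ q, (gramM v)⁻¹ i p * (gramM v)⁻¹ j q * (gramM v i j * gramM v p q)
      = n := by
    have : ∀ i j p, ∑ q, (gramM v)⁻¹ i p * (gramM v)⁻¹ j q * (gramM v i j * gramM v p q)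
        = (gramM v)⁻¹ i p * gramM v i j * if j = p then 1 else 0 := fun i j p => by
      rw [← sum_gramM_inv_mul hd, mul_sum]
      refine sum_congr rfl fun q _ => ?_
      have : gramM v p q = gramM v q p := by simp [gramM, real_inner_comm]
      rw [this]; ring
    simp only [this, mul_ite, mul_one, mul_zero, sum_ite_eq, mem_univ, if_true]
    exact traceG_gramM hd
  simp only [normSqG, e, mul_sub, sum_sub_distrib]
  rw [← e2]
  simp only [sum_mul, mul_assoc, mul_left_comm _ K, mul_sum]
  congr 1
  exact sum_congr rfl fun i _ => sum_congr rfl fun j _ => sum_congr rfl fun p _ =>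
    sum_congr rfl fun q _ => by ring

end PointData

end SphereMCF

end

/-! ### The jet of a smooth family of immersions. -/

noncomputable section

namespace SphereMCF

set_option linter.unusedSimpArgs false

open Matrix Finset Filter Topology smoothGerm

section LocalJet

variable {n N : ℕ}

/-- The parameter space of a family of immersions: time and local coordinates. -/
abbrev Param (n : ℕ) : Type := ℝ × EuclideanSpace ℝ (Fin n)

/-- The spatial coordinate direction `i`. -/
def eDir (i : Fin n) : Param n := (0, EuclideanSpace.single i 1)

/-- The time direction. -/
def tDir : Param n := (1, 0)

/-- The coordinate vectors of a family of immersions. -/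
def coordVec {V : Type*} [NormedAddCommGroup V] [NormedSpace ℝ V] (f : Param n → V) (z : Param n)
    (i : Fin n) : V := fderiv ℝ f z (eDir i)

/-- The second coordinate derivatives of a family of immersions. -/
def coordVec₂ {V : Type*} [NormedAddCommGroup V] [NormedSpace ℝ V] (f : Param n → V) (z : Param n)
    (i j : Fin n) : V := fderiv ℝ (fun z => coordVec f z j) z (eDir i)

theorem inner_eq_dotProduct (u v : EuclideanSpace ℝ (Fin N)) :
    inner ℝ u v = ∑ α, u α * v α := by
  simp [PiLp.inner_apply, mul_comm]

section

variable {Z : Type*} [NormedAddCommGroup Z] [NormedSpace ℝ Z] {z₀ : Z}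

theorem contDiffAt_det {m : Type*} [Fintype m] [DecidableEq m] {M : Z → Matrix m m ℝ}
    (hM : ∀ i j, ContDiffAt ℝ ∞ (fun z => M z i j) z₀) :
    ContDiffAt ℝ ∞ (fun z => (M z).det) z₀ := by
  simp only [Matrix.det_apply']
  exact ContDiffAt.sum fun σ _ => contDiffAt_const.mul (contDiffAt_prod fun i _ => hM _ _)

theorem contDiffAt_matrix_inv {m : Type*} [Fintype m] [DecidableEq m] {M : Z → Matrix m m ℝ}
    (hM : ∀ i j, ContDiffAt ℝ ∞ (fun z => M z i j) z₀) (hd : (M z₀).det ≠ 0) (i j : m) :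
    ContDiffAt ℝ ∞ (fun z => (M z)⁻¹ i j) z₀ := by
  simp only [Matrix.inv_def, Matrix.smul_apply, Ring.inverse_eq_inv', smul_eq_mul]
  refine ((contDiffAt_det hM).inv hd).mul ?_
  simp only [Matrix.adjugate_apply]
  refine contDiffAt_det fun a b => ?_
  by_cases h : a = j
  · subst h; simp only [Matrix.updateRow_self]; exact contDiffAt_const
  · simp only [Matrix.updateRow_ne h]; exact hM _ _

variable {f : Z → EuclideanSpace ℝ (Fin N)}

theorem contDiffAt_apply_coord (hf : ContDiffAt ℝ ∞ f z₀) (α : Fin N) :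
    ContDiffAt ℝ ∞ (fun z => f z α) z₀ :=
  (EuclideanSpace.proj (𝕜 := ℝ) α).contDiff.contDiffAt.comp z₀ hf

theorem eventually_differentiableAt_of_smooth {V : Type*} [NormedAddCommGroup V] [NormedSpace ℝ V]
    {f : Z → V} (hf : ContDiffAt ℝ ∞ f z₀) : ∀ᶠ z in 𝓝 z₀, DifferentiableAt ℝ f z := by
  have h1 : ContDiffAt ℝ 1 f z₀ := hf.of_le ENat.LEInfty.out
  filter_upwards [h1.eventually (by simp)] with z hz
  exact hz.differentiableAt (by simp)

theorem eventually_fderiv_coord (hf : ContDiffAt ℝ ∞ f z₀) (α : Fin N) (v : Z) :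
    (fun z => fderiv ℝ (fun z => f z α) z v) =ᶠ[𝓝 z₀] fun z => fderiv ℝ f z v α := by
  filter_upwards [eventually_differentiableAt_of_smooth hf] with z hz
  have : HasFDerivAt (fun z => f z α) ((EuclideanSpace.proj (𝕜 := ℝ) α).comp (fderiv ℝ f z)) z :=
    (EuclideanSpace.proj (𝕜 := ℝ) α).hasFDerivAt.comp z hz.hasFDerivAt
  rw [this.fderiv]; rfl

theorem contDiffAt_fderiv_apply' {V : Type*} [NormedAddCommGroup V] [NormedSpace ℝ V] {f : Z → V}
    (hf : ContDiffAt ℝ ∞ f z₀) (v : Z) : ContDiffAt ℝ ∞ (fun z => fderiv ℝ f z v) z₀ :=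
  (hf.fderiv_right (m := ∞) (by simp)).clm_apply contDiffAt_const

end

variable {z₀ : Param n} {f : Param n → EuclideanSpace ℝ (Fin N)}

theorem contDiffAt_gramM_coordVec (hf : ContDiffAt ℝ ∞ f z₀) (i j : Fin n) :
    ContDiffAt ℝ ∞ (fun z => gramM (coordVec f z) i j) z₀ :=
  (contDiffAt_fderiv_apply' hf (eDir i)).inner ℝ (contDiffAt_fderiv_apply' hf (eDir j))

theorem eventually_isUnit_det (hf : ContDiffAt ℝ ∞ f z₀) (hd : IsUnit (gramM (coordVec f z₀)).det) :
    ∀ᶠ z in 𝓝 z₀, IsUnit (gramM (coordVec f z)).det := by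
  have := (contDiffAt_det (contDiffAt_gramM_coordVec hf)).continuousAt.eventually_ne hd.ne_zero
  filter_upwards [this] with z hz
  exact isUnit_iff_ne_zero.2 hz

theorem rep_coordVec (hf : ContDiffAt ℝ ∞ f z₀) (i : Fin n) (α : Fin N) :
    Rep (smoothGerm.d (eDir i) (mk (fun z => f z α) (contDiffAt_apply_coord hf α)))
      (fun z => coordVec f z i α) :=
  ((rep_mk _ _).d _).congr (eventually_fderiv_coord hf α _)

/-- The jet of a family of immersions at a point. -/
def localJet (f : Param n → EuclideanSpace ℝ (Fin N)) (z₀ : Param n) (hf : ContDiffAt ℝ ∞ f z₀)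
    (hd : IsUnit (gramM (coordVec f z₀)).det) : ImmersionJet n N (smoothGerm z₀) where
  ev := smoothGerm.ev z₀
  D i := smoothGerm.d (eDir i)
  D0 := smoothGerm.d tDir
  D_comm _ _ := d_comm _ _
  D0_comm _ := d_comm _ _
  f α := mk (fun z => f z α) (contDiffAt_apply_coord hf α)
  G i j := mk (fun z => (gramM (coordVec f z))⁻¹ i j)
    (contDiffAt_matrix_inv (contDiffAt_gramM_coordVec hf) hd.ne_zero i j)
  G_mul i k := by
    have h1 : Rep (∑ j, (∑ α, smoothGerm.d (eDir i) (mk (fun z => f z α) (contDiffAt_apply_coord hf α))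
        * smoothGerm.d (eDir j) (mk (fun z => f z α) (contDiffAt_apply_coord hf α)))
        * mk (fun z => (gramM (coordVec f z))⁻¹ j k)
          (contDiffAt_matrix_inv (contDiffAt_gramM_coordVec hf) hd.ne_zero j k))
        (fun z => ∑ j, (∑ α, coordVec f z i α * coordVec f z j α)
          * (gramM (coordVec f z))⁻¹ j k) :=
      Rep.sum fun j => (Rep.sum fun α => (rep_coordVec hf i α).mul (rep_coordVec hf j α)).mul
        (rep_mk _ _)
    have h2 : Rep (z₀ := z₀) (if i = k then 1 else 0) (fun _ => if i = k then 1 else 0) := by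
      split_ifs <;> rfl
    refine h1.eq h2 ?_
    filter_upwards [eventually_isUnit_det hf hd] with z hz
    have := congrFun (congrFun (Matrix.mul_nonsing_inv _ hz) i) k
    rw [Matrix.mul_apply, Matrix.one_apply] at this
    rw [← this]
    exact sum_congr rfl fun j _ => by rw [← inner_eq_dotProduct]; rfl

variable {hf : ContDiffAt ℝ ∞ f z₀} {hd : IsUnit (gramM (coordVec f z₀)).det}

theorem rep_localJet_f1 (i : Fin n) (α : Fin N) :
    Rep ((localJet f z₀ hf hd).f1 i α) fun z => coordVec f z i α := rep_coordVec hf i α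

theorem rep_localJet_d_f1 (i : Fin n) (v : Param n) (α : Fin N) :
    Rep (smoothGerm.d v ((localJet f z₀ hf hd).f1 i α))
      fun z => fderiv ℝ (fun z => coordVec f z i) z v α :=
  ((rep_localJet_f1 i α).d v).congr
    (eventually_fderiv_coord (contDiffAt_fderiv_apply' hf (eDir i)) α v)

theorem rep_localJet_f2 (i j : Fin n) (α : Fin N) :
    Rep ((localJet f z₀ hf hd).f2 i j α) fun z => coordVec₂ f z i j α :=
  rep_localJet_d_f1 j (eDir i) α

theorem Rep.dotProduct {u v : Fin N → smoothGerm z₀} {u' v' : Param n → EuclideanSpace ℝ (Fin N)}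
    (hu : ∀ α, Rep (u α) fun z => u' z α) (hv : ∀ α, Rep (v α) fun z => v' z α) :
    Rep (u ⬝ᵥ v) fun z => inner ℝ (u' z) (v' z) := by
  simp only [inner_eq_dotProduct]
  exact Rep.sum fun α => (hu α).mul (hv α)

theorem rep_localJet_G (i j : Fin n) :
    Rep ((localJet f z₀ hf hd).G i j) fun z => (gramM (coordVec f z))⁻¹ i j := rfl

theorem rep_localJet_g (i j : Fin n) :
    Rep ((localJet f z₀ hf hd).g i j) fun z => gramM (coordVec f z) i j :=
  Rep.dotProduct (rep_localJet_f1 i) (rep_localJet_f1 j)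

theorem rep_localJet_nn (i j : Fin n) (α : Fin N) :
    Rep ((localJet f z₀ hf hd).nn i j α)
      fun z => normalPart (coordVec f z) (coordVec₂ f z) i j α := by
  have h : Rep ((localJet f z₀ hf hd).nn i j α) (fun z => coordVec₂ f z i j α
      - ∑ k, (∑ l, (gramM (coordVec f z))⁻¹ k l * inner ℝ (coordVec₂ f z i j) (coordVec f z l))
        * coordVec f z k α) := by
    rw [ImmersionJet.nn, Pi.sub_apply, Finset.sum_apply]
    exact (rep_localJet_f2 i j α).sub (Rep.sum fun k => (Rep.sum fun l => (rep_localJet_G k l).mul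
      (Rep.dotProduct (rep_localJet_f2 i j) (rep_localJet_f1 l))).mul (rep_localJet_f1 k α))
  convert h using 2 with z
  simp [normalPart]

theorem rep_localJet_Hv (α : Fin N) :
    Rep ((localJet f z₀ hf hd).Hv α)
      fun z => traceG (coordVec f z) (normalPart (coordVec f z) (coordVec₂ f z)) α := by
  have h : Rep ((localJet f z₀ hf hd).Hv α) (fun z => ∑ i, ∑ j, (gramM (coordVec f z))⁻¹ i j
      * normalPart (coordVec f z) (coordVec₂ f z) i j α) := by
    rw [ImmersionJet.Hv, Finset.sum_apply]
    simp only [Finset.sum_apply]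
    exact Rep.sum fun i => Rep.sum fun j => (rep_localJet_G i j).mul (rep_localJet_nn i j α)
  convert h using 2 with z
  simp [traceG]

theorem rep_localJet_S : Rep (localJet f z₀ hf hd).S
    fun z => normSqG (coordVec f z) (normalPart (coordVec f z) (coordVec₂ f z)) :=
  Rep.sum fun i => Rep.sum fun j => Rep.sum fun p => Rep.sum fun q =>
    ((rep_localJet_G i p).mul (rep_localJet_G j q)).mul
      (Rep.dotProduct (rep_localJet_nn i j) (rep_localJet_nn p q))

theorem rep_localJet_B : Rep (localJet f z₀ hf hd).B
    fun z => inner ℝ (traceG (coordVec f z) (normalPart (coordVec f z) (coordVec₂ f z)))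
      (traceG (coordVec f z) (normalPart (coordVec f z) (coordVec₂ f z))) :=
  Rep.dotProduct rep_localJet_Hv rep_localJet_Hv

end LocalJet

end SphereMCF

end

/-! ### Chain rule, time slices, and independence of the parametrization. -/

noncomputable section

namespace SphereMCF

set_option linter.unusedSimpArgs false

open Matrix Finset Filter Topology smoothGerm

section ChainRule

variable {n : ℕ} {V : Type*} [NormedAddCommGroup V] [NormedSpace ℝ V]

theorem euclidean_eq_sum (u : EuclideanSpace ℝ (Fin n)) :
    u = ∑ a, u a • EuclideanSpace.single a (1 : ℝ) := by
  ext i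
  simp [Finset.sum_apply, Pi.single_apply]

theorem clm_apply_eq_sum (T : EuclideanSpace ℝ (Fin n) →L[ℝ] V) (u : EuclideanSpace ℝ (Fin n)) :
    T u = ∑ a, u a • T (EuclideanSpace.single a 1) := by
  conv_lhs => rw [euclidean_eq_sum u]
  simp

variable {ψ : EuclideanSpace ℝ (Fin n) → V}
  {τ : EuclideanSpace ℝ (Fin n) → EuclideanSpace ℝ (Fin n)} {y : EuclideanSpace ℝ (Fin n)}

theorem fderiv_comp_coord (hψ : ContDiffAt ℝ 2 ψ (τ y)) (hτ : ContDiffAt ℝ 2 τ y) (i : Fin n) :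
    fderiv ℝ (fun y => ψ (τ y)) y (EuclideanSpace.single i 1)
      = ∑ a, (fderiv ℝ τ y (EuclideanSpace.single i 1)) a
        • fderiv ℝ ψ (τ y) (EuclideanSpace.single a 1) := by
  rw [← clm_apply_eq_sum]
  have := (hψ.differentiableAt (by simp)).hasFDerivAt.comp y
    (hτ.differentiableAt (by simp)).hasFDerivAt
  exact congrArg (fun T => T (EuclideanSpace.single i 1)) this.fderiv

theorem eventually_fderiv_comp_coord (hψ : ContDiffAt ℝ 2 ψ (τ y)) (hτ : ContDiffAt ℝ 2 τ y)
    (i : Fin n) : (fun y' => fderiv ℝ (fun y => ψ (τ y)) y' (EuclideanSpace.single i 1)) =ᶠ[𝓝 y]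
      fun y' => ∑ a, (fderiv ℝ τ y' (EuclideanSpace.single i 1)) a
        • fderiv ℝ ψ (τ y') (EuclideanSpace.single a 1) := by
  filter_upwards [hτ.eventually (by simp), hτ.continuousAt.eventually (hψ.eventually (by simp))]
    with y' h1 h2
  exact fderiv_comp_coord h2 h1 i

/-- The second coordinate derivatives of a reparametrized map. -/
theorem fderiv_fderiv_comp_coord (hψ : ContDiffAt ℝ 2 ψ (τ y)) (hτ : ContDiffAt ℝ 2 τ y) :
    ∃ Q : Fin n → Fin n → Fin n → ℝ, ∀ i j,
    fderiv ℝ (fun y' => fderiv ℝ (fun y => ψ (τ y)) y' (EuclideanSpace.single j 1)) y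
        (EuclideanSpace.single i 1)
      = ∑ a, ∑ b, ((fderiv ℝ τ y (EuclideanSpace.single i 1)) a
          * (fderiv ℝ τ y (EuclideanSpace.single j 1)) b)
          • fderiv ℝ (fun x => fderiv ℝ ψ x (EuclideanSpace.single b 1)) (τ y)
            (EuclideanSpace.single a 1)
        + ∑ a, Q i j a • fderiv ℝ ψ (τ y) (EuclideanSpace.single a 1) := by
  -- Q consists of the second derivatives of τ. Its value is irrelevant later, only that it
  -- multiplies first derivatives of ψ.
  refine ⟨fun i j a => fderiv ℝ (fun y' => fderiv ℝ τ y' (EuclideanSpace.single j 1) a) y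
    (EuclideanSpace.single i 1), fun i j => ?_⟩
  have hτ1 := hτ.differentiableAt (by simp)
  have hdτ : ∀ a, DifferentiableAt ℝ (fun y' => fderiv ℝ τ y' (EuclideanSpace.single j 1) a) y := by
    intro a
    have h1 : DifferentiableAt ℝ (fun y' => fderiv ℝ τ y' (EuclideanSpace.single j 1)) y :=
      ((hτ.fderiv_right (m := 1) (by norm_num)).clm_apply contDiffAt_const).differentiableAt (by simp)
    exact (EuclideanSpace.proj (𝕜 := ℝ) a).differentiableAt.comp y h1
  have hdψ : ∀ b, DifferentiableAt ℝ (fun x => fderiv ℝ ψ x (EuclideanSpace.single b 1)) (τ y) :=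
    fun b => ((hψ.fderiv_right (m := 1) (by norm_num)).clm_apply
      contDiffAt_const).differentiableAt (by simp)
  have hcomp : ∀ b, HasFDerivAt (fun y' => fderiv ℝ ψ (τ y') (EuclideanSpace.single b 1))
      ((fderiv ℝ (fun x => fderiv ℝ ψ x (EuclideanSpace.single b 1)) (τ y)).comp (fderiv ℝ τ y)) y :=
    fun b => (hdψ b).hasFDerivAt.comp y hτ1.hasFDerivAt
  rw [(eventually_fderiv_comp_coord hψ hτ j).fderiv_eq]
  have hsum := HasFDerivAt.fun_sum (u := univ) fun b _ => (hdτ b).hasFDerivAt.fun_smul (hcomp b)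
  rw [hsum.fderiv]
  simp only [_root_.sum_apply, _root_.add_apply,
    _root_.smul_apply, ContinuousLinearMap.smulRight_apply,
    ContinuousLinearMap.comp_apply, sum_add_distrib]
  congr 1
  rw [sum_comm]
  refine sum_congr rfl fun b _ => ?_
  rw [clm_apply_eq_sum _ (fderiv ℝ τ y _), smul_sum]
  exact sum_congr rfl fun a _ => by rw [smul_smul, mul_comm]

end ChainRule

section Slices

variable {n : ℕ} {V : Type*} [NormedAddCommGroup V] [NormedSpace ℝ V] {f : Param n → V}
  {t : ℝ} {y : EuclideanSpace ℝ (Fin n)}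

theorem coordVec_eq_slice (hf : DifferentiableAt ℝ f (t, y)) (i : Fin n) :
    coordVec f (t, y) i = fderiv ℝ (fun y => f (t, y)) y (EuclideanSpace.single i 1) := by
  have h1 : HasFDerivAt (fun y : EuclideanSpace ℝ (Fin n) => (t, y))
      (ContinuousLinearMap.inr ℝ ℝ (EuclideanSpace ℝ (Fin n))) y := hasFDerivAt_prodMk_right t y
  have := hf.hasFDerivAt.comp y h1
  change _ = fderiv ℝ (f ∘ fun y => (t, y)) y _
  rw [this.fderiv]; rfl

theorem coordVec₂_eq_slice (hf : ContDiffAt ℝ 2 f (t, y)) (i j : Fin n) :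
    coordVec₂ f (t, y) i j = fderiv ℝ (fun y' => fderiv ℝ (fun y => f (t, y)) y'
      (EuclideanSpace.single j 1)) y (EuclideanSpace.single i 1) := by
  have hd : DifferentiableAt ℝ (fun z => coordVec f z j) (t, y) :=
    ((hf.fderiv_right (m := 1) (by norm_num)).clm_apply contDiffAt_const).differentiableAt (by simp)
  have h1 := coordVec_eq_slice hd i
  change coordVec₂ f (t, y) i j = _ at h1
  rw [h1]
  have hc : ContinuousAt (fun y : EuclideanSpace ℝ (Fin n) => (t, y)) y := by fun_prop
  have : (fun y' => coordVec f (t, y') j) =ᶠ[𝓝 y]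
      fun y' => fderiv ℝ (fun y => f (t, y)) y' (EuclideanSpace.single j 1) := by
    filter_upwards [hc.eventually (hf.eventually (by simp))] with y' hy'
    exact coordVec_eq_slice (hy'.differentiableAt (by simp)) j
  rw [this.fderiv_eq]

end Slices

section Manifold

variable {n k : ℕ} {M : Type*} [TopologicalSpace M] [ChartedSpace (EuclideanSpace ℝ (Fin n)) M]
  [IsManifold (𝓡 n) ∞ M] {R : ℝ} {F : ℝ → M → Ambient n k}

omit [IsManifold (𝓡 n) ∞ M] in
theorem IsAncientSolution.contDiffAt_comp (hF : IsAncientSolution R F) {m : ℕ∞ω} (hm : m ≤ ∞)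
    {χ : EuclideanSpace ℝ (Fin n) → M} {t : ℝ} (ht : t < 0) {y : EuclideanSpace ℝ (Fin n)}
    (hχ : ContMDiffAt 𝓘(ℝ, EuclideanSpace ℝ (Fin n)) (𝓡 n) m χ y) :
    ContDiffAt ℝ m (fun z : Param n => F z.1 (χ z.2)) (t, y) := by
  rw [← contMDiffAt_iff_contDiffAt]
  have h1 : ContMDiffAt (𝓘(ℝ, ℝ).prod (𝓡 n)) 𝓘(ℝ, Ambient n k) ∞
      (fun z : ℝ × M => F z.1 z.2) (t, χ y) := by
    refine hF.smooth.contMDiffAt ?_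
    exact prod_mem_nhds (Iio_mem_nhds ht) univ_mem
  have h2 : ContMDiffAt 𝓘(ℝ, Param n) (𝓘(ℝ, ℝ).prod (𝓡 n)) m
      (fun z : Param n => (z.1, χ z.2)) (t, y) := by
    refine ContMDiffAt.prodMk ?_ ?_
    · exact contDiff_fst.contDiffAt.contMDiffAt
    · exact ContMDiffAt.comp (t, y) hχ contDiff_snd.contDiffAt.contMDiffAt
  exact ContMDiffAt.comp (t, y) (h1.of_le hm) h2

theorem contMDiffAt_extChartAt_symm_comp {m : ℕ∞ω} (hm : m ≤ ∞) (x₀ : M)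
    {τ : EuclideanSpace ℝ (Fin n) → EuclideanSpace ℝ (Fin n)} {y : EuclideanSpace ℝ (Fin n)}
    (hτ : ContDiffAt ℝ m τ y) (hy : τ y ∈ (extChartAt (𝓡 n) x₀).target) :
    ContMDiffAt 𝓘(ℝ, EuclideanSpace ℝ (Fin n)) (𝓡 n) m
      (fun y => (extChartAt (𝓡 n) x₀).symm (τ y)) y := by
  have h1 : ContMDiffAt 𝓘(ℝ, EuclideanSpace ℝ (Fin n)) (𝓡 n) ∞ (extChartAt (𝓡 n) x₀).symm (τ y) :=
    (contMDiffOn_extChartAt_symm (n := ∞) x₀).contMDiffAt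
      ((isOpen_extChartAt_target x₀).mem_nhds hy)
  exact ContMDiffAt.comp y (h1.of_le hm) hτ.contMDiffAt

theorem IsAncientSolution.contDiffAt_inChart (hF : IsAncientSolution R F) {t : ℝ} (ht : t < 0)
    (x : M) : ContDiffAt ℝ ∞ (inChart (F t) x) (extChartAt (𝓡 n) x x) := by
  have h1 := contMDiffAt_extChartAt_symm_comp (m := ∞) le_rfl x contDiffAt_id
    (mem_extChartAt_target (I := 𝓡 n) x)
  have h2 := hF.contDiffAt_comp le_rfl ht h1
  exact h2.comp (extChartAt (𝓡 n) x x) (contDiffAt_const.prodMk contDiffAt_id)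

/-- The coordinate vectors of a parametrization in terms of those of the preferred chart. -/
theorem IsAncientSolution.exists_coordVec_eq (hF : IsAncientSolution R F)
    {χ : EuclideanSpace ℝ (Fin n) → M} {t : ℝ} (ht : t < 0) {y : EuclideanSpace ℝ (Fin n)}
    (hχ : ContMDiffAt 𝓘(ℝ, EuclideanSpace ℝ (Fin n)) (𝓡 n) 2 χ y) :
    ∃ (J : Matrix (Fin n) (Fin n) ℝ) (Q : Fin n → Fin n → Fin n → ℝ),
      (∀ i, coordVec (fun z : Param n => F z.1 (χ z.2)) (t, y) i
        = ∑ a, J a i • tangentVec (F t) (χ y) a) ∧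
      ∀ i j, coordVec₂ (fun z : Param n => F z.1 (χ z.2)) (t, y) i j
        = ∑ a, ∑ b, (J a i * J b j) • secondDeriv (F t) (χ y) a b
          + ∑ a, Q i j a • tangentVec (F t) (χ y) a := by
  set f : Param n → Ambient n k := fun z => F z.1 (χ z.2) with hfdef
  have hf : ContDiffAt ℝ 2 f (t, y) := hF.contDiffAt_comp ENat.LEInfty.out ht hχ
  set x := χ y with hx
  set τ : EuclideanSpace ℝ (Fin n) → EuclideanSpace ℝ (Fin n) :=
    fun y' => extChartAt (𝓡 n) x (χ y') with hτdef
  have hτ : ContDiffAt ℝ 2 τ y := by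
    rw [← contMDiffAt_iff_contDiffAt]
    have h1 : ContMDiffAt (𝓡 n) 𝓘(ℝ, EuclideanSpace ℝ (Fin n)) ∞ (extChartAt (𝓡 n) x) (χ y) :=
      contMDiffAt_extChartAt' (by rw [← hx]; exact mem_chart_source _ _)
    exact ContMDiffAt.comp y (h1.of_le ENat.LEInfty.out) hχ
  have hψ : ContDiffAt ℝ 2 (inChart (F t) x) (τ y) :=
    (hF.contDiffAt_inChart ht x).of_le ENat.LEInfty.out
  have hfe : (fun y' => f (t, y')) =ᶠ[𝓝 y] fun y' => inChart (F t) x (τ y') := by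
    have : ∀ᶠ y' in 𝓝 y, χ y' ∈ (extChartAt (𝓡 n) x).source :=
      hχ.continuousAt.eventually (extChartAt_source_mem_nhds (I := 𝓡 n) x)
    filter_upwards [this] with y' hy'
    simp only [f, inChart, hτdef, (extChartAt (𝓡 n) x).left_inv hy']
  have hv : ∀ i, coordVec f (t, y) i = ∑ a, (fderiv ℝ τ y (EuclideanSpace.single i 1)) a
      • tangentVec (F t) x a := fun i => by
    rw [coordVec_eq_slice (hf.differentiableAt (by simp)), hfe.fderiv_eq,
      fderiv_comp_coord hψ hτ]
    rfl
  obtain ⟨Q, hQ⟩ := fderiv_fderiv_comp_coord hψ hτ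
  have hs : ∀ i j, coordVec₂ f (t, y) i j
      = ∑ a, ∑ b, ((fderiv ℝ τ y (EuclideanSpace.single i 1)) a
          * (fderiv ℝ τ y (EuclideanSpace.single j 1)) b) • secondDeriv (F t) x a b
        + ∑ a, Q i j a • tangentVec (F t) x a := fun i j => by
    rw [coordVec₂_eq_slice hf]
    have : (fun y' => fderiv ℝ (fun y => f (t, y)) y' (EuclideanSpace.single j 1)) =ᶠ[𝓝 y]
        fun y' => fderiv ℝ (fun y' => inChart (F t) x (τ y')) y' (EuclideanSpace.single j 1) := by
      filter_upwards [hfe.fderiv (𝕜 := ℝ)] with y' hy'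
      rw [hy']
    rw [this.fderiv_eq, hQ]
    rfl
  exact ⟨Matrix.of fun a i => (fderiv ℝ τ y (EuclideanSpace.single i 1)) a, Q, hv, hs⟩

/-- The curvature quantities may be computed in any parametrization. -/
theorem IsAncientSolution.curvature_eq (hF : IsAncientSolution R F)
    {χ : EuclideanSpace ℝ (Fin n) → M} {t : ℝ} (ht : t < 0) {y : EuclideanSpace ℝ (Fin n)}
    (hχ : ContMDiffAt 𝓘(ℝ, EuclideanSpace ℝ (Fin n)) (𝓡 n) 2 χ y)
    (hd : IsUnit (gramM (coordVec (fun z : Param n => F z.1 (χ z.2)) (t, y))).det) :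
    let f := fun z : Param n => F z.1 (χ z.2)
    meanCurv (F t) (χ y) = traceG (coordVec f (t, y))
        (sff (f (t, y)) (coordVec f (t, y)) (coordVec₂ f (t, y))) ∧
      secondFundFormNormSq (F t) (χ y) = normSqG (coordVec f (t, y))
        (sff (f (t, y)) (coordVec f (t, y)) (coordVec₂ f (t, y))) := by
  intro f
  obtain ⟨J, Q, hv, hs⟩ := hF.exists_coordVec_eq ht hχ
  have hh := sff_congruence (p := F t (χ y)) hv hd hs
  exact ⟨(traceG_congruence hv hd hh).symm, (normSqG_congruence hv hd hh).symm⟩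

end Manifold

end SphereMCF

end

/-! ### Existence of graph charts. -/

noncomputable section

namespace SphereMCF

set_option linter.unusedSimpArgs false

open Matrix Finset Filter Topology smoothGerm

section GraphChart

variable {n k : ℕ} {M : Type*} [TopologicalSpace M] [ChartedSpace (EuclideanSpace ℝ (Fin n)) M]

/-- A local parametrization of `M` around `x₀` in which `F t₀` is the graph of a map over its
tangent space at `x₀`. -/
structure GraphChart (F : ℝ → M → Ambient n k) (t₀ : ℝ) (x₀ : M) where
  χ : EuclideanSpace ℝ (Fin n) → M
  η : M → EuclideanSpace ℝ (Fin n)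
  e : Fin n → Ambient n k
  χ_zero : χ 0 = x₀
  η_base : η x₀ = 0
  smooth_η : ContMDiffAt (𝓡 n) 𝓘(ℝ, EuclideanSpace ℝ (Fin n)) ∞ η x₀
  smooth_χ : ContMDiffAt 𝓘(ℝ, EuclideanSpace ℝ (Fin n)) (𝓡 n) ∞ χ 0
  χ_η : ∀ᶠ x in 𝓝 x₀, χ (η x) = x
  orthonormal_e : Orthonormal ℝ e
  graph : ∀ᶠ y in 𝓝 0, ∀ i, inner ℝ (e i) (F t₀ (χ y) - F t₀ x₀) = y i
  coordVec_base : ∀ i, coordVec (fun z : Param n => F z.1 (χ z.2)) (t₀, 0) i = e i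

variable [IsManifold (𝓡 n) ∞ M] {R : ℝ} {F : ℝ → M → Ambient n k}

omit [IsManifold (𝓡 n) ∞ M] in
theorem IsAncientSolution.contMDiff_slice (hF : IsAncientSolution R F) {t : ℝ} (ht : t < 0) :
    ContMDiff (𝓡 n) 𝓘(ℝ, Ambient n k) ∞ (F t) := by
  intro x
  have h1 : ContMDiffAt (𝓘(ℝ, ℝ).prod (𝓡 n)) 𝓘(ℝ, Ambient n k) ∞
      (fun z : ℝ × M => F z.1 z.2) (t, x) :=
    hF.smooth.contMDiffAt (prod_mem_nhds (Iio_mem_nhds ht) univ_mem)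
  have h2 : ContMDiffAt (𝓡 n) (𝓘(ℝ, ℝ).prod (𝓡 n)) ∞ (fun y : M => (t, y)) x :=
    contMDiffAt_const.prodMk contMDiffAt_id
  exact ContMDiffAt.comp (g := fun z : ℝ × M => F z.1 z.2) x h1 h2

omit [IsManifold (𝓡 n) ∞ M] in
theorem IsAncientSolution.fderiv_inChart_injective (hF : IsAncientSolution R F) {t : ℝ}
    (ht : t < 0) (x : M) :
    Function.Injective (fderiv ℝ (inChart (F t) x) (extChartAt (𝓡 n) x x)) := by
  have h := hF.immersion t ht x
  have hd : MDifferentiableAt (𝓡 n) 𝓘(ℝ, Ambient n k) (F t) x :=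
    (hF.contMDiff_slice ht).mdifferentiable (by simp) x
  rw [hd.mfderiv] at h
  have h1 : writtenInExtChartAt (𝓡 n) 𝓘(ℝ, Ambient n k) x (F t) = inChart (F t) x := by
    funext y; rfl
  rw [h1, ModelWithCorners.range_eq_univ, fderivWithin_univ] at h
  exact h

/-- The immersion is projected orthogonally to its tangent plane at x₀. Injectivity of the
differential makes this an isomorphism to first order, and the local inverse supplies the
coordinates. -/
theorem IsAncientSolution.exists_graphChart (hF : IsAncientSolution R F) {t₀ : ℝ} (ht₀ : t₀ < 0)
    (x₀ : M) : Nonempty (GraphChart F t₀ x₀) := by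
  set φ := inChart (F t₀) x₀ with hφdef
  set p₀ := extChartAt (𝓡 n) x₀ x₀ with hp₀
  have hφ : ContDiffAt ℝ ∞ φ p₀ := hF.contDiffAt_inChart ht₀ x₀
  set A := fderiv ℝ φ p₀ with hA
  have hAi : Function.Injective A := hF.fderiv_inChart_injective ht₀ x₀
  set T : Submodule ℝ (Ambient n k) := LinearMap.range (A : EuclideanSpace ℝ (Fin n) →ₗ[ℝ] Ambient n k)
    with hT
  have hfin : Module.finrank ℝ T = n := by
    rw [hT, LinearMap.finrank_range_of_inj hAi]; simp
  let b : OrthonormalBasis (Fin n) ℝ T := (stdOrthonormalBasis ℝ T).reindex (finCongr hfin)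
  -- The orthogonal projection to the tangent plane T, expressed in the orthonormal basis b.
  let L : Ambient n k →L[ℝ] EuclideanSpace ℝ (Fin n) :=
    (b.repr.toContinuousLinearEquiv : T →L[ℝ] EuclideanSpace ℝ (Fin n)).comp T.orthogonalProjectionOnto
  have hL : ∀ w i, L w i = inner ℝ (b i : Ambient n k) w := fun w i => by
    change b.repr (T.orthogonalProjectionOnto w) i = _
    rw [b.repr_apply_apply, Submodule.coe_inner, ← Submodule.starProjection_apply,
      ← Submodule.inner_starProjection_left_eq_right,
      Submodule.starProjection_eq_self_iff.2 (b i).2]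
  have hLT : ∀ u (hu : u ∈ T), L u = b.repr ⟨u, hu⟩ := fun u hu => by
    change b.repr (T.orthogonalProjectionOnto u) = _
    congr 1
    exact Submodule.orthogonalProjectionOnto_mem_subspace_eq_self (⟨u, hu⟩ : T)
  have hAT : ∀ u, A u ∈ T := fun u => ⟨u, rfl⟩
  have hLAi : Function.Injective (L.comp A) := fun u v huv => by
    change L (A u) = L (A v) at huv
    rw [hLT _ (hAT u), hLT _ (hAT v)] at huv
    exact hAi (congrArg Subtype.val (b.repr.injective huv))
  let Aeq : EuclideanSpace ℝ (Fin n) ≃L[ℝ] EuclideanSpace ℝ (Fin n) :=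
    (LinearEquiv.ofInjectiveEndo
      (L.comp A : EuclideanSpace ℝ (Fin n) →ₗ[ℝ] EuclideanSpace ℝ (Fin n)) hLAi).toContinuousLinearEquiv
  have hAeq : (Aeq : EuclideanSpace ℝ (Fin n) →L[ℝ] EuclideanSpace ℝ (Fin n)) = L.comp A := by
    ext u; rfl
  set κ : EuclideanSpace ℝ (Fin n) → EuclideanSpace ℝ (Fin n) := fun y => L (φ y - φ p₀) with hκdef
  have hκ : ContDiffAt ℝ ∞ κ p₀ :=
    L.contDiff.contDiffAt.comp p₀ (hφ.sub contDiffAt_const)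
  have hκ' : HasFDerivAt κ (Aeq : EuclideanSpace ℝ (Fin n) →L[ℝ] EuclideanSpace ℝ (Fin n)) p₀ := by
    rw [hAeq]
    exact L.hasFDerivAt.comp p₀ ((hφ.differentiableAt (by simp)).hasFDerivAt.sub_const _)
  have hκs := hκ.hasStrictFDerivAt' hκ' (by simp)
  have hκ0 : κ p₀ = 0 := by simp [hκdef]
  set τ := hκs.localInverse κ Aeq p₀ with hτdef
  have hτ : ContDiffAt ℝ ∞ τ 0 := by
    have := hκ.to_localInverse hκ' (by simp)
    rw [hκ0] at this
    exact this
  have hτ0 : τ 0 = p₀ := by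
    rw [← hκ0]; exact hκs.localInverse_apply_image
  have hright : ∀ᶠ y in 𝓝 0, κ (τ y) = y := by
    rw [← hκ0]; exact hκs.eventually_right_inverse
  have hleft : ∀ᶠ y in 𝓝 p₀, τ (κ y) = y := hκs.eventually_left_inverse
  have hτ' : HasFDerivAt τ (Aeq.symm : EuclideanSpace ℝ (Fin n) →L[ℝ] EuclideanSpace ℝ (Fin n)) 0 := by
    have := hκs.to_localInverse.hasFDerivAt
    rw [hκ0] at this
    exact this
  have htar : τ 0 ∈ (extChartAt (𝓡 n) x₀).target := by
    rw [hτ0]; exact mem_extChartAt_target x₀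
  have hsm : ContMDiffAt 𝓘(ℝ, EuclideanSpace ℝ (Fin n)) (𝓡 n) ∞
      (fun y => (extChartAt (𝓡 n) x₀).symm (τ y)) 0 :=
    contMDiffAt_extChartAt_symm_comp le_rfl x₀ hτ htar
  have hφp : φ p₀ = F t₀ x₀ := by
    simp only [hφdef, inChart, hp₀, extChartAt_to_inv]
  refine ⟨{ χ := fun y => (extChartAt (𝓡 n) x₀).symm (τ y)
            η := fun x => κ (extChartAt (𝓡 n) x₀ x)
            e := fun i => b i
            χ_zero := ?_, η_base := hκ0, smooth_η := ?_, smooth_χ := hsm, χ_η := ?_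
            orthonormal_e := ?_, graph := ?_, coordVec_base := ?_ }⟩
  · rw [hτ0, hp₀, extChartAt_to_inv]
  · have hκm : ContMDiffAt 𝓘(ℝ, EuclideanSpace ℝ (Fin n)) 𝓘(ℝ, EuclideanSpace ℝ (Fin n)) ∞ κ
        (extChartAt (𝓡 n) x₀ x₀) := hκ.contMDiffAt
    have h1 : ContMDiffAt (𝓡 n) 𝓘(ℝ, EuclideanSpace ℝ (Fin n)) ∞ (extChartAt (𝓡 n) x₀) x₀ :=
      contMDiffAt_extChartAt
    exact ContMDiffAt.comp (g := κ) x₀ hκm h1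
  · filter_upwards [extChartAt_source_mem_nhds (I := 𝓡 n) x₀,
      (continuousAt_extChartAt (I := 𝓡 n) x₀).eventually hleft] with x h1 h2
    rw [h2, (extChartAt (𝓡 n) x₀).left_inv h1]
  · exact b.orthonormal.comp_linearIsometry T.subtypeₗᵢ
  · filter_upwards [hright] with y hy i
    rw [← hL, ← hφp]
    exact congrArg (fun w => w i) hy
  · intro i
    have hf := hF.contDiffAt_comp le_rfl ht₀ hsm
    rw [coordVec_eq_slice (hf.differentiableAt (by simp))]
    have h1 : HasFDerivAt (fun y => φ (τ y))
        (A.comp (Aeq.symm : EuclideanSpace ℝ (Fin n) →L[ℝ] EuclideanSpace ℝ (Fin n))) 0 := by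
      have h2 : HasFDerivAt φ A (τ 0) := by
        rw [hτ0]; exact (hφ.differentiableAt (by simp)).hasFDerivAt
      exact h2.comp 0 hτ'
    change fderiv ℝ (fun y => φ (τ y)) 0 _ = _
    rw [h1.fderiv]
    set w := A (Aeq.symm (EuclideanSpace.single i 1)) with hw
    have h3 : L w = EuclideanSpace.single i 1 := by
      have : (Aeq : EuclideanSpace ℝ (Fin n) →L[ℝ] EuclideanSpace ℝ (Fin n))
        (Aeq.symm (EuclideanSpace.single i 1)) = EuclideanSpace.single i 1 := by simp
      rw [hAeq] at this
      exact this
    rw [hLT w (hAT _)] at h3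
    have h4 : (⟨w, hAT _⟩ : T) = b i := by
      apply b.repr.injective
      rw [h3, b.repr_self]
    exact congrArg Subtype.val h4

end GraphChart

end SphereMCF

end

/-! ### The flow in a graph chart. -/

noncomputable section

namespace SphereMCF

set_option linter.unusedSimpArgs false

open Matrix Finset Filter Topology smoothGerm

/-- The germ of a constant function. -/
def smoothGerm.const {Z : Type*} [NormedAddCommGroup Z] [NormedSpace ℝ Z] (z₀ : Z) (c : ℝ) :
    smoothGerm z₀ := smoothGerm.mk (fun _ => c) contDiffAt_const

section

variable {n : ℕ} {V : Type*} [NormedAddCommGroup V] [InnerProductSpace ℝ V] {z₀ : Param n}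

theorem eventually_inner_fderiv {u v : Param n → V} {w : Param n → ℝ} (hu : ContDiffAt ℝ ∞ u z₀)
    (hv : ContDiffAt ℝ ∞ v z₀) (h : ∀ᶠ z in 𝓝 z₀, inner ℝ (u z) (v z) = w z) (e : Param n) :
    ∀ᶠ z in 𝓝 z₀, inner ℝ (u z) (fderiv ℝ v z e) + inner ℝ (fderiv ℝ u z e) (v z)
      = fderiv ℝ w z e := by
  filter_upwards [eventually_differentiableAt_of_smooth hu, eventually_differentiableAt_of_smooth hv,
    h.eventually_nhds] with z h1 h2 h3
  rw [← fderiv_inner_apply ℝ h1 h2, EventuallyEq.fderiv_eq h3]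

theorem tendsto_slice {t₀ : ℝ} {y₀ : EuclideanSpace ℝ (Fin n)} :
    Tendsto (fun y => ((t₀, y) : Param n)) (𝓝 y₀) (𝓝 (t₀, y₀)) := by
  have : Continuous (fun y : EuclideanSpace ℝ (Fin n) => ((t₀, y) : Param n)) := by fun_prop
  exact this.tendsto y₀

/-- The graph condition holds at time t₀ only, so it can be differentiated only along the slice. -/
theorem eventually_inner_coordVec_slice {u : Param n → V} {t₀ : ℝ} {y₀ : EuclideanSpace ℝ (Fin n)}
    (hu : ContDiffAt ℝ ∞ u (t₀, y₀)) {w : V} {c : EuclideanSpace ℝ (Fin n) → ℝ}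
    (h : ∀ᶠ y in 𝓝 y₀, inner ℝ w (u (t₀, y)) = c y) (i : Fin n) :
    ∀ᶠ y in 𝓝 y₀, inner ℝ w (coordVec u (t₀, y) i) = fderiv ℝ c y (EuclideanSpace.single i 1) := by
  filter_upwards [h.eventually_nhds,
    tendsto_slice.eventually (eventually_differentiableAt_of_smooth hu)] with y h1 h2
  rw [← EventuallyEq.fderiv_eq h1, coordVec_eq_slice h2]
  have h3 : DifferentiableAt ℝ (fun y => u (t₀, y)) y :=
    h2.comp y (by fun_prop)
  rw [fderiv_inner_apply ℝ (differentiableAt_const _) h3]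
  simp

theorem fderiv_tDir_eq_deriv {u : Param n → V} {t : ℝ} {y : EuclideanSpace ℝ (Fin n)}
    (hu : DifferentiableAt ℝ u (t, y)) {v : V} (h : HasDerivAt (fun s => u (s, y)) v t) :
    fderiv ℝ u (t, y) tDir = v := by
  have h1 : HasDerivAt (fun s : ℝ => ((s, y) : Param n)) tDir t :=
    (hasDerivAt_id t).prodMk (hasDerivAt_const t y)
  exact (hu.hasFDerivAt.comp_hasDerivAt t h1).unique h

end

namespace GraphChart

variable {n k : ℕ} {M : Type*} [TopologicalSpace M] [ChartedSpace (EuclideanSpace ℝ (Fin n)) M]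
  {R : ℝ} {F : ℝ → M → Ambient n k} {t₀ : ℝ} {x₀ : M}

/-- The family of immersions in the parametrization. -/
def param (c : GraphChart F t₀ x₀) (z : Param n) : Ambient n k := F z.1 (c.χ z.2)

variable (c : GraphChart F t₀ x₀) (hF : IsAncientSolution R F) (ht₀ : t₀ < 0)

theorem param_base : c.param (t₀, 0) = F t₀ x₀ := by rw [param, c.χ_zero]

theorem gramM_base : gramM (coordVec c.param (t₀, 0)) = 1 := by
  ext i j
  rw [gramM, Matrix.of_apply, Matrix.one_apply]
  have h := orthonormal_iff_ite.1 c.orthonormal_e i j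
  rw [← h, ← c.coordVec_base, ← c.coordVec_base]
  rfl

theorem isUnit_det_base : IsUnit (gramM (coordVec c.param (t₀, 0))).det := by
  rw [c.gramM_base, Matrix.det_one]; exact isUnit_one

include hF ht₀

theorem contDiffAt_param : ContDiffAt ℝ ∞ c.param (t₀, 0) :=
  hF.contDiffAt_comp le_rfl ht₀ c.smooth_χ

omit hF in
theorem eventually_neg : ∀ᶠ z : Param n in 𝓝 (t₀, 0), z.1 < 0 :=
  (continuous_fst.tendsto _).eventually (Iio_mem_nhds ht₀)

theorem eventually_inner_self : ∀ᶠ z in 𝓝 (t₀, 0), inner ℝ (c.param z) (c.param z) = R ^ 2 := by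
  filter_upwards [eventually_neg ht₀] with z hz
  have := hF.mem_sphere z.1 hz (c.χ z.2)
  rw [mem_sphere_zero_iff_norm] at this
  rw [real_inner_self_eq_norm_sq, param, this]

theorem eventually_inner_coordVec :
    ∀ᶠ z in 𝓝 (t₀, 0), ∀ i, inner ℝ (c.param z) (coordVec c.param z i) = 0 := by
  refine eventually_all.2 fun i => ?_
  have hc := c.contDiffAt_param hF ht₀
  filter_upwards [eventually_inner_fderiv hc hc (c.eventually_inner_self hF ht₀) (eDir i)] with z hz
  rw [real_inner_comm] at hz
  simp only [fderiv_const_apply, fderiv_fun_const, Pi.zero_apply, _root_.zero_apply] at hz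
  change inner ℝ (coordVec c.param z i) (c.param z) + inner ℝ (coordVec c.param z i) (c.param z) = 0
    at hz
  rw [real_inner_comm]
  linarith

theorem eventually_inner_coordVec₂ : ∀ᶠ z in 𝓝 (t₀, 0), ∀ i j,
    inner ℝ (c.param z) (coordVec₂ c.param z i j) = -gramM (coordVec c.param z) i j := by
  refine eventually_all.2 fun i => eventually_all.2 fun j => ?_
  have hc := c.contDiffAt_param hF ht₀
  filter_upwards [eventually_inner_fderiv hc (contDiffAt_fderiv_apply' hc (eDir j))
    ((c.eventually_inner_coordVec hF ht₀).mono fun z hz => hz j) (eDir i)] with z hz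
  simp only [fderiv_const_apply, fderiv_fun_const, Pi.zero_apply, _root_.zero_apply] at hz
  exact eq_neg_of_add_eq_zero_left hz

theorem eventually_flow : ∀ᶠ z in 𝓝 (t₀, 0),
    fderiv ℝ c.param z tDir = meanCurv (F z.1) (c.χ z.2) := by
  filter_upwards [eventually_neg ht₀,
    eventually_differentiableAt_of_smooth (c.contDiffAt_param hF ht₀)] with z h1 h2
  exact fderiv_tDir_eq_deriv (t := z.1) (y := z.2) h2 (hF.flow z.1 h1 (c.χ z.2))

variable [IsManifold (𝓡 n) ∞ M]

omit hF ht₀ in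
theorem eventually_contMDiffAt : ∀ᶠ z : Param n in 𝓝 (t₀, 0),
    ContMDiffAt 𝓘(ℝ, EuclideanSpace ℝ (Fin n)) (𝓡 n) 2 c.χ z.2 := by
  have h2 : ContMDiffAt 𝓘(ℝ, EuclideanSpace ℝ (Fin n)) (𝓡 n) 2 c.χ 0 :=
    c.smooth_χ.of_le ENat.LEInfty.out
  have : IsManifold (𝓡 n) 2 M := IsManifold.of_le (n := ∞) ENat.LEInfty.out
  exact (continuous_snd.tendsto _).eventually
    ((contMDiffAt_iff_contMDiffAt_nhds (by simp)).1 h2)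

theorem eventually_curvature (hR : 0 < R) : ∀ᶠ z in 𝓝 (t₀, 0),
    let v := coordVec c.param z
    let h := normalPart v (coordVec₂ c.param z)
    meanCurv (F z.1) (c.χ z.2) = traceG v h + (n * (R ^ 2)⁻¹) • c.param z ∧
    ‖meanCurv (F z.1) (c.χ z.2)‖ ^ 2 = inner ℝ (traceG v h) (traceG v h) - n ^ 2 * (R ^ 2)⁻¹ ∧
    secondFundFormNormSq (F z.1) (c.χ z.2) = normSqG v h - n * (R ^ 2)⁻¹ := by
  have hK0 : (R ^ 2)⁻¹ ≠ 0 := by positivity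
  filter_upwards [eventually_neg ht₀, c.eventually_contMDiffAt,
    eventually_isUnit_det (c.contDiffAt_param hF ht₀) c.isUnit_det_base,
    c.eventually_inner_self hF ht₀, c.eventually_inner_coordVec hF ht₀,
    c.eventually_inner_coordVec₂ hF ht₀] with z h1 h2 h3 h4 h5 h6
  have h4' : inner ℝ (c.param z) (c.param z) = ((R ^ 2)⁻¹)⁻¹ := by rw [h4, inv_inv]
  obtain ⟨e1, e2⟩ := hF.curvature_eq (t := z.1) (y := z.2) h1 h2 h3
  refine ⟨?_, ?_, ?_⟩
  · rw [e1]; exact traceG_sff h3 h5 h6 h4' hK0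
  · rw [e1]; exact normSq_traceG_sff h3 h5 h6 h4' hK0
  · rw [e2]; exact normSqG_sff h3 h5 h6 h4' hK0

/-- The jet of the flow in a graph chart. -/
def jet : ImmersionJet n (n + k + 1) (smoothGerm ((t₀, 0) : Param n)) :=
  localJet c.param (t₀, 0) (c.contDiffAt_param hF ht₀) c.isUnit_det_base

omit [IsManifold (𝓡 n) ∞ M] in
theorem rep_jet_f (α : Fin (n + k + 1)) :
    Rep ((c.jet hF ht₀).f α) fun z => c.param z α := rfl

omit [IsManifold (𝓡 n) ∞ M] in
theorem jet_r (i : Fin n) : (c.jet hF ht₀).r i = (c.e i).ofLp := by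
  funext α
  refine (rep_localJet_f1 i α).ev.trans ?_
  rw [← c.coordVec_base]; rfl

omit [IsManifold (𝓡 n) ∞ M] in
theorem eventually_inner_e_coordVec (i l : Fin n) : ∀ᶠ y in 𝓝 0,
    inner ℝ (c.e l) (coordVec c.param (t₀, y) i) = if i = l then 1 else 0 := by
  have h1 : ∀ᶠ y in 𝓝 0, inner ℝ (c.e l) (c.param (t₀, y))
      = y l + inner ℝ (c.e l) (F t₀ x₀) := by
    filter_upwards [c.graph] with y hy
    have := hy l
    rw [inner_sub_right] at this
    rw [← this, param]; ring
  filter_upwards [eventually_inner_coordVec_slice (c.contDiffAt_param hF ht₀) h1 i] with y hy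
  rw [hy]
  have h2 : HasFDerivAt (fun y : EuclideanSpace ℝ (Fin n) => y l + inner ℝ (c.e l) (F t₀ x₀))
      (EuclideanSpace.proj (𝕜 := ℝ) l) y := (EuclideanSpace.proj (𝕜 := ℝ) l).hasFDerivAt.add_const _
  rw [h2.fderiv]
  simp [Pi.single_apply, eq_comm]

-- On the slice t₀ one has ⟨e l, ∂_i f⟩ = δ_il throughout a neighbourhood, so further spatial
-- derivatives of f are orthogonal to every e l.
omit [IsManifold (𝓡 n) ∞ M] in
theorem jet_isGraph : (c.jet hF ht₀).IsGraph := by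
  have hc := c.contDiffAt_param hF ht₀
  have ha : ∀ i j l, ∀ᶠ y in 𝓝 0, inner ℝ (c.e l) (coordVec₂ c.param (t₀, y) i j) = 0 := by
    intro i j l
    filter_upwards [eventually_inner_coordVec_slice (contDiffAt_fderiv_apply' hc (eDir j))
      (c.eventually_inner_e_coordVec hF ht₀ j l) i] with y hy
    exact hy.trans (by simp)
  refine ⟨fun i j => ?_, fun i j l => ?_, fun i j m l => ?_⟩
  · rw [c.jet_r, c.jet_r]
    have := orthonormal_iff_ite.1 c.orthonormal_e i j
    rw [inner_eq_dotProduct] at this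
    exact this
  · have h1 : (c.jet hF ht₀).a i j = (coordVec₂ c.param (t₀, 0) i j).ofLp :=
      funext fun α => (rep_localJet_f2 i j α).ev
    rw [c.jet_r, h1]
    have := (ha i j l).self_of_nhds
    rw [real_inner_comm, inner_eq_dotProduct] at this
    exact this
  · have hc2 : ContDiffAt ℝ ∞ (fun z => coordVec₂ c.param z j m) (t₀, 0) :=
      contDiffAt_fderiv_apply' (contDiffAt_fderiv_apply' hc (eDir m)) (eDir j)
    have h1 : (c.jet hF ht₀).t i j m
        = (coordVec (fun z => coordVec₂ c.param z j m) (t₀, 0) i).ofLp := by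
      funext α
      exact (((rep_localJet_f2 j m α).d (eDir i)).congr (eventually_fderiv_coord hc2 α (eDir i))).ev
    rw [c.jet_r, h1]
    have := (eventually_inner_coordVec_slice hc2 (ha j m l) i).self_of_nhds
    rw [real_inner_comm, inner_eq_dotProduct] at this
    exact this.trans (by simp)

omit [IsManifold (𝓡 n) ∞ M] in
theorem jet_isSpherical :
    (c.jet hF ht₀).IsSpherical (smoothGerm.const _ (R ^ 2)) where
  D_const i := d_const _ _
  eq := by
    have h1 : Rep ((c.jet hF ht₀).f ⬝ᵥ (c.jet hF ht₀).f)
        fun z => inner ℝ (c.param z) (c.param z) :=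
      Rep.dotProduct (c.rep_jet_f hF ht₀) (c.rep_jet_f hF ht₀)
    exact h1.eq (rep_const _) (c.eventually_inner_self hF ht₀)

/-- The spherical mean curvature vector is the Euclidean one plus nK times the position, hence the
constant κ = nK. -/
theorem jet_isFlow (hR : 0 < R) :
    (c.jet hF ht₀).IsFlow (smoothGerm.const _ (n * (R ^ 2)⁻¹)) where
  D_const i := d_const _ _
  eq α := by
    have h1 : Rep ((c.jet hF ht₀).D0 ((c.jet hF ht₀).f α)) fun z => fderiv ℝ c.param z tDir α :=
      ((c.rep_jet_f hF ht₀ α).d tDir).congr (eventually_fderiv_coord (c.contDiffAt_param hF ht₀) α tDir)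
    refine h1.eq ((rep_localJet_Hv α).add ((rep_const _).mul (c.rep_jet_f hF ht₀ α))) ?_
    filter_upwards [c.eventually_flow hF ht₀, c.eventually_curvature hF ht₀ hR] with z h1 h2
    rw [h1, h2.1]
    simp

end GraphChart

end SphereMCF

end

/-! ### The maximum principle for the pinching quotient. -/

noncomputable section

namespace SphereMCF

set_option linter.unusedSimpArgs false

open Matrix Finset Filter Topology smoothGerm

section Calculus

variable {Z : Type*} [NormedAddCommGroup Z] [NormedSpace ℝ Z] {p : Z → ℝ} {z₀ e : Z}

/-- The second derivative test along a line. -/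
theorem fderiv_fderiv_nonpos_of_line (hp : ContDiffAt ℝ ∞ p z₀)
    (h : ∀ᶠ s : ℝ in 𝓝 0, p (z₀ + s • e) ≤ p z₀) :
    fderiv ℝ (fun z => fderiv ℝ p z e) z₀ e ≤ 0 := by
  set u : ℝ → ℝ := fun s => p (z₀ + s • e) with hu
  have hline : ∀ s : ℝ, HasDerivAt (fun s : ℝ => z₀ + s • e) e s := fun s => by
    simpa using ((hasDerivAt_id s).smul_const e).const_add z₀
  have hcont : Tendsto (fun s : ℝ => z₀ + s • e) (𝓝 0) (𝓝 z₀) := by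
    have := (hline 0).continuousAt.tendsto
    simpa using this
  have hd1 : deriv u =ᶠ[𝓝 0] fun s => fderiv ℝ p (z₀ + s • e) e := by
    filter_upwards [hcont.eventually (eventually_differentiableAt_of_smooth hp)] with s hs
    exact (hs.hasFDerivAt.comp_hasDerivAt s (hline s)).deriv
  have hd2 : deriv (deriv u) 0 = fderiv ℝ (fun z => fderiv ℝ p z e) z₀ e := by
    rw [hd1.deriv_eq]
    have h1 : DifferentiableAt ℝ (fun z => fderiv ℝ p z e) z₀ :=
      (contDiffAt_fderiv_apply hp e).differentiableAt (by simp)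
    have h2 : HasFDerivAt (fun z => fderiv ℝ p z e) (fderiv ℝ (fun z => fderiv ℝ p z e) z₀)
        (z₀ + (0 : ℝ) • e) := by simpa using h1.hasFDerivAt
    exact (h2.comp_hasDerivAt (0 : ℝ) (hline 0)).deriv
  have hmax : IsLocalMax u 0 := by
    filter_upwards [h] with s hs
    simpa [hu] using hs
  rw [← hd2]
  -- A positive second derivative would make 0 a local minimum too; u would then be locally
  -- constant, with vanishing second derivative.
  by_contra! hpos
  have hc : ContinuousAt u 0 := by
    have h0 : ContinuousAt p (z₀ + (0 : ℝ) • e) := by simpa using hp.continuousAt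
    exact ContinuousAt.comp (f := fun s : ℝ => z₀ + s • e) h0 (hline 0).continuousAt
  have hmin := isLocalMin_of_deriv_deriv_pos hpos hmax.deriv_eq_zero hc
  have hconst : u =ᶠ[𝓝 0] fun _ => u 0 := by
    filter_upwards [hmax, hmin] with s h1 h2
    exact le_antisymm h1 h2
  have : deriv u =ᶠ[𝓝 0] fun _ => 0 := by
    filter_upwards [hconst.eventuallyEq_nhds] with s hs
    rw [hs.deriv_eq, deriv_const]
  rw [this.deriv_eq, deriv_const] at hpos
  exact lt_irrefl _ hpos

end Calculus

section PinchingFunctions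

variable {n k : ℕ} {M : Type*} [TopologicalSpace M] [ChartedSpace (EuclideanSpace ℝ (Fin n)) M]

/-- The squared norm `|h|² - |H|² / n` of the traceless second fundamental form. -/
def tracelessNormSq (F : ℝ → M → Ambient n k) (t : ℝ) (x : M) : ℝ :=
  secondFundFormNormSq (F t) x - ‖meanCurv (F t) x‖ ^ 2 / n

/-- The denominator of the pinching quotient. -/
def pinchingWeight (F : ℝ → M → Ambient n k) (c : ℝ) (t : ℝ) (x : M) : ℝ :=
  ‖meanCurv (F t) x‖ ^ 2 / (3 * n) + c

end PinchingFunctions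

namespace GraphChart

variable {n k : ℕ} {M : Type*} [TopologicalSpace M] [ChartedSpace (EuclideanSpace ℝ (Fin n)) M]
  {R : ℝ} {F : ℝ → M → Ambient n k} {t₀ : ℝ} {x₀ : M}

variable (c : GraphChart F t₀ x₀)
include c

/-- Continuity in chart coordinates is carried back to M by the local inverse η of χ. -/
theorem continuousAt_of_param {Y : Type*} [TopologicalSpace Y] {P : Param n → Y} {Q : ℝ × M → Y}
    (hP : ContinuousAt P (t₀, 0)) (h : ∀ᶠ z in 𝓝 (t₀, 0), Q (z.1, c.χ z.2) = P z) :
    ContinuousAt Q (t₀, x₀) := by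
  have hη : ContinuousAt (fun z : ℝ × M => ((z.1, c.η z.2) : Param n)) (t₀, x₀) :=
    continuousAt_fst.prodMk (ContinuousAt.comp (f := Prod.snd) c.smooth_η.continuousAt continuousAt_snd)
  have h1 : ContinuousAt (fun z : ℝ × M => P (z.1, c.η z.2)) (t₀, x₀) :=
    ContinuousAt.comp (f := fun z : ℝ × M => ((z.1, c.η z.2) : Param n))
      (by simpa [c.η_base] using hP) hη
  refine h1.congr ?_
  have h2 : ∀ᶠ z : ℝ × M in 𝓝 (t₀, x₀), c.χ (c.η z.2) = z.2 :=
    (continuous_snd.tendsto (t₀, x₀)).eventually c.χ_η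
  have h3 := hη.eventually (p := fun z : Param n => Q (z.1, c.χ z.2) = P z)
    (by simpa only [c.η_base] using h)
  filter_upwards [h2, h3] with z h2 h3
  rw [← h3, h2]

theorem eventually_of_manifold {Q : ℝ × M → Prop} (h : ∀ᶠ z in 𝓝 (t₀, x₀), Q z) :
    ∀ᶠ z : Param n in 𝓝 (t₀, 0), Q (z.1, c.χ z.2) := by
  have hχ : ContinuousAt (fun z : Param n => ((z.1, c.χ z.2) : ℝ × M)) (t₀, 0) :=
    continuousAt_fst.prodMk
      (ContinuousAt.comp (f := Prod.snd) c.smooth_χ.continuousAt continuousAt_snd)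
  refine hχ.eventually ?_
  simpa [c.χ_zero] using h

variable [IsManifold (𝓡 n) ∞ M] (hF : IsAncientSolution R F) (ht₀ : t₀ < 0) (hR : 0 < R)
include c hF ht₀ hR

theorem eventually_tracelessNormSq (hn : n ≠ 0) : ∀ᶠ z in 𝓝 (t₀, 0),
    let v := coordVec c.param z
    let h := normalPart v (coordVec₂ c.param z)
    tracelessNormSq F z.1 (c.χ z.2)
      = normSqG v h - (n : ℝ)⁻¹ * inner ℝ (traceG v h) (traceG v h) := by
  filter_upwards [c.eventually_curvature hF ht₀ hR] with z hz
  obtain ⟨-, h1, h2⟩ := hz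
  have hn' : (n : ℝ) ≠ 0 := by exact_mod_cast hn
  simp only [tracelessNormSq, h1, h2]
  field_simp
  ring

theorem eventually_pinchingWeight (hn : n ≠ 0) (b : ℝ) : ∀ᶠ z in 𝓝 (t₀, 0),
    let v := coordVec c.param z
    let h := normalPart v (coordVec₂ c.param z)
    pinchingWeight F (b * (R ^ 2)⁻¹) z.1 (c.χ z.2)
      = (3 * n : ℝ)⁻¹ * inner ℝ (traceG v h) (traceG v h)
        + (b * (R ^ 2)⁻¹ - n * (R ^ 2)⁻¹ / 3) := by
  filter_upwards [c.eventually_curvature hF ht₀ hR] with z hz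
  obtain ⟨-, h1, -⟩ := hz
  have hn' : (n : ℝ) ≠ 0 := by exact_mod_cast hn
  simp only [pinchingWeight, h1]
  field_simp
  ring

theorem continuousAt_tracelessNormSq (hn : n ≠ 0) :
    ContinuousAt (fun z : ℝ × M => tracelessNormSq F z.1 z.2) (t₀, x₀) := by
  refine c.continuousAt_of_param ?_ (c.eventually_tracelessNormSq hF ht₀ hR hn)
  exact ((rep_localJet_S (hf := c.contDiffAt_param hF ht₀) (hd := c.isUnit_det_base)).sub
    ((rep_const _).mul (rep_localJet_B (hf := c.contDiffAt_param hF ht₀)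
    (hd := c.isUnit_det_base)))).contDiffAt.continuousAt

theorem continuousAt_pinchingWeight (hn : n ≠ 0) (b : ℝ) :
    ContinuousAt (fun z : ℝ × M => pinchingWeight F (b * (R ^ 2)⁻¹) z.1 z.2) (t₀, x₀) := by
  refine c.continuousAt_of_param ?_ (c.eventually_pinchingWeight hF ht₀ hR hn b)
  exact (((rep_const _).mul (rep_localJet_B (hf := c.contDiffAt_param hF ht₀)
    (hd := c.isUnit_det_base))).add (rep_const _)).contDiffAt.continuousAt

theorem tracelessNormSq_eq (hn : n ≠ 0) :
    tracelessNormSq F t₀ x₀ = ∑ i, ∑ j, (c.jet hF ht₀).tf i j ⬝ᵥ (c.jet hF ht₀).tf i j := by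
  have hG := c.jet_isGraph hF ht₀
  rw [ImmersionJet.sum_dotProduct_tf_sq _ hn, ← hG.ev_S, ← hG.ev_B]
  have h := (c.eventually_tracelessNormSq hF ht₀ hR hn).self_of_nhds
  have h1 : (c.jet hF ht₀).ev (c.jet hF ht₀).S = _ := rep_localJet_S.ev
  have h2 : (c.jet hF ht₀).ev (c.jet hF ht₀).B = _ := rep_localJet_B.ev
  rw [h1, h2]
  simp only [c.χ_zero] at h
  rw [h]
  ring

theorem tracelessNormSq_nonneg (hn : n ≠ 0) : 0 ≤ tracelessNormSq F t₀ x₀ := by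
  rw [c.tracelessNormSq_eq hF ht₀ hR hn]
  exact sum_nonneg fun i _ => sum_nonneg fun j _ => sum_nonneg fun α _ => mul_self_nonneg _

/-- The pinching quotient, weighted by the exponential of its rate of decay, has no interior
maximum. -/
theorem not_pinching_max (hn : 2 ≤ n) (hH : 0 < ‖meanCurv (F t₀) x₀‖) {b lam : ℝ} (hb : 0 ≤ b)
    (hbn : 2 * b < n) (hl : 0 < lam) (hl1 : lam ≤ 1)
    (heq : tracelessNormSq F t₀ x₀ = lam * pinchingWeight F (b * (R ^ 2)⁻¹) t₀ x₀)
    (hle : ∀ᶠ z in 𝓝 (t₀, x₀), z.1 ≤ t₀ → tracelessNormSq F z.1 z.2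
      ≤ lam * Real.exp (-((n - 2 * b) * (R ^ 2)⁻¹) * (z.1 - t₀))
        * pinchingWeight F (b * (R ^ 2)⁻¹) z.1 z.2) : False := by
  have hn0 : n ≠ 0 := by omega
  have hK : 0 < (R ^ 2)⁻¹ := by positivity
  set K := (R ^ 2)⁻¹ with hKdef
  set L := c.jet hF ht₀ with hL
  have hG := c.jet_isGraph hF ht₀
  -- The weight has value `lam` at time t₀ and decays at the rate that `heat_pinching_neg` demands
  -- of Λ. It remains to show that φ - ΛW, at its local maximum over times up to t₀, has nonnegative
  -- heat operator.
  set ex : Param n → ℝ := fun z => lam * Real.exp (-((n - 2 * b) * K) * (z.1 - t₀)) with hex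
  have hexs : ContDiff ℝ ∞ ex := by
    have : ContDiff ℝ ∞ (fun z : Param n => z.1) := contDiff_fst
    exact contDiff_const.mul ((contDiff_const.mul (this.sub contDiff_const)).exp)
  have hexd : ∀ z v, fderiv ℝ ex z v = -((n - 2 * b) * K) * v.1 * ex z := fun z v => by
    have h1 : HasFDerivAt (fun z : Param n => z.1 - t₀)
        (ContinuousLinearMap.fst ℝ ℝ (EuclideanSpace ℝ (Fin n))) z := hasFDerivAt_fst.sub_const _
    have h2 := ((h1.const_mul (-((n - 2 * b) * K))).exp).const_mul lam
    rw [hex, h2.fderiv]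
    simp only [_root_.smul_apply, ContinuousLinearMap.coe_fst', smul_eq_mul]
    ring
  let Λ : smoothGerm ((t₀, 0) : Param n) := smoothGerm.mk ex hexs.contDiffAt
  have hΛ : Rep Λ ex := rep_mk _ _
  have hex0 : ex (t₀, 0) = lam := by simp [hex]
  set ν := smoothGerm.const ((t₀, 0) : Param n) (n : ℝ)⁻¹
  set α := smoothGerm.const ((t₀, 0) : Param n) (3 * n : ℝ)⁻¹
  set β := smoothGerm.const ((t₀, 0) : Param n) (b * K - n * K / 3)
  have hrB : Rep L.B _ := rep_localJet_B
  have hrS : Rep L.S _ := rep_localJet_S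
  have hrφ : Rep (L.S - ν * L.B) fun z => tracelessNormSq F z.1 (c.χ z.2) := by
    refine (hrS.sub ((rep_const _).mul hrB)).congr ?_
    filter_upwards [c.eventually_tracelessNormSq hF ht₀ hR hn0] with z hz
    exact hz.symm
  have hrW : Rep (α * L.B + β) fun z => pinchingWeight F (b * K) z.1 (c.χ z.2) := by
    refine (((rep_const _).mul hrB).add (rep_const _)).congr ?_
    filter_upwards [c.eventually_pinchingWeight hF ht₀ hR hn0 b] with z hz
    exact hz.symm
  have hrψ := hrφ.sub (hΛ.mul hrW)
  set p : Param n → ℝ := fun z => tracelessNormSq F z.1 (c.χ z.2)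
    - ex z * pinchingWeight F (b * K) z.1 (c.χ z.2) with hp
  have hps : ContDiffAt ℝ ∞ p (t₀, 0) := hrψ.contDiffAt
  have hp0 : p (t₀, 0) = 0 := by simp only [hp, hex0, c.χ_zero, heq, sub_self]
  have hpneg : ∀ᶠ z in 𝓝 (t₀, 0), z.1 ≤ t₀ → p z ≤ 0 := by
    filter_upwards [c.eventually_of_manifold hle] with z hz hz1
    exact sub_nonpos.2 (hz hz1)
  have hW0 : 0 < pinchingWeight F (b * K) t₀ x₀ := by
    have : (0 : ℝ) < n := by positivity
    rw [pinchingWeight]; positivity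
  have hheat : L.heat (L.S - ν * L.B - Λ * (α * L.B + β)) < 0 := by
    refine ImmersionJet.heat_pinching_neg (c.jet_isFlow hF ht₀ hR) hG (c.jet_isSpherical hF ht₀) hn hK
      (rep_const _).ev ((rep_const _).ev.trans (inv_inv _).symm) hb hbn (rep_const _).ev
      (rep_const _).ev (rep_const _).ev (fun i => d_const _ _) (fun i => d_const _ _)
      (fun i => d_const _ _) (fun i => ?_) (d_const _ _) (d_const _ _) (d_const _ _) ?_ ?_ ?_ ?_ ?_ ?_
    · refine (hΛ.d (eDir i)).eq (g := fun _ => 0) rfl (Eventually.of_forall fun z => ?_)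
      simp [hexd, eDir]
    · refine (hΛ.d tDir).ev.trans ?_
      rw [hexd]
      have : L.ev Λ = ex (t₀, 0) := hΛ.ev
      rw [this]; simp [tDir]
    · exact hΛ.ev.symm ▸ hex0.symm ▸ hl.le
    · exact hΛ.ev.symm ▸ hex0.symm ▸ hl1
    · have h1 : L.ev L.B = _ := hrB.ev
      have h2 := (c.eventually_curvature hF ht₀ hR).self_of_nhds.2.1
      rw [h1]
      simp only [c.χ_zero] at h2
      have : 0 < ‖meanCurv (F t₀) x₀‖ ^ 2 := by positivity
      rw [h2] at this
      linarith
    · have h1 : L.ev (L.S - ν * L.B) = _ := hrφ.ev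
      rw [h1]
      simp only [c.χ_zero, heq]
      positivity
    · have h1 : L.ev (L.S - ν * L.B) = _ := hrφ.ev
      have h2 : L.ev (Λ * (α * L.B + β)) = _ := (hΛ.mul hrW).ev
      rw [h1, h2]
      simp only [c.χ_zero, heq, hex0]
  have htime : 0 ≤ L.ev (L.D0 (L.S - ν * L.B - Λ * (α * L.B + β))) := by
    have h1 : L.ev (L.D0 (L.S - ν * L.B - Λ * (α * L.B + β))) = _ := (hrψ.d tDir).ev
    rw [h1]
    have hmax : IsLocalMaxOn p {z | z.1 ≤ t₀} (t₀, 0) := by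
      filter_upwards [hpneg.filter_mono nhdsWithin_le_nhds, self_mem_nhdsWithin] with z h h'
      rw [hp0]; exact h h'
    -- The comparison covers times up to t₀ only, so the first order condition is available in the
    -- backward time direction alone.
    have hcone : -tDir ∈ posTangentConeAt {z : Param n | z.1 ≤ t₀} (t₀, 0) := by
      refine mem_posTangentConeAt_of_segment_subset ?_
      refine (convex_halfSpace_le (f := fun z : Param n => z.1)
        (ContinuousLinearMap.fst ℝ ℝ (EuclideanSpace ℝ (Fin n))).isLinear t₀).segment_subset ?_ ?_
      · simp
      · simp [tDir]
    have := hmax.hasFDerivWithinAt_nonpos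
      (hps.differentiableAt (by simp)).hasFDerivAt.hasFDerivWithinAt hcone
    rw [map_neg] at this
    linarith
  have hspace : ∀ i, L.ev (L.D i (L.D i (L.S - ν * L.B - Λ * (α * L.B + β)))) ≤ 0 := by
    intro i
    have h1 : L.ev (L.D i (L.D i (L.S - ν * L.B - Λ * (α * L.B + β)))) = _ :=
      ((hrψ.d (eDir i)).d (eDir i)).ev
    rw [h1]
    refine fderiv_fderiv_nonpos_of_line hps ?_
    have hc : Continuous (fun s : ℝ => ((t₀, 0) : Param n) + s • eDir i) := by fun_prop
    have hc0 : Tendsto (fun s : ℝ => ((t₀, 0) : Param n) + s • eDir i) (𝓝 0) (𝓝 (t₀, 0)) := by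
      simpa using hc.tendsto 0
    filter_upwards [hc0.eventually hpneg] with s hs
    rw [hp0]
    exact hs (by simp [eDir])
  have hsum : ∑ i, L.ev (L.D i (L.D i (L.S - ν * L.B - Λ * (α * L.B + β)))) ≤ 0 :=
    sum_nonpos fun i _ => hspace i
  rw [ImmersionJet.heat] at hheat
  linarith

end GraphChart

section MaximumPrinciple

variable {n k : ℕ} {M : Type*} [TopologicalSpace M] [CompactSpace M]
  [ChartedSpace (EuclideanSpace ℝ (Fin n)) M] [IsManifold (𝓡 n) ∞ M] {R : ℝ}
  {F : ℝ → M → Ambient n k}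

/-- Pinching improves exponentially. -/
theorem IsAncientSolution.pinching_decay (hF : IsAncientSolution R F) (hR : 0 < R) (hn : 2 ≤ n)
    (hH : ∀ t < 0, ∀ x, 0 < ‖meanCurv (F t) x‖) {b : ℝ} (hb : 0 ≤ b) (hbn : 2 * b < n)
    (hpinch : ∀ t < 0, ∀ x, tracelessNormSq F t x ≤ pinchingWeight F (b * (R ^ 2)⁻¹) t x)
    {t₁ t₂ : ℝ} (h12 : t₁ < t₂) (h2 : t₂ < 0) (x : M) :
    tracelessNormSq F t₂ x ≤ Real.exp (-((n - 2 * b) * (R ^ 2)⁻¹ * (t₂ - t₁)))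
      * pinchingWeight F (b * (R ^ 2)⁻¹) t₂ x := by
  have hn0 : n ≠ 0 := by omega
  have hnpos : (0 : ℝ) < n := by positivity
  set K := (R ^ 2)⁻¹ with hK
  have hKpos : 0 < K := by positivity
  set ε := (n - 2 * b) * K with hε
  have hW : ∀ t < 0, ∀ x, 0 < pinchingWeight F (b * K) t x := fun t ht x => by
    have := hH t ht x
    rw [pinchingWeight]; positivity
  -- The claim is Q ≤ 1 on [t₁, t₂] × M. A maximum above 1 is not attained at t₁, where pinching
  -- gives Q ≤ 1, and at any later time it contradicts `not_pinching_max`.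
  set Q : ℝ × M → ℝ := fun z => Real.exp (ε * (z.1 - t₁))
    * (tracelessNormSq F z.1 z.2 / pinchingWeight F (b * K) z.1 z.2) with hQ
  have hcont : ContinuousOn Q (Set.Icc t₁ t₂ ×ˢ Set.univ) := by
    rintro ⟨t, y⟩ ⟨ht, -⟩
    have ht0 : t < 0 := ht.2.trans_lt h2
    obtain ⟨c⟩ := hF.exists_graphChart ht0 y
    have he : ContinuousAt (fun z : ℝ × M => Real.exp (ε * (z.1 - t₁))) (t, y) := by fun_prop
    exact (he.mul ((c.continuousAt_tracelessNormSq hF ht0 hR hn0).div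
      (c.continuousAt_pinchingWeight hF ht0 hR hn0 b) (hW t ht0 y).ne')).continuousWithinAt
  obtain ⟨⟨t, y⟩, ⟨ht, -⟩, hmax⟩ := (isCompact_Icc.prod isCompact_univ).exists_isMaxOn
    ⟨(t₁, x), ⟨le_rfl, h12.le⟩, Set.mem_univ _⟩ hcont
  have ht0 : t < 0 := ht.2.trans_lt h2
  have hQ1 : Q (t, y) ≤ 1 := by
    by_contra! hQ1
    set lam := tracelessNormSq F t y / pinchingWeight F (b * K) t y with hlam
    have hlam1 : lam ≤ 1 := (div_le_one (hW t ht0 y)).2 (hpinch t ht0 y)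
    have hQt : Q (t, y) = Real.exp (ε * (t - t₁)) * lam := rfl
    have hlt : t₁ < t := by
      rcases ht.1.lt_or_eq with h | h
      · exact h
      · rw [hQt, show t = t₁ from h.symm, sub_self, mul_zero, Real.exp_zero, one_mul] at hQ1
        linarith
    have hlam0 : 0 < lam := by
      by_contra! hneg
      have := mul_nonpos_of_nonneg_of_nonpos (Real.exp_pos (ε * (t - t₁))).le hneg
      linarith
    obtain ⟨c⟩ := hF.exists_graphChart ht0 y
    refine c.not_pinching_max hF ht0 hR hn (hH t ht0 y) hb hbn hlam0 hlam1
      (div_mul_cancel₀ _ (hW t ht0 y).ne').symm ?_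
    have : ∀ᶠ z : ℝ × M in 𝓝 (t, y), t₁ < z.1 :=
      (continuous_fst.tendsto (t, y)).eventually (Ioi_mem_nhds hlt)
    filter_upwards [this] with z hz hzt
    have hz0 : z.1 < 0 := hzt.trans_lt ht0
    have h3 : Q z ≤ Q (t, y) := hmax ⟨⟨hz.le, hzt.trans ht.2⟩, Set.mem_univ _⟩
    rw [hQt] at h3
    have h4 : tracelessNormSq F z.1 z.2 / pinchingWeight F (b * K) z.1 z.2
        ≤ lam * Real.exp (-ε * (z.1 - t)) := by
      have e1 : Real.exp (-ε * (z.1 - t)) = Real.exp (ε * (t - t₁)) / Real.exp (ε * (z.1 - t₁)) := by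
        rw [← Real.exp_sub]; congr 1; ring
      rw [e1, ← mul_div_assoc, le_div_iff₀ (Real.exp_pos _), mul_comm, mul_comm lam]
      exact h3
    exact (div_le_iff₀ (hW z.1 hz0 z.2)).1 h4
  have h5 : Q (t₂, x) ≤ 1 := (hmax ⟨⟨h12.le, le_rfl⟩, Set.mem_univ _⟩).trans hQ1
  rw [← div_le_iff₀ (hW t₂ h2 x), Real.exp_neg, ← one_div, le_div_iff₀ (Real.exp_pos _), mul_comm]
  exact h5

/-- A pinched ancient solution is totally umbilic. -/
theorem IsAncientSolution.tracelessNormSq_eq_zero (hF : IsAncientSolution R F) (hR : 0 < R)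
    (hn : 2 ≤ n) (hH : ∀ t < 0, ∀ x, 0 < ‖meanCurv (F t) x‖) {b : ℝ} (hb : 0 ≤ b)
    (hbn : 2 * b < n)
    (hpinch : ∀ t < 0, ∀ x, tracelessNormSq F t x ≤ pinchingWeight F (b * (R ^ 2)⁻¹) t x)
    {t : ℝ} (ht : t < 0) (x : M) : tracelessNormSq F t x = 0 := by
  have hε : 0 < (n - 2 * b) * (R ^ 2)⁻¹ := mul_pos (by linarith) (by positivity)
  obtain ⟨c⟩ := hF.exists_graphChart ht x
  refine le_antisymm ?_ (c.tracelessNormSq_nonneg hF ht hR (by omega))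
  -- The weight is taken at the final time t, and only the starting time t - u recedes; no bound on
  -- the curvature in the past is needed.
  have hlim : Tendsto (fun u : ℝ => Real.exp (-((n - 2 * b) * (R ^ 2)⁻¹ * u))
      * pinchingWeight F (b * (R ^ 2)⁻¹) t x) atTop (𝓝 0) := by
    have := (Real.tendsto_exp_neg_atTop_nhds_zero.comp (tendsto_id.const_mul_atTop hε)).mul_const
      (pinchingWeight F (b * (R ^ 2)⁻¹) t x)
    rw [zero_mul] at this
    exact this
  refine ge_of_tendsto hlim ?_
  filter_upwards [eventually_gt_atTop 0] with u hu
  have := hF.pinching_decay hR hn hH hb hbn hpinch (show t - u < t by linarith) ht x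
  rwa [sub_sub_cancel] at this

end MaximumPrinciple

end SphereMCF

end

/-! ### The equality case φ = 0, and maps with vanishing derivative. -/

noncomputable section

namespace SphereMCF

set_option linter.unusedSimpArgs false

open Matrix Finset Filter Topology smoothGerm

section Umbilic

variable {n : ℕ} {V : Type*} [NormedAddCommGroup V] [InnerProductSpace ℝ V] {v : Fin n → V}

-- The inverse Gram matrix is positive semidefinite, so it factors as BᵀB, and J = Bᵀ works.
open scoped MatrixOrder Matrix.Norms.L2Operator in
theorem exists_orthonormal_frame (hd : IsUnit (gramM v).det) :
    ∃ J : Matrix (Fin n) (Fin n) ℝ, IsUnit J ∧ Jᵀ * gramM v * J = 1 := by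
  have hps : (gramM v).PosSemidef := posSemidef_gram (𝕜 := ℝ) v
  obtain ⟨B, hB⟩ := CStarAlgebra.nonneg_iff_eq_star_mul_self.1 hps.inv.nonneg
  rw [Matrix.star_eq_conjTranspose, Matrix.conjTranspose_eq_transpose_of_trivial] at hB
  have hBu : IsUnit B.det := by
    have h1 : IsUnit (gramM v)⁻¹.det := by rwa [Matrix.isUnit_nonsing_inv_det_iff]
    rw [hB, Matrix.det_mul] at h1
    exact isUnit_of_mul_isUnit_right h1
  have hBu' : IsUnit B := (Matrix.isUnit_iff_isUnit_det B).2 hBu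
  refine ⟨Bᵀ, (Matrix.isUnit_iff_isUnit_det _).2 (by rwa [Matrix.det_transpose]), ?_⟩
  rw [Matrix.transpose_transpose]
  refine hBu'.mul_right_cancel ?_
  have h2 : gramM v * (Bᵀ * B) = 1 := by rw [← hB, Matrix.mul_nonsing_inv _ hd]
  rw [one_mul, Matrix.mul_assoc, Matrix.mul_assoc, h2, Matrix.mul_one]

/-- A symmetric form with vanishing traceless part is a multiple of the metric. -/
theorem eq_gramM_smul_traceG (hd : IsUnit (gramM v).det) (hn : n ≠ 0) {h : Fin n → Fin n → V}
    (h0 : normSqG v h = (n : ℝ)⁻¹ * inner ℝ (traceG v h) (traceG v h)) (i j : Fin n) :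
    h i j = ((n : ℝ)⁻¹ * gramM v i j) • traceG v h := by
  obtain ⟨J, hJ, hJg⟩ := exists_orthonormal_frame hd
  have hn' : (n : ℝ) ≠ 0 := by exact_mod_cast hn
  set v' : Fin n → V := fun i => ∑ a, J a i • v a with hv'
  have hv : ∀ i, v' i = ∑ a, J a i • v a := fun i => rfl
  have hg' : gramM v' = 1 := (gramM_congruence hv).trans hJg
  have hd' : IsUnit (gramM v').det := by rw [hg', Matrix.det_one]; exact isUnit_one
  set h' : Fin n → Fin n → V := fun i j => ∑ a, ∑ b, (J a i * J b j) • h a b with hh'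
  have hh : ∀ i j, h' i j = ∑ a, ∑ b, (J a i * J b j) • h a b := fun i j => rfl
  set τ := traceG v h with hτ
  have e1 : ∑ i, h' i i = τ := by
    rw [hτ, ← traceG_congruence hv hd' hh, traceG, hg']
    simp [Matrix.one_apply, ite_smul]
  have e2 : ∑ i, ∑ j, inner ℝ (h' i j) (h' i j) = (n : ℝ)⁻¹ * inner ℝ τ τ := by
    rw [← h0, ← normSqG_congruence hv hd' hh, normSqG, hg']
    simp [Matrix.one_apply, ite_smul]
  -- In an orthonormal frame |h - (H/n) g|² = |h|² - |H|²/n, which is zero by hypothesis.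
  have e3 : ∑ i, ∑ j, ‖h' i j - (if i = j then (n : ℝ)⁻¹ else 0) • τ‖ ^ 2 = 0 := by
    have : ∀ i j, ‖h' i j - (if i = j then (n : ℝ)⁻¹ else 0) • τ‖ ^ 2
        = inner ℝ (h' i j) (h' i j) + (if i = j then
          (n : ℝ)⁻¹ ^ 2 * inner ℝ τ τ - 2 * ((n : ℝ)⁻¹ * inner ℝ (h' i j) τ) else 0) := by
      intro i j
      rw [norm_sub_sq_real, real_inner_self_eq_norm_sq, real_inner_self_eq_norm_sq, norm_smul,
        inner_smul_right, mul_pow, Real.norm_eq_abs, sq_abs]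
      split_ifs <;> ring
    simp only [this, sum_add_distrib, e2, sum_ite_eq, mem_univ, if_true, sum_sub_distrib,
      ← mul_sum, ← sum_inner, e1, sum_const, card_univ, Fintype.card_fin, 
      ← Nat.cast_smul_eq_nsmul ℝ, inner_smul_left, RCLike.conj_to_real, smul_eq_mul]
    field_simp
    ring
  have e4 : ∀ i j, h' i j = (if i = j then (n : ℝ)⁻¹ else 0) • τ := by
    intro i j
    have h1 := (sum_eq_zero_iff_of_nonneg fun i _ => sum_nonneg fun j _ => sq_nonneg _).1 e3 i
      (mem_univ _)
    have h2 := (sum_eq_zero_iff_of_nonneg fun j _ => sq_nonneg _).1 h1 j (mem_univ _)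
    exact sub_eq_zero.1 (norm_eq_zero.1 (pow_eq_zero_iff two_ne_zero |>.1 h2))
  -- Pairing with an arbitrary w turns the vector valued form into a matrix, so that J can be
  -- cancelled on both sides.
  refine ext_inner_right ℝ fun w => ?_
  set X : Matrix (Fin n) (Fin n) ℝ := Matrix.of fun i j => inner ℝ (h i j) w with hX
  set r : ℝ := (n : ℝ)⁻¹ * inner ℝ τ w with hr
  have e5 : Jᵀ * X * J = r • (1 : Matrix (Fin n) (Fin n) ℝ) := by
    ext i j
    have h1 := congrArg (fun u => (inner ℝ u w : ℝ)) ((hh i j).symm.trans (e4 i j))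
    simp only [sum_inner, inner_smul_left, RCLike.conj_to_real] at h1
    rw [Matrix.mul_apply, Matrix.smul_apply, Matrix.one_apply, smul_eq_mul]
    simp only [Matrix.mul_apply, Matrix.transpose_apply, sum_mul]
    rw [sum_comm]
    calc _ = ∑ a, ∑ b, J a i * J b j * inner ℝ (h a b) w :=
          sum_congr rfl fun a _ => sum_congr rfl fun b _ => by simp only [hX, Matrix.of_apply]; ring
      _ = _ := by rw [h1, hr]; split_ifs <;> ring
  have e6 : X = r • gramM v := by
    have hJT : IsUnit Jᵀ := by
      rw [Matrix.isUnit_iff_isUnit_det, Matrix.det_transpose, ← Matrix.isUnit_iff_isUnit_det]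
      exact hJ
    refine hJT.mul_left_cancel (hJ.mul_right_cancel ?_)
    rw [e5, Matrix.mul_smul, Matrix.smul_mul, hJg]
  have := congrFun (congrFun e6 i) j
  rw [inner_smul_left, RCLike.conj_to_real]
  simp only [hX, Matrix.of_apply, Matrix.smul_apply, smul_eq_mul] at this
  rw [this, hr]; ring

end Umbilic

section ZeroDerivative

variable {n : ℕ} {M : Type*} [TopologicalSpace M] [ChartedSpace (EuclideanSpace ℝ (Fin n)) M]
  [IsManifold (𝓡 n) ∞ M] {W : Type*} [NormedAddCommGroup W] [NormedSpace ℝ W]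

/-- A map with vanishing derivative on a connected manifold is constant. -/
theorem eq_of_hasMFDerivAt_zero [PreconnectedSpace M] {Q : M → W}
    (h : ∀ x, HasMFDerivAt (𝓡 n) 𝓘(ℝ, W) Q x 0) (x x' : M) : Q x = Q x' := by
  have hloc : IsLocallyConstant Q := by
    refine (IsLocallyConstant.iff_eventually_eq Q).2 fun x => ?_
    set E := extChartAt (𝓡 n) x with hE
    obtain ⟨ε, hε, hball⟩ := Metric.isOpen_iff.1 (isOpen_extChartAt_target (I := 𝓡 n) x) _
      (mem_extChartAt_target (I := 𝓡 n) x)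
    have hder : ∀ y ∈ Metric.ball (E x) ε, HasFDerivAt (fun y => Q (E.symm y))
        (0 : EuclideanSpace ℝ (Fin n) →L[ℝ] W) y := by
      intro y hy
      have h1 : ContMDiffAt 𝓘(ℝ, EuclideanSpace ℝ (Fin n)) (𝓡 n) ∞ E.symm y :=
        contMDiffAt_extChartAt_symm_comp le_rfl x contDiffAt_id (hball hy)
      have h2 := HasMFDerivAt.comp y (h (E.symm y)) (h1.mdifferentiableAt (by simp)).hasMFDerivAt
      rw [ContinuousLinearMap.zero_comp] at h2
      exact hasMFDerivAt_iff_hasFDerivAt.1 h2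
    filter_upwards [extChartAt_source_mem_nhds (I := 𝓡 n) x,
      (continuousAt_extChartAt (I := 𝓡 n) x).eventually (Metric.ball_mem_nhds _ hε)] with y hy hy'
    have := Metric.isOpen_ball.is_const_of_fderiv_eq_zero (convex_ball (E x) ε).isPreconnected
      (fun z hz => (hder z hz).differentiableAt.differentiableWithinAt)
      (fun z hz => (hder z hz).fderiv) hy' (Metric.mem_ball_self hε)
    simp only [hE] at this
    rwa [(extChartAt (𝓡 n) x).left_inv hy, extChartAt_to_inv] at this
  exact hloc.apply_eq_of_preconnectedSpace x x'

omit [IsManifold (𝓡 n) ∞ M] in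
theorem GraphChart.hasMFDerivAt_zero {k : ℕ} {F : ℝ → M → Ambient n k} {t₀ : ℝ} {x₀ : M}
    (c : GraphChart F t₀ x₀) {Q : M → W} {P : Param n → W} (hP : ContDiffAt ℝ ∞ P (t₀, 0))
    (hQ : ∀ᶠ y in 𝓝 0, Q (c.χ y) = P (t₀, y)) (h0 : ∀ i, coordVec P (t₀, 0) i = 0) :
    HasMFDerivAt (𝓡 n) 𝓘(ℝ, W) Q x₀ 0 := by
  have hPd : DifferentiableAt ℝ P (t₀, 0) := hP.differentiableAt (by simp)
  have h1 : HasFDerivAt (fun y => P (t₀, y)) (0 : EuclideanSpace ℝ (Fin n) →L[ℝ] W) 0 := by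
    have hd : DifferentiableAt ℝ (fun y => P (t₀, y)) (0 : EuclideanSpace ℝ (Fin n)) :=
      hPd.comp 0 (by fun_prop)
    have : fderiv ℝ (fun y => P (t₀, y)) (0 : EuclideanSpace ℝ (Fin n)) = 0 := by
      ext u
      rw [clm_apply_eq_sum]
      refine sum_eq_zero fun i _ => ?_
      rw [← coordVec_eq_slice hPd, h0, smul_zero]
    rw [← this]
    exact hd.hasFDerivAt
  have h2 : HasMFDerivAt 𝓘(ℝ, EuclideanSpace ℝ (Fin n)) 𝓘(ℝ, W) (fun y => P (t₀, y)) (c.η x₀)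
      (0 : EuclideanSpace ℝ (Fin n) →L[ℝ] W) := by
    rw [c.η_base]; exact h1.hasMFDerivAt
  have h3 := HasMFDerivAt.comp x₀ h2 (c.smooth_η.mdifferentiableAt (by simp)).hasMFDerivAt
  have h3' : HasMFDerivAt (𝓡 n) 𝓘(ℝ, W) ((fun y => P (t₀, y)) ∘ c.η) x₀ 0 := h3
  refine h3'.congr_of_eventuallyEq ?_
  have h4 := c.smooth_η.continuousAt.eventually (p := fun y => Q (c.χ y) = P (t₀, y))
    (by rwa [c.η_base])
  filter_upwards [h4, c.χ_η] with x h4 h5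
  rw [Function.comp_apply, ← h4, h5]

end ZeroDerivative

end SphereMCF

end

/-! ### Quantities that are constant on a time slice of an umbilic flow. -/

noncomputable section

namespace SphereMCF

set_option linter.unusedSimpArgs false

open Matrix Finset Filter Topology smoothGerm

/-- For a sphere with centre q and squared radius 1/σ, this is |∇⟨f,w⟩|² + σ⟨f - q, w⟩². Its
derivative in direction k is 2⟨r k, w⟩ times ⟨h/n + σ(f - q), w⟩, which is zero. It vanishes for
exactly those w that are orthogonal to f - q and to the tangent space, so its constancy shows that
the span of these does not move. -/
theorem ImmersionJet.IsGraph.ev_D_gradNormSq {n N : ℕ} {A : Type*} [CommRing A]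
    {L : ImmersionJet n N A} (hL : L.IsGraph)
    (ha : ∀ i j, L.a i j = if i = j then (n : ℝ)⁻¹ • L.h else 0) {w q : Fin N → A} {σ : A}
    (k : Fin n) (hw : ∀ α, L.D k (w α) = 0) (hq : ∀ α, L.D k (q α) = 0) (hσ : L.D k σ = 0)
    (hh : (n : ℝ)⁻¹ • L.h = -(L.ev σ) • L.evv (L.f - q)) :
    L.ev (L.D k (∑ i, ∑ j, L.G i j * ((L.f1 i ⬝ᵥ w) * (L.f1 j ⬝ᵥ w))
      + σ * (((L.f - q) ⬝ᵥ w) * ((L.f - q) ⬝ᵥ w)))) = 0 := by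
  have hdw : dv (L.D k) w = 0 := funext hw
  have hdf : dv (L.D k) (L.f - q) = L.f1 k := by
    funext α; simp [dv, hq, f1]
  have hf1 : ∀ i, dv (L.D k) (L.f1 i) = L.f2 k i := fun i => rfl
  have hr : ∀ i, L.evv (L.f1 i) = L.r i := fun i => rfl
  have haa : ∀ i, L.evv (L.f2 k i) = L.a k i := fun i => rfl
  simp only [map_add, map_sum, Derivation.leibniz, smul_eq_mul, map_mul, derivation_dotProduct, hdw,
    hdf, hf1, hσ, hL.ev_G, hL.ev_D_G, dotProduct_zero, add_zero, map_zero, mul_zero, ev_dotProduct,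
    hr, haa, ite_mul, one_mul, zero_mul, sum_ite_eq, mem_univ, if_true, sum_add_distrib]
  have e1 : ∀ i, L.r i ⬝ᵥ L.evv w * (L.a k i ⬝ᵥ L.evv w)
      = if k = i then (-(L.ev σ) • L.evv (L.f - q)) ⬝ᵥ L.evv w * (L.r k ⬝ᵥ L.evv w) else 0 := by
    intro i
    rw [ha]
    split_ifs with h
    · rw [hh, h]; ring
    · simp
  simp only [e1, sum_ite_eq, mem_univ, if_true, smul_dotProduct, smul_eq_mul,
    sum_const_zero]
  ring

section Slice

variable {n k : ℕ} {M : Type*} [TopologicalSpace M] [ChartedSpace (EuclideanSpace ℝ (Fin n)) M]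
  {R : ℝ} {F : ℝ → M → Ambient n k} {t₀ : ℝ} {x₀ : M}

/-- The squared norm of the gradient of the height function in the direction `w`. -/
def gradNormSq (f : M → Ambient n k) (w : Ambient n k) (x : M) : ℝ :=
  traceG (tangentVec f x) fun i j => inner ℝ (tangentVec f x i) w * inner ℝ (tangentVec f x j) w

namespace GraphChart

variable (c : GraphChart F t₀ x₀) (hF : IsAncientSolution R F) (ht₀ : t₀ < 0)

include hF ht₀ in
theorem inner_base_e (i : Fin n) : inner ℝ (F t₀ x₀) (c.e i) = 0 := by
  have := (c.eventually_inner_coordVec hF ht₀).self_of_nhds i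
  rw [c.param_base] at this
  rw [← c.coordVec_base]
  exact this

variable [IsManifold (𝓡 n) ∞ M]

include hF ht₀ in
theorem eventually_gradNormSq (w : Ambient n k) : ∀ᶠ z in 𝓝 (t₀, 0),
    gradNormSq (F z.1) w (c.χ z.2) = traceG (coordVec c.param z) fun i j =>
      inner ℝ (coordVec c.param z i) w * inner ℝ (coordVec c.param z j) w := by
  filter_upwards [eventually_neg ht₀, c.eventually_contMDiffAt,
    eventually_isUnit_det (c.contDiffAt_param hF ht₀) c.isUnit_det_base] with z h1 h2 h3
  obtain ⟨J, Q, hv, -⟩ := hF.exists_coordVec_eq (t := z.1) (y := z.2) h1 h2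
  refine (traceG_congruence hv h3 fun i j => ?_).symm
  change inner ℝ (coordVec (fun z : Param n => F z.1 (c.χ z.2)) (z.1, z.2) i) w
    * inner ℝ (coordVec (fun z : Param n => F z.1 (c.χ z.2)) (z.1, z.2) j) w = _
  rw [hv i, hv j, sum_inner, sum_inner, sum_mul_sum]
  refine sum_congr rfl fun a _ => sum_congr rfl fun b _ => ?_
  rw [real_inner_smul_left, real_inner_smul_left, smul_eq_mul]
  ring

include hF ht₀ in
theorem gradNormSq_base (w : Ambient n k) :
    gradNormSq (F t₀) w x₀ = ∑ i, inner ℝ (c.e i) w ^ 2 := by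
  have := (c.eventually_gradNormSq hF ht₀ w).self_of_nhds
  simp only [c.χ_zero] at this
  rw [this, traceG, c.gramM_base]
  have he : ∀ i, coordVec c.param (t₀, 0) i = c.e i := c.coordVec_base
  simp [Matrix.one_apply, he, sq]

variable (hR : 0 < R)
include hF ht₀ hR

theorem inner_meanCurv_e (i : Fin n) : inner ℝ (meanCurv (F t₀) x₀) (c.e i) = 0 := by
  have h1 := (c.eventually_curvature hF ht₀ hR).self_of_nhds.1
  simp only [c.χ_zero] at h1
  have he : coordVec c.param (t₀, 0) i = c.e i := c.coordVec_base i
  rw [h1, inner_add_left, real_inner_smul_left, c.param_base, c.inner_base_e hF ht₀, mul_zero,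
    add_zero, real_inner_comm, traceG, ← he]
  simp only [inner_sum, real_inner_smul_right, inner_normalPart c.isUnit_det_base, mul_zero,
    sum_const_zero]

theorem jet_h : (c.jet hF ht₀).h
    = (meanCurv (F t₀) x₀ - (n * (R ^ 2)⁻¹) • F t₀ x₀).ofLp := by
  rw [← (c.jet_isGraph hF ht₀).evv_Hv]
  funext α
  refine (rep_localJet_Hv α).ev.trans ?_
  have h1 := (c.eventually_curvature hF ht₀ hR).self_of_nhds.1
  simp only [c.χ_zero, c.param_base] at h1
  rw [h1]
  simp

theorem jet_h_dot_h : (c.jet hF ht₀).h ⬝ᵥ (c.jet hF ht₀).h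
    = ‖meanCurv (F t₀) x₀‖ ^ 2 + n ^ 2 * (R ^ 2)⁻¹ := by
  rw [← (c.jet_isGraph hF ht₀).ev_B]
  have h1 := (c.eventually_curvature hF ht₀ hR).self_of_nhds.2.1
  simp only [c.χ_zero] at h1
  rw [h1, sub_add_cancel]
  exact rep_localJet_B.ev

theorem jet_umbilic (hn : n ≠ 0) (hum : ∀ t < 0, ∀ x, tracelessNormSq F t x = 0) (i j : Fin n)
    (α : Fin (n + k + 1)) : (c.jet hF ht₀).nn i j α
      = smoothGerm.const _ (n : ℝ)⁻¹ * (c.jet hF ht₀).g i j * (c.jet hF ht₀).Hv α := by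
  refine (rep_localJet_nn i j α).eq
    (((rep_const _).mul (rep_localJet_g i j)).mul (rep_localJet_Hv α)) ?_
  filter_upwards [eventually_neg ht₀, c.eventually_tracelessNormSq hF ht₀ hR hn,
    eventually_isUnit_det (c.contDiffAt_param hF ht₀) c.isUnit_det_base] with z h1 h2 h3
  rw [hum z.1 h1] at h2
  rw [eq_gramM_smul_traceG h3 hn (sub_eq_zero.1 h2.symm) i j]
  simp

theorem rep_meanCurv (α : Fin (n + k + 1)) :
    Rep ((c.jet hF ht₀).Hv α
      + smoothGerm.const _ (n * (R ^ 2)⁻¹) * (c.jet hF ht₀).f α)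
      fun z => meanCurv (F z.1) (c.χ z.2) α := by
  refine ((rep_localJet_Hv α).add ((rep_const _).mul (c.rep_jet_f hF ht₀ α))).congr ?_
  filter_upwards [c.eventually_curvature hF ht₀ hR] with z hz
  rw [hz.1]
  simp

theorem contDiffAt_meanCurv :
    ContDiffAt ℝ ∞ (fun z : Param n => meanCurv (F z.1) (c.χ z.2)) (t₀, 0) :=
  contDiffAt_euclidean.2 fun α => (c.rep_meanCurv hF ht₀ hR α).contDiffAt

/-- The Euclidean mean curvature vector has derivative -((s + n²K)/n) e_i with s = |H|², and the
correction nK F contributes nK e_i. -/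
theorem coordVec_meanCurv (hn : 2 ≤ n) (hum : ∀ t < 0, ∀ x, tracelessNormSq F t x = 0)
    (i : Fin n) : coordVec (fun z : Param n => meanCurv (F z.1) (c.χ z.2)) (t₀, 0) i
      = -(‖meanCurv (F t₀) x₀‖ ^ 2 / n) • c.e i := by
  have hn0 : n ≠ 0 := by omega
  have hn' : (n : ℝ) ≠ 0 := by exact_mod_cast hn0
  ext α
  have h1 := (((c.rep_meanCurv hF ht₀ hR α).d (eDir i)).congr
    (eventually_fderiv_coord (c.contDiffAt_meanCurv hF ht₀ hR) α (eDir i))).ev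
  change _ = (coordVec (fun z : Param n => meanCurv (F z.1) (c.χ z.2)) (t₀, 0) i).ofLp α at h1
  rw [← h1]
  have h2 := congrFun ((c.jet_isGraph hF ht₀).evv_D_Hv_of_umbilic hn (rep_const _).ev
    (fun i => d_const _ _) (c.jet_umbilic hF ht₀ hR hn0 hum) i) α
  have h3 : (c.jet hF ht₀).ev ((c.jet hF ht₀).D i ((c.jet hF ht₀).f α)) = c.e i α :=
    congrFun (c.jet_r hF ht₀ i) α
  have h4 : (c.jet hF ht₀).D i (smoothGerm.const _ (n * (R ^ 2)⁻¹)) = 0 := d_const _ _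
  have h5 : (c.jet hF ht₀).ev (smoothGerm.const _ (n * (R ^ 2)⁻¹)) = n * (R ^ 2)⁻¹ :=
    (rep_const _).ev
  change (c.jet hF ht₀).ev ((c.jet hF ht₀).D i _) = _
  rw [map_add, map_add, Derivation.leibniz, h4, smul_zero, add_zero, smul_eq_mul, map_mul, h3, h5]
  change (c.jet hF ht₀).ev ((c.jet hF ht₀).D i ((c.jet hF ht₀).Hv α)) = _ at h2
  rw [h2, c.jet_h_dot_h hF ht₀ hR, c.jet_r]
  simp only [Pi.smul_apply, PiLp.smul_apply, smul_eq_mul]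
  field_simp
  ring

end GraphChart

variable [IsManifold (𝓡 n) ∞ M] [PreconnectedSpace M]
  (hF : IsAncientSolution R F) (hR : 0 < R) (hn : 2 ≤ n)
  (hum : ∀ t < 0, ∀ x, tracelessNormSq F t x = 0) {t : ℝ} (ht : t < 0)
include hF hR hn hum ht

/-- The derivative of H is tangential while H is normal, so the derivative of |H|² vanishes. -/
theorem norm_meanCurv_eq (x x' : M) : ‖meanCurv (F t) x‖ ^ 2 = ‖meanCurv (F t) x'‖ ^ 2 := by
  refine eq_of_hasMFDerivAt_zero (n := n) (Q := fun x => ‖meanCurv (F t) x‖ ^ 2) (fun x => ?_) x x'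
  obtain ⟨c⟩ := hF.exists_graphChart ht x
  have hs := c.contDiffAt_meanCurv hF ht hR
  refine c.hasMFDerivAt_zero (P := fun z => ‖meanCurv (F z.1) (c.χ z.2)‖ ^ 2) (hs.norm_sq ℝ)
    (Eventually.of_forall fun y => rfl) fun i => ?_
  have hd := hs.differentiableAt (by simp)
  have h1 : coordVec (fun z => ‖meanCurv (F z.1) (c.χ z.2)‖ ^ 2) (t, 0) i
      = 2 * inner ℝ (meanCurv (F t) (c.χ 0))
        (coordVec (fun z : Param n => meanCurv (F z.1) (c.χ z.2)) (t, 0) i) := by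
    rw [coordVec, (hd.hasFDerivAt.norm_sq).fderiv]
    simp [coordVec]
  rw [h1, c.coordVec_meanCurv hF ht hR hn hum, c.χ_zero, inner_smul_right,
    c.inner_meanCurv_e hF ht hR]
  simp

theorem meanCurv_add_smul_eq {s : ℝ} (hs : ∀ x, ‖meanCurv (F t) x‖ ^ 2 = s) (x x' : M) :
    meanCurv (F t) x + (s / n) • F t x = meanCurv (F t) x' + (s / n) • F t x' := by
  refine eq_of_hasMFDerivAt_zero (n := n) (Q := fun x => meanCurv (F t) x + (s / n) • F t x)
    (fun x => ?_) x x'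
  obtain ⟨c⟩ := hF.exists_graphChart ht x
  have h1 := c.contDiffAt_meanCurv hF ht hR
  have h2 := c.contDiffAt_param hF ht
  refine c.hasMFDerivAt_zero
    (P := fun z => meanCurv (F z.1) (c.χ z.2) + (s / n) • c.param z) (h1.add (h2.const_smul _))
    (Eventually.of_forall fun y => rfl) fun i => ?_
  have h3 := (h1.differentiableAt (by simp)).hasFDerivAt.add
    ((h2.differentiableAt (by simp)).hasFDerivAt.const_smul (s / n))
  have h4 := c.coordVec_meanCurv hF ht hR hn hum i
  have h5 : coordVec c.param (t, 0) i = c.e i := c.coordVec_base i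
  rw [coordVec] at h4 h5 ⊢
  have h6 := congrArg (fun T => T (eDir i)) h3.fderiv
  refine h6.trans ?_
  simp only [_root_.add_apply, _root_.smul_apply, h4, h5, hs]
  rw [← add_smul, neg_add_cancel, zero_smul]

theorem gradNormSq_add_eq {s : ℝ} {q : Ambient n k}
    (hq : ∀ x, meanCurv (F t) x = (n * (R ^ 2)⁻¹) • q - (s / n) • (F t x - q)) (w : Ambient n k)
    (x x' : M) : gradNormSq (F t) w x + (s / n ^ 2 + (R ^ 2)⁻¹) * inner ℝ (F t x - q) w ^ 2
      = gradNormSq (F t) w x' + (s / n ^ 2 + (R ^ 2)⁻¹) * inner ℝ (F t x' - q) w ^ 2 := by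
  have hn0 : n ≠ 0 := by omega
  have hn' : (n : ℝ) ≠ 0 := by exact_mod_cast hn0
  set σ := s / n ^ 2 + (R ^ 2)⁻¹ with hσ
  refine eq_of_hasMFDerivAt_zero (n := n)
    (Q := fun x => gradNormSq (F t) w x + σ * inner ℝ (F t x - q) w ^ 2) (fun x => ?_) x x'
  obtain ⟨c⟩ := hF.exists_graphChart ht x
  set L := c.jet hF ht with hL
  set P : Param n → ℝ := fun z => (traceG (coordVec c.param z) fun i j =>
      inner ℝ (coordVec c.param z i) w * inner ℝ (coordVec c.param z j) w)
    + σ * (inner ℝ (c.param z - q) w * inner ℝ (c.param z - q) w) with hP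
  let wg : Fin (n + k + 1) → smoothGerm ((t, 0) : Param n) := fun α => smoothGerm.const _ (w α)
  let qg : Fin (n + k + 1) → smoothGerm ((t, 0) : Param n) := fun α => smoothGerm.const _ (q α)
  have hfw : ∀ i, Rep (L.f1 i ⬝ᵥ wg) fun z => inner ℝ (coordVec c.param z i) w := fun i =>
    Rep.dotProduct (v' := fun _ => w) (rep_localJet_f1 i) fun α => rep_const _
  have hqw : Rep ((L.f - qg) ⬝ᵥ wg) fun z => inner ℝ (c.param z - q) w :=
    Rep.dotProduct (u' := fun z => c.param z - q) (v' := fun _ => w)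
      (fun α => (c.rep_jet_f hF ht α).sub (rep_const _)) fun α => rep_const _
  have hrep : Rep (∑ i, ∑ j, L.G i j * ((L.f1 i ⬝ᵥ wg) * (L.f1 j ⬝ᵥ wg))
      + smoothGerm.const _ σ * (((L.f - qg) ⬝ᵥ wg) * ((L.f - qg) ⬝ᵥ wg))) P :=
    (Rep.sum fun i => Rep.sum fun j => (rep_localJet_G i j).mul ((hfw i).mul (hfw j))).add
      ((rep_const _).mul (hqw.mul hqw))
  refine c.hasMFDerivAt_zero hrep.contDiffAt ?_ fun i => ?_
  · filter_upwards [tendsto_slice.eventually (c.eventually_gradNormSq hF ht w)] with y hy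
    rw [hP, hy, sq]
    rfl
  · have h1 := (hrep.d (eDir i)).ev
    change _ = coordVec P (t, 0) i at h1
    rw [← h1]
    have hG := c.jet_isGraph hF ht
    refine hG.ev_D_gradNormSq (hG.a_of_umbilic (rep_const _).ev (c.jet_umbilic hF ht hR hn0 hum)) i
      (fun α => d_const _ _) (fun α => d_const _ _) (d_const _ _) ?_
    have h2 : (c.jet hF ht).ev (smoothGerm.const _ σ) = σ := (rep_const _).ev
    have h3 : (c.jet hF ht).evv ((c.jet hF ht).f - qg) = (F t x - q).ofLp := by
      funext α
      refine ((c.rep_jet_f hF ht α).sub (rep_const _)).ev.trans ?_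
      rw [c.param_base]; rfl
    rw [h2, h3, c.jet_h hF ht hR, hq x]
    funext α
    simp only [Pi.smul_apply, PiLp.sub_apply, PiLp.smul_apply, smul_eq_mul, hσ]
    field_simp
    ring

end Slice

end SphereMCF

end

/-! ### A time slice is a full round sphere. -/

noncomputable section

namespace SphereMCF

set_option linter.unusedSimpArgs false

open Matrix Finset Filter Topology smoothGerm

section LinearAlgebra

variable {V : Type*} [NormedAddCommGroup V] [InnerProductSpace ℝ V] {n : ℕ} {e : Fin n → V} {m : V}

/-- The span of a vector and a frame. -/
def frameSpan (m : V) (e : Fin n → V) : Submodule ℝ V :=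
  Submodule.span ℝ (Set.range fun o : Option (Fin n) => o.elim m e)

theorem mem_frameSpan_self : m ∈ frameSpan m e := Submodule.subset_span ⟨none, rfl⟩

theorem mem_frameSpan_frame (i : Fin n) : e i ∈ frameSpan m e := Submodule.subset_span ⟨some i, rfl⟩

theorem mem_frameSpan_orthogonal {w : V} :
    w ∈ (frameSpan m e)ᗮ ↔ inner ℝ m w = 0 ∧ ∀ i, inner ℝ (e i) w = 0 := by
  rw [frameSpan, Submodule.mem_orthogonal]
  constructor
  · intro h
    exact ⟨h _ mem_frameSpan_self, fun i => h _ (mem_frameSpan_frame i)⟩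
  · rintro ⟨h1, h2⟩ u hu
    induction hu using Submodule.span_induction with
    | mem x hx =>
      obtain ⟨o, rfl⟩ := hx
      cases o with
      | none => exact h1
      | some i => exact h2 i
    | zero => simp
    | add x y _ _ hx hy => rw [inner_add_left, hx, hy, add_zero]
    | smul a x _ hx => rw [inner_smul_left, hx, mul_zero]

theorem finrank_frameSpan (he : Orthonormal ℝ e) (hm : m ≠ 0) (hme : ∀ i, inner ℝ m (e i) = 0) :
    Module.finrank ℝ (frameSpan m e) = n + 1 := by
  have hli : LinearIndependent ℝ (fun o : Option (Fin n) => o.elim m e) := by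
    refine linearIndependent_of_ne_zero_of_inner_eq_zero ?_ ?_
    · rintro (_ | i)
      · exact hm
      · exact he.ne_zero i
    · rintro (_ | i) (_ | j) hij
      · exact absurd rfl hij
      · exact hme j
      · rw [real_inner_comm]; exact hme i
      · exact he.2 fun h => hij (congrArg some h)
  rw [frameSpan, finrank_span_eq_card hli]
  simp

/-- Two vectors of the same length in the same open half of the span with the same frame components
agree. -/
theorem eq_of_mem_frameSpan (hm : m ≠ 0) (hme : ∀ i, inner ℝ m (e i) = 0)
    {u u' : V} (hu : u ∈ frameSpan m e) (hu' : u' ∈ frameSpan m e) (hn : ‖u‖ = ‖u'‖)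
    (hi : ∀ i, inner ℝ (e i) u = inner ℝ (e i) u') (hp : 0 < inner ℝ m u)
    (hp' : 0 < inner ℝ m u') : u = u' := by
  have hmm : inner ℝ m m ≠ 0 := inner_self_ne_zero.2 hm
  set lam : ℝ := inner ℝ m (u - u') / inner ℝ m m with hlam
  have hd : u - u' = lam • m := by
    have h1 : u - u' - lam • m ∈ frameSpan m e :=
      sub_mem (sub_mem hu hu') (Submodule.smul_mem _ _ mem_frameSpan_self)
    have h2 : u - u' - lam • m ∈ (frameSpan m e)ᗮ := by
      refine mem_frameSpan_orthogonal.2 ⟨?_, fun i => ?_⟩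
      · rw [inner_sub_right, inner_smul_right, hlam, div_mul_cancel₀ _ hmm, sub_self]
      · rw [inner_sub_right, inner_smul_right, inner_sub_right, hi, real_inner_comm m (e i), hme]; simp
    have h3 := Submodule.mem_inf.2 ⟨h1, h2⟩
    rw [Submodule.inf_orthogonal_eq_bot, Submodule.mem_bot] at h3
    exact sub_eq_zero.1 h3
  have h4 : inner ℝ (u - u') (u + u') = 0 := by
    rw [inner_sub_left, inner_add_right, inner_add_right, real_inner_self_eq_norm_sq,
      real_inner_self_eq_norm_sq, hn, real_inner_comm u u']
    ring
  rw [hd, inner_smul_left, inner_add_right, RCLike.conj_to_real] at h4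
  have h5 : lam = 0 := (mul_eq_zero.1 h4).resolve_right (by linarith)
  rw [h5, zero_smul] at hd
  exact sub_eq_zero.1 hd

end LinearAlgebra

section Slice

variable {n k : ℕ} {M : Type*} [TopologicalSpace M] [ChartedSpace (EuclideanSpace ℝ (Fin n)) M]
  [IsManifold (𝓡 n) ∞ M] {R : ℝ} {F : ℝ → M → Ambient n k}

/-- A closed subset of a subsphere which contains graphs over its tangent spaces is everything. -/
theorem range_eq_subsphere [CompactSpace M] [Nonempty M] (hF : IsAncientSolution R F) (hn : 2 ≤ n)
    {t : ℝ} (ht : t < 0) {U : Submodule ℝ (Ambient n k)} {q : Ambient n k} (hq : q ∈ Uᗮ)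
    (hqR : ‖q‖ < R) (hU : Module.finrank ℝ U = n + 1) (hmem : ∀ x, F t x - q ∈ U)
    (hspan : ∀ x, ∀ c : GraphChart F t x, U = frameSpan (F t x - q) c.e) :
    Set.range (F t) = {y | y - q ∈ U ∧ ‖y‖ = R} := by
  have hpyth : ∀ u ∈ U, ‖u + q‖ ^ 2 = ‖u‖ ^ 2 + ‖q‖ ^ 2 := fun u hu => by
    have := Submodule.inner_right_of_mem_orthogonal hu hq
    rw [norm_add_sq_real, this]; ring
  have hFR : ∀ x, ‖F t x‖ = R := fun x => mem_sphere_zero_iff_norm.1 (hF.mem_sphere t ht x)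
  have hR : 0 < R := (norm_nonneg q).trans_lt hqR
  set ρ := √(R ^ 2 - ‖q‖ ^ 2) with hρ
  have hρsq : ρ ^ 2 = R ^ 2 - ‖q‖ ^ 2 := Real.sq_sqrt (by nlinarith [norm_nonneg q])
  have hρpos : 0 < ρ := Real.sqrt_pos.2 (by nlinarith [norm_nonneg q])
  have hnorm : ∀ u ∈ U, ‖u‖ = ρ ↔ ‖u + q‖ = R := fun u hu => by
    rw [← sq_eq_sq₀ (norm_nonneg u) hρpos.le, ← sq_eq_sq₀ (norm_nonneg _) hR.le, hpyth u hu, hρsq]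
    constructor <;> intro h <;> linarith
  have hmR : ∀ x, ‖F t x - q‖ = ρ := fun x => by
    rw [hnorm _ (hmem x), sub_add_cancel, hFR]
  refine Set.Subset.antisymm ?_ ?_
  · rintro _ ⟨x, rfl⟩
    exact ⟨hmem x, hFR x⟩
  have hrank : 1 < Module.rank ℝ U := by
    rw [← Module.finrank_eq_rank, hU]
    exact_mod_cast (by omega : 1 < n + 1)
  have hconn : PreconnectedSpace (Metric.sphere (0 : U) ρ) :=
    isPreconnected_iff_preconnectedSpace.1 (isPreconnected_sphere hrank 0 ρ)
  have hFc : Continuous (F t) := (hF.contMDiff_slice ht).continuous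
  set A : Set (Metric.sphere (0 : U) ρ) := {z | ((z : U) : Ambient n k) + q ∈ Set.range (F t)}
    with hA
  have hcont : Continuous fun z : Metric.sphere (0 : U) ρ => ((z : U) : Ambient n k) + q := by
    fun_prop
  have hclosed : IsClosed A := (isCompact_range hFc).isClosed.preimage hcont
  -- Near a point that is attained, each point of the sphere is compared with the graph point having
  -- the same frame coordinates. Both have length ρ and lie on the same side, so
  -- `eq_of_mem_frameSpan` identifies them. With compactness of M and connectedness of the sphere,
  -- everything is attained.
  have hopen : IsOpen A := by
    refine isOpen_iff_mem_nhds.2 ?_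
    rintro z₀ ⟨x, hx⟩
    obtain ⟨c⟩ := hF.exists_graphChart ht x
    set m₀ := F t x - q with hm₀
    have hz₀ : ((z₀ : U) : Ambient n k) = m₀ := by rw [hm₀, hx, add_sub_cancel_right]
    have hm₀ne : m₀ ≠ 0 := by
      rw [← norm_pos_iff, hmR]; exact hρpos
    have hUe := hspan x c
    have hqe : ∀ i, inner ℝ q (c.e i) = 0 := fun i => by
      refine Submodule.inner_left_of_mem_orthogonal (K := U) ?_ hq
      rw [hUe]; exact mem_frameSpan_frame i
    have hme : ∀ i, inner ℝ m₀ (c.e i) = 0 := fun i => by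
      rw [hm₀, inner_sub_left, c.inner_base_e hF ht, hqe, sub_zero]
    set y : Metric.sphere (0 : U) ρ → EuclideanSpace ℝ (Fin n) := fun z =>
      WithLp.toLp 2 fun i => inner ℝ (c.e i) (((z : U) : Ambient n k) - m₀) with hy
    have hyc : Continuous y := by
      refine (PiLp.continuous_toLp 2 _).comp (continuous_pi fun i => ?_)
      fun_prop
    have hy0 : y z₀ = 0 := by
      ext i; simp [hy, hz₀]
    have ht1 : Tendsto y (𝓝 z₀) (𝓝 0) := by rw [← hy0]; exact hyc.tendsto z₀
    have hχc : ContinuousAt (fun y => F t (c.χ y)) 0 :=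
      ContinuousAt.comp (f := c.χ) hFc.continuousAt c.smooth_χ.continuousAt
    have hpos1 : ∀ᶠ y in 𝓝 0, 0 < inner ℝ m₀ (F t (c.χ y) - q) := by
      have hc : ContinuousAt (fun y => inner ℝ m₀ (F t (c.χ y) - q)) 0 :=
        continuousAt_const.inner (𝕜 := ℝ) (hχc.sub continuousAt_const)
      refine hc.eventually (Ioi_mem_nhds ?_)
      simp only [c.χ_zero]
      exact real_inner_self_pos.2 hm₀ne
    have hpos2 : ∀ᶠ z : Metric.sphere (0 : U) ρ in 𝓝 z₀, 0 < inner ℝ m₀ ((z : U) : Ambient n k) := by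
      have hc : Continuous fun z : Metric.sphere (0 : U) ρ =>
          (inner ℝ m₀ ((z : U) : Ambient n k) : ℝ) := by fun_prop
      refine hc.continuousAt.eventually (Ioi_mem_nhds ?_)
      simp only [hz₀]
      exact real_inner_self_pos.2 hm₀ne
    filter_upwards [ht1.eventually c.graph, ht1.eventually hpos1, hpos2] with z h1 h2 h3
    refine ⟨c.χ (y z), ?_⟩
    rw [← sub_eq_iff_eq_add]
    refine eq_of_mem_frameSpan hm₀ne hme ?_ ?_ ?_ (fun i => ?_) h2 h3
    · rw [← hUe]; exact hmem _
    · rw [← hUe]; exact (z : U).2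
    · rw [hmR]
      exact (mem_sphere_zero_iff_norm.1 z.2).symm
    · have h4 : inner ℝ (c.e i) (F t (c.χ (y z)) - F t x)
          = inner ℝ (c.e i) (((z : U) : Ambient n k) - m₀) := h1 i
      rw [inner_sub_right, inner_sub_right] at h4
      have h5 : inner ℝ (c.e i) m₀ = 0 := by rw [real_inner_comm]; exact hme i
      have h6 : inner ℝ (c.e i) q = 0 := by rw [real_inner_comm]; exact hqe i
      have h7 : inner ℝ (c.e i) (F t x) = 0 := by
        rw [real_inner_comm]; exact c.inner_base_e hF ht i
      rw [h5, h7] at h4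
      rw [inner_sub_right, h6]
      linarith
  have huniv : A = Set.univ := by
    refine IsClopen.eq_univ ⟨hclosed, hopen⟩ ?_
    obtain ⟨x⟩ := ‹Nonempty M›
    exact ⟨⟨⟨F t x - q, hmem x⟩, mem_sphere_zero_iff_norm.2 (hmR x)⟩, x, by simp⟩
  rintro y ⟨hy1, hy2⟩
  have h1 : (⟨⟨y - q, hy1⟩, mem_sphere_zero_iff_norm.2
      ((hnorm _ hy1).2 (by rw [sub_add_cancel, hy2]))⟩ : Metric.sphere (0 : U) ρ) ∈ A := by
    rw [huniv]; exact Set.mem_univ _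
  simpa [hA] using h1

/-- A time slice of a totally umbilic flow is a round sphere. -/
theorem IsAncientSolution.exists_slice [CompactSpace M] [ConnectedSpace M]
    (hF : IsAncientSolution R F) (hR : 0 < R) (hn : 2 ≤ n)
    (hum : ∀ t < 0, ∀ x, tracelessNormSq F t x = 0)
    (hH : ∀ t < 0, ∀ x, 0 < ‖meanCurv (F t) x‖) {t : ℝ} (ht : t < 0) :
    ∃ (U : Submodule ℝ (Ambient n k)) (q : Ambient n k), Module.finrank ℝ U = n + 1 ∧ q ∈ Uᗮ ∧
      q ≠ 0 ∧ ‖q‖ < R ∧ (∀ x, F t x - q ∈ U) ∧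
      (∀ x x', meanCurv (F t) x
        = (n * (R ^ 2)⁻¹) • q - (‖meanCurv (F t) x'‖ ^ 2 / n) • (F t x - q)) ∧
      Set.range (F t) = {y | y - q ∈ U ∧ ‖y‖ = R} := by
  obtain ⟨x₀⟩ : Nonempty M := inferInstance
  have hn0 : (0 : ℝ) < n := by positivity
  set s := ‖meanCurv (F t) x₀‖ ^ 2 with hsdef
  have hs : ∀ x, ‖meanCurv (F t) x‖ ^ 2 = s := fun x => norm_meanCurv_eq hF hR hn hum ht x x₀
  have hspos : 0 < s := by have := hH t ht x₀; positivity
  set K := (R ^ 2)⁻¹ with hK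
  have hKpos : 0 < K := by positivity
  have hKR : K * R ^ 2 = 1 := inv_mul_cancel₀ (by positivity)
  -- Since ∂_i H = -(s/n) ∂_i F, this vector does not depend on the base point. Dividing it by a =
  -- nK + s/n gives the centre q of the sphere.
  set C := meanCurv (F t) x₀ + (s / n) • F t x₀ with hC
  have hCx : ∀ x, meanCurv (F t) x + (s / n) • F t x = C := fun x =>
    meanCurv_add_smul_eq hF hR hn hum ht hs x x₀
  set a := n * K + s / n with ha
  have hapos : 0 < a := by positivity
  set q := a⁻¹ • C with hq
  have haq : a • q = C := by rw [hq, smul_smul, mul_inv_cancel₀ hapos.ne', one_smul]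
  have hmc : ∀ x, meanCurv (F t) x = (n * K) • q - (s / n) • (F t x - q) := fun x => by
    have h1 := hCx x
    rw [← haq, ha, add_smul] at h1
    rw [smul_sub, eq_sub_of_add_eq h1]
    abel
  have hFF : ∀ x, inner ℝ (F t x) (F t x) = R ^ 2 := fun x => by
    rw [real_inner_self_eq_norm_sq, mem_sphere_zero_iff_norm.1 (hF.mem_sphere t ht x)]
  -- Differentiating |F|² = R² in time along the flow gives ⟨F, H⟩ = 0.
  have hHF : ∀ x, inner ℝ (F t x) (meanCurv (F t) x) = 0 := fun x => by
    have h1 := hF.flow t ht x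
    have h2 := h1.inner ℝ h1
    have h3 : (fun s => inner ℝ (F s x) (F s x)) =ᶠ[𝓝 t] fun _ => R ^ 2 := by
      filter_upwards [Iio_mem_nhds ht] with s hs
      rw [real_inner_self_eq_norm_sq, mem_sphere_zero_iff_norm.1 (hF.mem_sphere s hs x)]
    have h4 := h2.unique ((hasDerivAt_const t (R ^ 2)).congr_of_eventuallyEq h3)
    rw [real_inner_comm (F t x)] at h4
    rw [real_inner_comm] at h4 ⊢
    linarith
  have hFC : ∀ x, inner ℝ (F t x) C = s / n * R ^ 2 := fun x => by
    rw [← hCx x, inner_add_right, hHF, inner_smul_right, hFF, zero_add]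
  have hCC : inner ℝ C C = s / n * R ^ 2 * a := by
    have h1 : inner ℝ C C = inner ℝ (meanCurv (F t) x₀) C + s / n * inner ℝ (F t x₀) C := by
      conv_lhs => rw [hC, inner_add_left, real_inner_smul_left, ← hC]
    have h2 : inner ℝ (meanCurv (F t) x₀) C = s := by
      rw [hC, inner_add_right, inner_smul_right, real_inner_comm, real_inner_comm (F t x₀), hHF,
        real_inner_self_eq_norm_sq]
      ring
    rw [h1, h2, hFC, ha]
    have h3 : n * (s / n) = s := mul_div_cancel₀ s hn0.ne'
    linear_combination (-(K * R ^ 2)) * h3 - s * hKR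
  have hFq : ∀ x, inner ℝ (F t x) q = s / n * R ^ 2 / a := fun x => by
    rw [hq, inner_smul_right, hFC]; field_simp
  have hqq : inner ℝ q q = s / n * R ^ 2 / a := by
    rw [hq, inner_smul_right, real_inner_smul_left, hCC]; field_simp
  have hmq : ∀ x, inner ℝ (F t x - q) q = 0 := fun x => by
    rw [inner_sub_left, hFq, hqq, sub_self]
  have hq0 : q ≠ 0 := by
    rw [← inner_self_ne_zero (𝕜 := ℝ), hqq]; positivity
  have hqR : ‖q‖ < R := by
    rw [← sq_lt_sq₀ (norm_nonneg q) hR.le, ← real_inner_self_eq_norm_sq, hqq, div_lt_iff₀ hapos, ha]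
    have : 0 < n * K * R ^ 2 := by positivity
    nlinarith
  have hm0 : ∀ x, F t x - q ≠ 0 := fun x h => by
    have h1 := mem_sphere_zero_iff_norm.1 (hF.mem_sphere t ht x)
    rw [sub_eq_zero.1 h] at h1
    exact hqR.ne h1
  have hqe : ∀ x (c : GraphChart F t x) i, inner ℝ q (c.e i) = 0 := fun x c i => by
    rw [hq, real_inner_smul_left, ← hCx x, inner_add_left, real_inner_smul_left,
      c.inner_meanCurv_e hF ht hR, c.inner_base_e hF ht]
    simp
  have hme : ∀ x (c : GraphChart F t x) i, inner ℝ (F t x - q) (c.e i) = 0 := fun x c i => by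
    rw [inner_sub_left, hqe, c.inner_base_e hF ht, sub_zero]
  -- A sum of squares with positive weights vanishes only termwise. Together with
  -- `gradNormSq_add_eq`, this makes the orthogonal complement of the span the same at all points.
  have horth : ∀ x (c : GraphChart F t x) w, w ∈ (frameSpan (F t x - q) c.e)ᗮ
      ↔ gradNormSq (F t) w x + (s / n ^ 2 + K) * inner ℝ (F t x - q) w ^ 2 = 0 := fun x c w => by
    rw [mem_frameSpan_orthogonal, c.gradNormSq_base hF ht]
    have h1 : 0 ≤ ∑ i, (inner ℝ (c.e i) w : ℝ) ^ 2 := sum_nonneg fun i _ => sq_nonneg _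
    have h2 : 0 < s / n ^ 2 + K := by positivity
    constructor
    · rintro ⟨h3, h4⟩
      simp [h3, h4]
    · intro h
      have h3 : 0 ≤ (s / n ^ 2 + K) * (inner ℝ (F t x - q) w : ℝ) ^ 2 := by positivity
      have h4 : (s / n ^ 2 + K) * (inner ℝ (F t x - q) w : ℝ) ^ 2 = 0 := by linarith
      have h5 : ∑ i, (inner ℝ (c.e i) w : ℝ) ^ 2 = 0 := by linarith
      refine ⟨pow_eq_zero_iff two_ne_zero |>.1 ((mul_eq_zero.1 h4).resolve_left h2.ne'), fun i => ?_⟩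
      exact pow_eq_zero_iff two_ne_zero |>.1
        ((sum_eq_zero_iff_of_nonneg fun i _ => sq_nonneg _).1 h5 i (mem_univ _))
  obtain ⟨c₀⟩ := hF.exists_graphChart ht x₀
  set U := frameSpan (F t x₀ - q) c₀.e with hU
  have hspan : ∀ x (c : GraphChart F t x), U = frameSpan (F t x - q) c.e := fun x c => by
    rw [← Submodule.orthogonal_orthogonal U,
      ← Submodule.orthogonal_orthogonal (frameSpan (F t x - q) c.e)]
    congr 1
    ext w
    rw [hU, horth, horth, gradNormSq_add_eq hF hR hn hum ht hmc w x x₀]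
  have hmem : ∀ x, F t x - q ∈ U := fun x => by
    obtain ⟨c⟩ := hF.exists_graphChart ht x
    rw [hspan x c]; exact mem_frameSpan_self
  have hqU : q ∈ Uᗮ := by
    refine mem_frameSpan_orthogonal.2 ⟨hmq x₀, fun i => ?_⟩
    rw [real_inner_comm]; exact hqe x₀ c₀ i
  have hfin : Module.finrank ℝ U = n + 1 :=
    finrank_frameSpan c₀.orthonormal_e (hm0 x₀) (hme x₀ c₀)
  refine ⟨U, q, hfin, hqU, hq0, hqR, hmem, fun x x' => ?_, ?_⟩
  · rw [hs x']; exact hmc x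
  · exact range_eq_subsphere hF hn ht hqU hqR hfin hmem hspan

end Slice

end SphereMCF

end

/-! ### Motion of the spheres in time. -/

noncomputable section

namespace SphereMCF

set_option linter.unusedSimpArgs false

open Matrix Finset Filter Topology smoothGerm

theorem eq_of_hasDerivAt_zero_of_neg {V : Type*} [NormedAddCommGroup V] [NormedSpace ℝ V]
    {f : ℝ → V} (h : ∀ t < 0, HasDerivAt f 0 t) {t t' : ℝ} (ht : t < 0) (ht' : t' < 0) :
    f t = f t' :=
  isOpen_Iio.is_const_of_deriv_eq_zero isPreconnected_Iio
    (fun s hs => (h s hs).differentiableAt.differentiableWithinAt) (fun s hs => (h s hs).deriv) ht ht'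

theorem finrank_sup_span_singleton {V : Type*} [NormedAddCommGroup V] [InnerProductSpace ℝ V]
    [FiniteDimensional ℝ V] {U : Submodule ℝ V} {p : V} (hp : p ∈ Uᗮ) (hp0 : p ≠ 0) :
    Module.finrank ℝ ↥(U ⊔ Submodule.span ℝ {p}) = Module.finrank ℝ U + 1 := by
  have h1 := Submodule.finrank_sup_add_finrank_inf_eq U (Submodule.span ℝ {p})
  have h2 : U ⊓ Submodule.span ℝ {p} = ⊥ := by
    rw [eq_bot_iff, ← Submodule.inf_orthogonal_eq_bot U]
    exact inf_le_inf_left _ ((Submodule.span_singleton_le_iff_mem _ _).2 hp)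
  rw [h2, finrank_bot, add_zero, finrank_span_singleton hp0] at h1
  exact h1

/-- A family of subspheres whose centres move exponentially along a line orthogonal to them is a
shrinking cap. -/
theorem isShrinkingSphericalCap_of_subspheres {n k : ℕ} {R : ℝ} (hR : 0 < R) (hn : n ≠ 0)
    {Γ : ℝ → Set (Ambient n k)} {U : Submodule ℝ (Ambient n k)} {p₀ : Ambient n k}
    (hU : Module.finrank ℝ U = n + 1) (hp₀ : p₀ ∈ Uᗮ) (hp₀0 : p₀ ≠ 0)
    (hle : ∀ t < 0, Real.exp (n * (R ^ 2)⁻¹ * t) * ‖p₀‖ < R)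
    (hΓ : ∀ t < 0, Γ t = {y | y - Real.exp (n * (R ^ 2)⁻¹ * t) • p₀ ∈ U ∧ ‖y‖ = R}) :
    IsShrinkingSphericalCap R Γ := by
  have hnpos : (0 : ℝ) < n := by positivity
  set c := (n : ℝ) * (R ^ 2)⁻¹ with hc
  have hcpos : 0 < c := by positivity
  set A := ‖p₀‖ with hA
  have hApos : 0 < A := norm_pos_iff.2 hp₀0
  -- The strict bounds for t < 0 pass to the limit t → 0; this is what gives T ≥ 0.
  have hAR : A ≤ R := by
    have hlim : Tendsto (fun t : ℝ => Real.exp (c * t) * A) (𝓝[<] 0) (𝓝 A) := by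
      have h1 : Continuous fun t : ℝ => Real.exp (c * t) * A := by fun_prop
      have h2 := h1.tendsto 0
      simp only [mul_zero, Real.exp_zero, one_mul] at h2
      exact h2.mono_left nhdsWithin_le_nhds
    refine le_of_tendsto hlim ?_
    filter_upwards [self_mem_nhdsWithin] with t ht
    exact (hle t ht).le
  set p := A⁻¹ • p₀ with hp
  have hpU : p ∈ Uᗮ := Submodule.smul_mem _ _ hp₀
  have hpn : ‖p‖ = 1 := by
    rw [hp, norm_smul, norm_inv, Real.norm_of_nonneg hApos.le, inv_mul_cancel₀ hApos.ne']
  have hp0 : p ≠ 0 := by rw [← norm_pos_iff, hpn]; exact one_pos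
  have hpp : inner ℝ p p = (1 : ℝ) := by rw [real_inner_self_eq_norm_sq, hpn, one_pow]
  have hup : ∀ u ∈ U, inner ℝ u p = (0 : ℝ) := fun u hu =>
    Submodule.inner_right_of_mem_orthogonal hu hpU
  -- The time at which the centre Re^{c(t-T)} p reaches the pole Rp, i.e. e^{cT} A = R.
  set T := -Real.log (A / R) / c with hT
  have hexp : ∀ t, R * Real.exp (n * (t - T) / R ^ 2) = Real.exp (c * t) * A := fun t => by
    have h1 : n * (t - T) / R ^ 2 = c * t + Real.log (A / R) := by
      have h2 : c * T = -Real.log (A / R) := mul_div_cancel₀ _ hcpos.ne'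
      have h3 : n * (t - T) / R ^ 2 = c * t - c * T := by rw [hc]; ring
      rw [h3, h2]; ring
    rw [h1, Real.exp_add, Real.exp_log (by positivity)]
    field_simp
  refine ⟨U ⊔ Submodule.span ℝ {p}, p, T, ?_, ?_, hpn, ?_, fun t ht => ?_⟩
  · rw [finrank_sup_span_singleton hpU hp0, hU]
  · exact Submodule.mem_sup_right (Submodule.mem_span_singleton_self p)
  · refine div_nonneg (neg_nonneg.2 (Real.log_nonpos (by positivity) ?_)) hcpos.le
    exact (div_le_one hR).2 hAR
  · have hq : Real.exp (c * t) • p₀ = (Real.exp (c * t) * A) • p := by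
      rw [hp, smul_smul, mul_inv_cancel_right₀ hApos.ne']
    rw [hΓ t ht]
    ext y
    simp only [Set.mem_ofPred_eq, mem_sphere_zero_iff_norm, hexp, hq]
    constructor
    · rintro ⟨h1, h2⟩
      refine ⟨?_, h2, ?_⟩
      · rw [← sub_add_cancel y ((Real.exp (c * t) * A) • p)]
        exact add_mem (Submodule.mem_sup_left h1)
          (Submodule.mem_sup_right (Submodule.smul_mem _ _ (Submodule.mem_span_singleton_self p)))
      · have h3 := hup _ h1
        rw [inner_sub_left, real_inner_smul_left, hpp] at h3
        linarith
    · rintro ⟨h1, h2, h3⟩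
      refine ⟨?_, h2⟩
      obtain ⟨u, hu, w, hw, rfl⟩ := Submodule.mem_sup.1 h1
      obtain ⟨b, rfl⟩ := Submodule.mem_span_singleton.1 hw
      rw [inner_add_left, real_inner_smul_left, hup u hu, hpp, zero_add, mul_one] at h3
      rw [h3, add_sub_cancel_right]
      exact hu

section Cap

variable {n k : ℕ} {M : Type*} [TopologicalSpace M] [CompactSpace M] [ConnectedSpace M]
  [ChartedSpace (EuclideanSpace ℝ (Fin n)) M] [IsManifold (𝓡 n) ∞ M] {R : ℝ}
  {F : ℝ → M → Ambient n k}

omit [CompactSpace M] [ConnectedSpace M] in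
theorem IsAncientSolution.continuousAt_meanCurv (hF : IsAncientSolution R F) (hR : 0 < R) (x : M)
    {t : ℝ} (ht : t < 0) : ContinuousAt (fun t => meanCurv (F t) x) t := by
  obtain ⟨c⟩ := hF.exists_graphChart ht x
  have h1 : ContinuousAt (fun s : ℝ => ((s, 0) : Param n)) t := by fun_prop
  have h2 := ContinuousAt.comp (f := fun s : ℝ => ((s, 0) : Param n))
    (c.contDiffAt_meanCurv hF ht hR).continuousAt h1
  have h3 : ((fun z : Param n => meanCurv (F z.1) (c.χ z.2)) ∘ fun s : ℝ => ((s, 0) : Param n))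
      = fun s => meanCurv (F s) x := by
    funext s
    simp only [Function.comp_apply, c.χ_zero]
  rwa [h3] at h2

/-- A totally umbilic ancient solution with nowhere vanishing mean curvature is a shrinking
spherical cap. -/
theorem IsAncientSolution.isShrinkingSphericalCap (hF : IsAncientSolution R F) (hR : 0 < R)
    (hn : 2 ≤ n) (hum : ∀ t < 0, ∀ x, tracelessNormSq F t x = 0)
    (hH : ∀ t < 0, ∀ x, 0 < ‖meanCurv (F t) x‖) :
    IsShrinkingSphericalCap R (fun t => Set.range (F t)) := by
  obtain ⟨x₀⟩ : Nonempty M := inferInstance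
  have hn0 : n ≠ 0 := by omega
  have hR2 : 0 < R ^ 2 := by positivity
  choose! U q hfin hqU hq0 hqR hmem hmc hrange using
    fun t (ht : t < 0) => hF.exists_slice hR hn hum hH ht
  set σ : ℝ → ℝ := fun t => ‖meanCurv (F t) x₀‖ ^ 2 / n with hσ
  have hσc : ContinuousOn σ (Set.Iio 0) := fun t ht =>
    (((hF.continuousAt_meanCurv hR x₀ ht).norm.pow 2).div_const _).continuousWithinAt
  -- An integrating factor: differences of points satisfy d' = -σd, so e^Λ d is constant. The base
  -- point -1 is an arbitrary negative time.
  set Λ : ℝ → ℝ := fun t => ∫ u in (-1)..t, σ u with hΛdef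
  have hΛ : ∀ t < 0, HasDerivAt Λ (σ t) t := fun t ht => by
    refine intervalIntegral.integral_hasDerivAt_right ?_
      (hσc.stronglyMeasurableAtFilter isOpen_Iio t ht) (hσc.continuousAt (Iio_mem_nhds ht))
    refine (hσc.mono fun u hu => ?_).intervalIntegrable
    exact hu.2.trans_lt (max_lt (by norm_num) ht)
  have hdiff : ∀ x x' t, t < 0 → ∀ t', t' < 0 →
      Real.exp (Λ t) • (F t x - F t x') = Real.exp (Λ t') • (F t' x - F t' x') := by
    intro x x' t ht t' ht'
    refine eq_of_hasDerivAt_zero_of_neg (f := fun t => Real.exp (Λ t) • (F t x - F t x'))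
      (fun t ht => ?_) ht ht'
    have h1 := (hΛ t ht).exp.smul ((hF.flow t ht x).sub (hF.flow t ht x'))
    refine h1.congr_deriv ?_
    rw [hmc t ht x x₀, hmc t ht x' x₀]
    change _ • ((_ - σ t • _) - (_ - σ t • _)) + _ = _
    simp only [Pi.sub_apply]
    module
  -- Each u in U t is a multiple of the difference of two antipodal points of the slice, and such a
  -- difference keeps its direction in time.
  have hUle : ∀ t, t < 0 → ∀ t', t' < 0 → U t ≤ U t' := by
    intro t ht t' ht' u hu
    rcases eq_or_ne u 0 with rfl | hu0
    · exact zero_mem _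
    have hunorm : 0 < ‖u‖ := norm_pos_iff.2 hu0
    have hpos : 0 < R ^ 2 - ‖q t‖ ^ 2 := by
      have := hqR t ht
      nlinarith [norm_nonneg (q t)]
    set ρ := √(R ^ 2 - ‖q t‖ ^ 2) with hρ
    have hρpos : 0 < ρ := Real.sqrt_pos.2 hpos
    have hρsq : ρ ^ 2 = R ^ 2 - ‖q t‖ ^ 2 := Real.sq_sqrt hpos.le
    have hin : ∀ a : ℝ, |a| = ρ / ‖u‖ → ∃ x, F t x = a • u + q t := by
      intro a ha
      have h1 : a • u + q t ∈ Set.range (F t) := by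
        rw [hrange t ht]
        refine ⟨by rw [add_sub_cancel_right]; exact Submodule.smul_mem _ _ hu, ?_⟩
        have h2 : inner ℝ (a • u) (q t) = 0 :=
          Submodule.inner_right_of_mem_orthogonal (Submodule.smul_mem _ a hu) (hqU t ht)
        rw [← sq_eq_sq₀ (norm_nonneg _) hR.le, norm_add_sq_real, h2, norm_smul, Real.norm_eq_abs, ha,
          div_mul_cancel₀ _ hunorm.ne', hρsq]
        ring
      exact h1
    have hapos : 0 < ρ / ‖u‖ := by positivity
    obtain ⟨x, hx⟩ := hin (ρ / ‖u‖) (abs_of_pos hapos)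
    obtain ⟨x', hx'⟩ := hin (-(ρ / ‖u‖)) (by rw [abs_neg, abs_of_pos hapos])
    have h3 : F t x - F t x' = (2 * (ρ / ‖u‖)) • u := by
      rw [hx, hx']; module
    have h4 : F t' x - F t' x' ∈ U t' := by
      have := sub_mem (hmem t' ht' x) (hmem t' ht' x')
      rwa [sub_sub_sub_cancel_right] at this
    have h5 : Real.exp (Λ t) • (2 * (ρ / ‖u‖)) • u ∈ U t' := by
      rw [← h3, hdiff x x' t ht t' ht']
      exact Submodule.smul_mem _ _ h4
    rw [smul_smul] at h5
    exact (Submodule.smul_mem_iff _ (by positivity)).1 h5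
  have h1 : (-1 : ℝ) < 0 := by norm_num
  set U₀ := U (-1) with hU₀
  have hU : ∀ t < 0, U t = U₀ := fun t ht => le_antisymm (hUle t ht _ h1) (hUle _ h1 t ht)
  set P := U₀ᗮ.starProjection with hP
  have hPq : ∀ t < 0, P (q t) = q t := fun t ht =>
    Submodule.starProjection_eq_self_iff.2 (by rw [← hU t ht]; exact hqU t ht)
  have hPm : ∀ t < 0, ∀ x, P (F t x - q t) = 0 := fun t ht x => by
    rw [hP, Submodule.starProjection_apply_eq_zero_iff, Submodule.orthogonal_orthogonal, ← hU t ht]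
    exact hmem t ht x
  set c := (n : ℝ) * (R ^ 2)⁻¹ with hc
  have hPF : ∀ t < 0, P (F t x₀) = q t := fun t ht => by
    have := hPm t ht x₀
    rw [map_sub, hPq t ht] at this
    exact sub_eq_zero.1 this
  -- q is the projection of F(x₀) to U₀^⊥, and the flow equation projects to q' = nKq. The function
  -- s(t) drops out and need not be found.
  have hqd : ∀ t < 0, HasDerivAt q (c • q t) t := fun t ht => by
    have h2 := (P.hasFDerivAt.comp_hasDerivAt t (hF.flow t ht x₀))
    rw [hmc t ht x₀ x₀, map_sub, map_smul, map_smul, hPq t ht, hPm t ht, smul_zero, sub_zero] at h2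
    refine h2.congr_of_eventuallyEq ?_
    filter_upwards [Iio_mem_nhds ht] with s hs
    exact (hPF s hs).symm
  have hqc : ∀ t < 0, Real.exp (-(c * t)) • q t = Real.exp (-(c * -1)) • q (-1) := fun t ht => by
    refine eq_of_hasDerivAt_zero_of_neg (f := fun t => Real.exp (-(c * t)) • q t) (fun t ht => ?_)
      ht h1
    have h2 : HasDerivAt (fun t => -(c * t)) (-c) t := by
      have h3 := ((hasDerivAt_id' t).const_mul c).neg
      rw [mul_one] at h3
      exact h3
    refine (h2.exp.smul (hqd t ht)).congr_deriv ?_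
    module
  set p₀ := Real.exp (-(c * -1)) • q (-1) with hp₀
  have hqp : ∀ t < 0, q t = Real.exp (c * t) • p₀ := fun t ht => by
    rw [← hqc t ht, smul_smul, ← Real.exp_add, add_neg_cancel, Real.exp_zero, one_smul]
  refine isShrinkingSphericalCap_of_subspheres hR hn0 (U := U₀) (p₀ := p₀) (hfin _ h1)
    (Submodule.smul_mem _ _ (hqU _ h1)) (smul_ne_zero (Real.exp_pos _).ne' (hq0 _ h1))
    (fun t ht => ?_) (fun t ht => ?_)
  · have := hqR t ht
    rwa [hqp t ht, norm_smul, Real.norm_of_nonneg (Real.exp_pos _).le] at this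
  · rw [← hqp t ht, ← hU t ht]
    exact hrange t ht

end Cap

end SphereMCF

end

/-! ### From the pinching hypotheses to the conclusion. -/

noncomputable section

namespace SphereMCF

section Pinched

variable {n k : ℕ} {M : Type*} [TopologicalSpace M] [CompactSpace M] [ConnectedSpace M]
  [ChartedSpace (EuclideanSpace ℝ (Fin n)) M] [IsManifold (𝓡 n) ∞ M] {R : ℝ}
  {F : ℝ → M → Ambient n k}

/-- A pinched ancient solution is a shrinking spherical cap. -/
theorem IsAncientSolution.isShrinkingSphericalCap_of_pinched (hF : IsAncientSolution R F)
    (hR : 0 < R) (hn : 2 ≤ n) (hH : ∀ t < 0, ∀ x, 0 < ‖meanCurv (F t) x‖) {b : ℝ} (hb : 0 ≤ b)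
    (hbn : 2 * b < n)
    (hpinch : ∀ t < 0, ∀ x, secondFundFormNormSq (F t) x
      ≤ 4 / (3 * n) * ‖meanCurv (F t) x‖ ^ 2 + b * (1 / R ^ 2)) :
    IsShrinkingSphericalCap R (fun t => Set.range (F t)) := by
  have hn0 : (0 : ℝ) < n := by positivity
  refine hF.isShrinkingSphericalCap hR hn (fun t ht x =>
    hF.tracelessNormSq_eq_zero hR hn hH hb hbn (fun t ht x => ?_) ht x) hH
  have h1 := hpinch t ht x
  have h2 : 4 / (3 * n) * ‖meanCurv (F t) x‖ ^ 2
      = ‖meanCurv (F t) x‖ ^ 2 / n + ‖meanCurv (F t) x‖ ^ 2 / (3 * n) := by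
    field_simp
    ring
  rw [h2, one_div] at h1
  rw [tracelessNormSq, pinchingWeight]
  linarith

end Pinched

end SphereMCF

end

theorem mainTheorem6 {n k : ℕ} (hn : 2 ≤ n) (hk : 1 ≤ k) {R : ℝ} (hR : 0 < R)
    {M : Type*} [TopologicalSpace M] [T2Space M] [CompactSpace M] [ConnectedSpace M]
    [ChartedSpace (EuclideanSpace ℝ (Fin n)) M] [IsManifold (𝓡 n) ∞ M]
    (F : ℝ → M → SphereMCF.Ambient n k) (hF : SphereMCF.IsAncientSolution R F)
    (hH : ∀ t < 0, ∀ x, 0 < ‖SphereMCF.meanCurv (F t) x‖) :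
    (((n = 4 ∧ ∃ δ : ℝ, 0 < δ ∧ ∀ t < 0, ∀ x,
          SphereMCF.secondFundFormNormSq (F t) x - 1 / 3 * ‖SphereMCF.meanCurv (F t) x‖ ^ 2
            ≤ (2 - δ) * (1 / R ^ 2)) ∨
        (5 ≤ n ∧ ∀ t < 0, ∀ x,
          SphereMCF.secondFundFormNormSq (F t) x
              - 1 / ((n : ℝ) - 1) * ‖SphereMCF.meanCurv (F t) x‖ ^ 2
            ≤ 2 * (1 / R ^ 2))) →
      SphereMCF.IsShrinkingSphericalCap R (fun t => Set.range (F t)) ∨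
        SphereMCF.IsTotallyGeodesicSphere R (fun t => Set.range (F t))) ∧
    ((∀ t < 0, ∀ x,
        SphereMCF.secondFundFormNormSq (F t) x
          ≤ 4 / (3 * (n : ℝ)) * ‖SphereMCF.meanCurv (F t) x‖ ^ 2) →
      SphereMCF.IsShrinkingSphericalCap R (fun t => Set.range (F t))) := by
  have hnr : (2 : ℝ) ≤ n := by exact_mod_cast hn
  have hK : 0 < 1 / R ^ 2 := by positivity
  -- A totally geodesic sphere has H = 0, so only the cap can occur.
  refine ⟨fun h => Or.inl ?_, fun h => ?_⟩
  · rcases h with ⟨rfl, δ, hδ, h⟩ | ⟨hn5, h⟩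
    -- For n = 4 the condition 2b < n needs b < 2, which δ provides; the minimum with 1 keeps b
    -- nonnegative when δ is large.
    · refine hF.isShrinkingSphericalCap_of_pinched hR hn hH (b := 2 - min δ 1) ?_ ?_
        fun t ht x => ?_
      · linarith [min_le_right δ 1]
      · have := lt_min hδ one_pos
        push_cast
        linarith
      · have h1 := h t ht x
        have h2 : (2 - δ) * (1 / R ^ 2) ≤ (2 - min δ 1) * (1 / R ^ 2) :=
          mul_le_mul_of_nonneg_right (by linarith [min_le_left δ 1]) hK.le
        push_cast
        linarith
    · have hn5r : (5 : ℝ) ≤ n := by exact_mod_cast hn5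
      refine hF.isShrinkingSphericalCap_of_pinched hR hn hH (b := 2) (by norm_num) (by linarith)
        fun t ht x => ?_
      have h1 := h t ht x
      -- Equivalent to n ≥ 4; what requires n ≥ 5 is 2b = 4 < n.
      have h2 : 1 / ((n : ℝ) - 1) ≤ 4 / (3 * n) := by
        rw [div_le_div_iff₀ (by linarith) (by linarith)]
        linarith
      have h3 := mul_le_mul_of_nonneg_right h2 (sq_nonneg ‖SphereMCF.meanCurv (F t) x‖)
      linarith
  · refine hF.isShrinkingSphericalCap_of_pinched hR hn hH (b := 0) le_rfl (by linarith)
      fun t ht x => ?_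
    rw [zero_mul, add_zero]
    exact h t ht x
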